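/- **Theorem.** Let $u_0$ be a real function on $[0,1]$ that is piecewise Lipschitz: there is a partition $0=x_0<x_1<\dots<x_{k+1}=1$ such that $u_0$ is Lipschitz on each open interval $(x_j,x_{j+1})$. Write $u_0(0)$ and $u_0(1)$ for the one-sided limits $u_0(0^+)$ and $u_0(1^-)$ (they are the values of $u_0$ when $u_0$ is continuous at the endpoints). Consider $$u_t+u_{xxx}=0\ \ (x\in(0,1),\ t\in\mathbb R),\qquad u(0,t)=u(1,t)=0,\quad u_x(1,t)=u_x(0,t),\qquad u(\cdot,0)=u_0 .$$ A solution is a continuous map $t\mapsto u(\cdot,t)$ from $\mathbb R$ to $L^2((0,1);\mathbb{R})$ with $u(\cdot,0)=u_0$ and $\frac{\mathrm d}{\mathrm dt}\int_0^1u\,\varphi\,\mathrm dx=\int_0^1u\,\varphi'''\,\mathrm dx$ for all $t\in\mathbb R$ and all smooth real $\varphi$ on $[0,1]$ with $\varphi(0)=\varphi(1)=0$ and $\varphi'(1)=\varphi'(0)$. Identities between functions of $x\in(0,1)$ hold for almost every $x$, and series of functions of $x$ converge in $L^2(0,1)$. There is exactly one solution $u$, and for all $t\in\mathbb R$ $$u(x,t)=U_{\mathcal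 R}(x,t)+U_{\mathcal C}(x,t),$$ where $U_{\mathcal C}(\cdot,t)$ is continuous on $(0,1)$ and $$U_{\mathcal R}(x,t)=\sum_{n=1}^\infty 2\operatorname{Re}\Big[\widetilde{u_0}(n)\,e^{i(2n-\frac13)^3\pi^3t}\,e^{i(2n-\frac13)\pi x}\Big],\qquad \widetilde{u_0}(n)=\int_0^1[u_0(y)+u_0(1)+u_0(0)]\,e^{-i(2n-\frac13)\pi y}\,\mathrm dy .$$ The series for $U_{\mathcal R}(\cdot,t)$ converges for every $t$. If $p,q\in\mathbb N$ are coprime and $q\ge1$, then $$U_{\mathcal R}\Big(x,\frac p{q\pi^2}\Big)=\operatorname{Re}\Big\{e^{-i\frac{\pi}{27}(9x+\frac pq)}\,[L_1(x)+iL_2(x)-L_3]\Big\},$$ where $$L_1(x)=\sum_{k=0}^{q-1}d_k^{p,q}\,G_{u_0}\Big(x+\frac p{3q}-\frac kq\Big),\qquad L_2(x)=\sum_{k=0}^{q-1}d_k^{p,q}\,[\mathcal HG_{u_0}]\Big(x+\frac p{3q}-\frac kq\Big),\qquad L_3=\int_0^1G_{u_0}(y)\,\mathrm dy,$$ $G_{u_0}(x)=[u_0(x)+u_0(1)+u_0(0)]\,e^{i\pi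 x/3}$ for $x\in[0,1)$, extended $1$-periodically to $\mathbb R$, and the scalars $$d_k^{p,q}=\frac1q\sum_{m=0}^{q-1}e^{2\pi i\left(mk+[4m^3-2m^2]p\right)/q}$$ do not depend on $u_0$. Here $\mathcal H$ is the $1$-periodic Hilbert transform $$\mathcal Hv(x)=i\sum_{n=1}^\infty\big[\hat v(-n)e^{-2\pi inx}-\hat v(n)e^{2\pi inx}\big],\qquad \hat v(n)=\int_0^1v(y)e^{-2\pi iny}\,\mathrm dy .$$ -/

import Mathlib

open MeasureTheory Set

namespace AiryRevival

noncomputable section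

/-- `u₀` is piecewise Lipschitz on `[0,1]`: there is a partition
`0 = x₀ < x₁ < ⋯ < x_{k+1} = 1` such that `u₀` is Lipschitz on every open piece
`(x_j, x_{j+1})`. Nothing is required of the values at the partition points. -/
def PiecewiseLipschitz (u₀ : ℝ → ℝ) : Prop :=
  ∃ (k : ℕ) (x : Fin (k + 2) → ℝ), StrictMono x ∧ x 0 = 0 ∧ x (Fin.last (k + 1)) = 1 ∧
    ∀ j : Fin (k + 1), ∃ K : NNReal, LipschitzOnWith K u₀ (Ioo (x j.castSucc) (x j.succ))

/-- Lebesgue measure on `(0,1)`. -/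
abbrev volI : Measure ℝ := volume.restrict (Ioo (0 : ℝ) 1)

/-- The real Hilbert space `L²(0,1)`. -/
abbrev L2I : Type := Lp ℝ 2 volI

/-- Smooth functions on `[0,1]` that satisfy the boundary conditions
`φ(0) = φ(1) = 0`, `φ'(1) = φ'(0)`. -/
structure IsTestFunction (φ : ℝ → ℝ) : Prop where
  smooth : ContDiff ℝ (⊤ : ℕ∞) φ
  zero_left : φ 0 = 0
  zero_right : φ 1 = 0
  deriv_eq : deriv φ 1 = deriv φ 0

/-- `u` is a (weak) solution, continuous in time with values in `L²(0,1)`, of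
`u_t + u_xxx = 0` on `(0,1)`, `u(0,t) = u(1,t) = 0`, `u_x(1,t) = u_x(0,t)`, `u(·,0) = u₀`.

Three integrations by parts turn the equation, tested with `φ`, into
`d/dt ∫ u φ = ∫ u φ'''`. All boundary terms `[u_xx φ - u_x φ' + u φ'']₀¹` vanish because of the
boundary conditions on `u` and on `φ`, and it is through these terms that the boundary conditions
on `u` are imposed: the operator `-∂ₓ³` with these boundary conditions is skew-adjoint, so
`∂ₓ³` on the test functions is (a core of) its adjoint. -/
structure IsAirySolution (u₀ : ℝ → ℝ) (u : ℝ → L2I) : Prop where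
  continuous : Continuous u
  initial : ∀ᵐ x ∂volI, u 0 x = u₀ x
  weak : ∀ φ : ℝ → ℝ, IsTestFunction φ → ∀ t : ℝ,
    HasDerivAt (fun s => ∫ x, u s x * φ x ∂volI) (∫ x, u t x * iteratedDeriv 3 φ x ∂volI) t

/-- The approximate wave number `(2n - 1/3)π`. -/
def waveNumber (n : ℕ) : ℝ := (2 * (n : ℝ) - 1 / 3) * Real.pi

/-- The function `u₀(y) + u₀(1) + u₀(0)` on `(0,1)`, where the boundary values are those of `u₀`
seen from inside the interval, that is `u₀(1⁻)` and `u₀(0⁺)`. -/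
def shifted (u₀ : ℝ → ℝ) (y : ℝ) : ℝ :=
  u₀ y + Function.leftLim u₀ 1 + Function.rightLim u₀ 0

/-- The coefficients `∫₀¹ [u₀(y) + u₀(1) + u₀(0)] e^{-i(2n-1/3)πy} dy`. -/
def revivalCoeff (u₀ : ℝ → ℝ) (n : ℕ) : ℂ :=
  ∫ y in (0 : ℝ)..1, (shifted u₀ y : ℂ) * Complex.exp (-Complex.I * waveNumber n * y)

/-- The `n`-th term of the series for `U_R`, as a function of `x`. -/
def revivalTermFun (u₀ : ℝ → ℝ) (t : ℝ) (n : ℕ) (x : ℝ) : ℝ :=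
  2 * (revivalCoeff u₀ n * Complex.exp (Complex.I * (waveNumber n : ℂ) ^ 3 * t) *
    Complex.exp (Complex.I * waveNumber n * x)).re

theorem memLp_revivalTermFun (u₀ : ℝ → ℝ) (t : ℝ) (n : ℕ) :
    MemLp (revivalTermFun u₀ t n) 2 volI := by
  have hc : Continuous (revivalTermFun u₀ t n) := by
    unfold revivalTermFun
    fun_prop
  refine MemLp.of_bound hc.aestronglyMeasurable
    (2 * ‖revivalCoeff u₀ n * Complex.exp (Complex.I * (waveNumber n : ℂ) ^ 3 * t)‖)
    (Filter.Eventually.of_forall fun x => ?_)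
  unfold revivalTermFun
  rw [norm_mul, Real.norm_eq_abs, Real.norm_eq_abs, abs_of_pos (by norm_num : (0 : ℝ) < 2)]
  gcongr
  refine (Complex.abs_re_le_norm _).trans ?_
  rw [norm_mul]
  have : ‖Complex.exp (Complex.I * waveNumber n * x)‖ = 1 := by
    have h : Complex.I * waveNumber n * x = ((waveNumber n * x : ℝ) : ℂ) * Complex.I := by
      push_cast; ring
    rw [h, Complex.norm_exp_ofReal_mul_I]
  rw [this, mul_one]

/-- The `n`-th term of the series for `U_R`, as an element of `L²(0,1)`. -/
def revivalTerm (u₀ : ℝ → ℝ) (t : ℝ) (n : ℕ) : L2I :=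
  (memLp_revivalTermFun u₀ t n).toLp (revivalTermFun u₀ t n)

/-- `U_R(·,t)`, the sum of the series over `n ≥ 1` in `L²(0,1)`. -/
def revivalPart (u₀ : ℝ → ℝ) (t : ℝ) : L2I :=
  ∑' n : ℕ, revivalTerm u₀ t (n + 1)

/-- The `1`-periodic Hilbert transform
`𝓗 g = i ∑_{n ≥ 1} [ĝ(-n) e^{-2πinx} - ĝ(n) e^{2πinx}]` (series in `L²` of the circle `ℝ/ℤ`)
of a square integrable function `g` on `ℝ/ℤ`. -/
def periodicHilbert (g : UnitAddCircle → ℂ) :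
    Lp ℂ 2 (AddCircle.haarAddCircle (T := (1 : ℝ))) :=
  Complex.I • ∑' n : ℕ, (fourierCoeff g (-((n : ℤ) + 1)) • fourierLp 2 (-((n : ℤ) + 1))
    - fourierCoeff g ((n : ℤ) + 1) • fourierLp 2 ((n : ℤ) + 1))

/-- The series in the definition of the periodic Hilbert transform converges in `L²` for every
square integrable function. -/
theorem summable_periodicHilbert (g : UnitAddCircle → ℂ)
    (hg : MemLp g 2 (AddCircle.haarAddCircle (T := (1 : ℝ)))) :
    Summable fun n : ℕ => (fourierCoeff g (-((n : ℤ) + 1)) •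
        (fourierLp 2 (-((n : ℤ) + 1)) : Lp ℂ 2 (AddCircle.haarAddCircle (T := (1 : ℝ))))
      - fourierCoeff g ((n : ℤ) + 1) • fourierLp 2 ((n : ℤ) + 1)) := by
  have h := (hasSum_fourier_series_L2 (hg.toLp g)).summable
  have hco : ∀ m : ℤ, fourierCoeff (hg.toLp g) m = fourierCoeff g m := fun m =>
    integral_congr_ae (hg.coeFn_toLp.mono fun x hx => by simp only [hx])
  simp only [hco] at h
  refine Summable.sub ?_ ?_
  · exact h.comp_injective (i := fun n : ℕ => -((n : ℤ) + 1)) fun a b hab => by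
      simp only at hab; omega
  · exact h.comp_injective (i := fun n : ℕ => (n : ℤ) + 1) fun a b hab => by
      simp only at hab; omega

/-- `G_{u₀}(x) = [u₀(x) + u₀(1) + u₀(0)] e^{iπx/3}`, for `x` in the unit interval. -/
def G (u₀ : ℝ → ℝ) (x : ℝ) : ℂ :=
  (shifted u₀ x : ℂ) * Complex.exp (Complex.I * Real.pi * x / 3)

/-- The `1`-periodic extension of `G_{u₀}` from `[0,1)`, as a function on `ℝ/ℤ`. -/
def Gper (u₀ : ℝ → ℝ) : UnitAddCircle → ℂ :=
  AddCircle.liftIco 1 0 (G u₀)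

/-- The scalars `d_k^{p,q} = (1/q) ∑_{m=0}^{q-1} e^{2πi(mk + (4m³ - 2m²)p)/q}`. -/
def dCoeff (p q k : ℕ) : ℂ :=
  (1 / (q : ℂ)) * ∑ m ∈ Finset.range q,
    Complex.exp (2 * Real.pi * Complex.I *
      ((m : ℂ) * k + (4 * (m : ℂ) ^ 3 - 2 * (m : ℂ) ^ 2) * p) / q)

/-- The translated point `x + p/(3q) - k/q`. -/
def shiftPoint (p q k : ℕ) (x : ℝ) : ℝ := x + (p : ℝ) / (3 * q) - (k : ℝ) / q

/-- `L₁(x) = ∑_{k<q} d_k^{p,q} G_{u₀}(x + p/(3q) - k/q)`. -/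
def L₁ (u₀ : ℝ → ℝ) (p q : ℕ) (x : ℝ) : ℂ :=
  ∑ k ∈ Finset.range q, dCoeff p q k * Gper u₀ (shiftPoint p q k x : UnitAddCircle)

/-- `L₂(x) = ∑_{k<q} d_k^{p,q} [𝓗G_{u₀}](x + p/(3q) - k/q)`. -/
def L₂ (u₀ : ℝ → ℝ) (p q : ℕ) (x : ℝ) : ℂ :=
  ∑ k ∈ Finset.range q,
    dCoeff p q k * periodicHilbert (Gper u₀) (shiftPoint p q k x : UnitAddCircle)

/-- `L₃ = ∫₀¹ G_{u₀}(y) dy`. -/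
def L₃ (u₀ : ℝ → ℝ) : ℂ := ∫ y in (0 : ℝ)..1, G u₀ y

end

end AiryRevival

namespace AiryRevival

noncomputable section

open scoped ComplexConjugate

/-! ### The complex Hilbert space `L²(0,1)` -/

/-! The operator `∂³` with the conditions `u(0) = u(1) = 0`, `u'(0) = u'(1)` has an explicit
inverse, an integral operator whose real continuous kernel is antisymmetric. This inverse `greenOp`
is compact, injective and skew-adjoint, so the spectral theorem makes its eigenfunctions complete.
They are the modes `airyMode κ` with `κ > 0` a root of `chi`, and their complex conjugates. A mode
is `e^{iκx}` plus two boundary layers: the Dirichlet conditions fix the layers, and the condition on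
the derivative is `chi κ = 0`. For real data only `κ > 0` is needed: the solution is `2 Re` of the
sum `flow` over these modes. Testing the weak equation with real and imaginary parts of a mode gives
a scalar linear equation for its coefficient, hence uniqueness.

For large `κ`, `chi` is, up to a phase and an exponentially small error, a multiple of `sin(κ/2 +
π/6)`, so its roots are exponentially close to `(2n - 1/3)π` (`exists_wave_enumeration`). In the
coefficient of `u₀` on a mode the layers contribute Laplace integrals, equal to boundary values of
`u₀` over `κ` up to `O(κ⁻²)`. At the frequency `(2n - 1/3)π` the sum of these terms is exactly the
Fourier integral of the constant `u₀(0) + u₀(1)`; this is the origin of the shift in `revivalCoeff`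
(`IsWaveSeq.isBigO_inner_sub`). Inside `(0,1)` the layers are negligible, so modes and revival terms
differ by `O(n⁻²)` locally uniformly. The difference series therefore has a continuous sum, and the
modes not enumerated contribute an element of the range of `greenOp`, which is continuous too.

At `t = p/(qπ²)` the phase of the `n`-th term contains `2π(4n³ - 2n²)p/q`, which modulo `2π` depends
only on `n mod q`. A finite Fourier transform turns that factor into a combination of translations
by `k/q` (`sum_dCoeff_mul_exp`), and the part of the phase linear in `n` is one more translation.
What is translated is the positive-frequency part of `G_{u₀}`, which the Hilbert transform expresses
through `G_{u₀}` and its mean (`two_smul_positivePart`). -/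

instance isProbabilityMeasure_volI : IsProbabilityMeasure volI :=
  ⟨by simp [volI]⟩

/-- The complex Hilbert space `L²((0,1); ℂ)`. -/
abbrev L2C : Type := Lp ℂ 2 volI

theorem ae_volI_mem : ∀ᵐ x ∂volI, x ∈ Ioo (0 : ℝ) 1 :=
  ae_restrict_mem measurableSet_Ioo

theorem integral_volI {E : Type*} [NormedAddCommGroup E] [NormedSpace ℝ E] (f : ℝ → E) :
    ∫ x, f x ∂volI = ∫ x in (0 : ℝ)..1, f x := by
  rw [intervalIntegral.integral_of_le zero_le_one, integral_Ioc_eq_integral_Ioo]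

theorem memLp_of_continuous {E : Type*} [NormedAddCommGroup E] [SecondCountableTopology E]
    {f : ℝ → E} (hf : Continuous f) (p : ENNReal) : MemLp f p volI := by
  obtain ⟨C, hC⟩ := isCompact_Icc.exists_bound_of_continuousOn (s := Icc (0 : ℝ) 1) hf.continuousOn
  exact MemLp.of_bound hf.aestronglyMeasurable C
    (ae_volI_mem.mono fun x hx => hC x (Ioo_subset_Icc_self hx))

theorem norm_Lp_le_of_ae_bound {E : Type*} [NormedAddCommGroup E] {f : Lp E 2 volI} {C : ℝ}
    (hC : 0 ≤ C) (h : ∀ᵐ x ∂volI, ‖f x‖ ≤ C) : ‖f‖ ≤ C := by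
  have := Lp.norm_le_of_ae_bound hC h
  simpa [measureUnivNNReal] using this

open Classical in
/-- The class in `L²((0,1); ℂ)` of a square integrable function. -/
def toL2 (f : ℝ → ℂ) : L2C := if h : MemLp f 2 volI then h.toLp f else 0

theorem coeFn_toL2 {f : ℝ → ℂ} (h : MemLp f 2 volI) : toL2 f =ᵐ[volI] f := by
  rw [toL2, dif_pos h]
  exact h.coeFn_toLp

theorem coeFn_toL2_of_continuous {f : ℝ → ℂ} (h : Continuous f) : toL2 f =ᵐ[volI] f :=
  coeFn_toL2 (memLp_of_continuous h 2)

theorem inner_eq_integral (f g : L2C) : inner ℂ f g = ∫ x, conj (f x) * g x ∂volI := by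
  rw [L2.inner_def]
  simp only [RCLike.inner_apply, mul_comm]

theorem inner_toL2_left {f : ℝ → ℂ} (h : MemLp f 2 volI) (g : L2C) :
    inner ℂ (toL2 f) g = ∫ x, conj (f x) * g x ∂volI := by
  rw [inner_eq_integral]
  exact integral_congr_ae ((coeFn_toL2 h).mono fun x hx => by simp only [hx])

theorem integrable_coeFn (f : L2C) : Integrable f volI :=
  (Lp.memLp f).integrable (by norm_num)

/-! ### The Green operator -/

/-- Projection of the line onto the unit interval. -/
def clamp (x : ℝ) : ℝ := max 0 (min 1 x)

theorem continuous_clamp : Continuous clamp := by unfold clamp; fun_prop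

theorem clamp_of_mem {x : ℝ} (hx : x ∈ Icc (0 : ℝ) 1) : clamp x = x := by
  simp [clamp, hx.1, hx.2]

theorem clamp_mem (x : ℝ) : clamp x ∈ Icc (0 : ℝ) 1 := by
  simp [clamp]

/-- The Green kernel of `∂³` with boundary conditions `u(0) = u(1) = 0`, `u'(0) = u'(1)`. -/
def greenKernel (x y : ℝ) : ℝ :=
  (clamp y - clamp x) * min (clamp x) (clamp y) * (1 - max (clamp x) (clamp y)) / 2

/-- The clamps in the kernel make continuity and the bound by `1` valid on the whole plane, so that
no membership in `[0,1]` has to be carried along. -/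
theorem continuous_greenKernel : Continuous fun z : ℝ × ℝ => greenKernel z.1 z.2 := by
  have := continuous_clamp
  unfold greenKernel
  fun_prop

/-- This is the source of the skew-adjointness of the Green operator. -/
theorem greenKernel_antisymm (x y : ℝ) : greenKernel y x = -greenKernel x y := by
  simp only [greenKernel, min_comm (clamp y), max_comm (clamp y)]
  ring

theorem abs_greenKernel_le (x y : ℝ) : |greenKernel x y| ≤ 1 := by
  obtain ⟨hx0, hx1⟩ := clamp_mem x
  obtain ⟨hy0, hy1⟩ := clamp_mem y
  unfold greenKernel
  generalize clamp x = a at *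
  generalize clamp y = b at *
  have h1 : |b - a| ≤ 1 := by rw [abs_le]; constructor <;> linarith
  have h2 : |min a b| ≤ 1 := by
    rw [abs_of_nonneg (le_min hx0 hy0)]; exact (min_le_left _ _).trans hx1
  have h3 : |1 - max a b| ≤ 1 := by
    rw [abs_of_nonneg (by linarith [max_le hx1 hy1])]
    linarith [le_max_left a b]
  rw [abs_div, abs_mul, abs_mul, abs_two]
  have := mul_le_mul (mul_le_mul h1 h2 (abs_nonneg _) zero_le_one) h3 (abs_nonneg _) (by norm_num)
  linarith

/-- The first summand is the fundamental solution of `∂³` for the initial value problem. The second,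
quadratic in `x`, corrects the boundary values and is the whole kernel when `x ≤ y`. -/
theorem greenKernel_of_le {x y : ℝ} (hx : x ∈ Icc (0 : ℝ) 1) (hy : y ∈ Icc (0 : ℝ) 1)
    (h : y ≤ x) :
    greenKernel x y = (x - y) ^ 2 / 2 + (x * (y * (1 - y) / 2) - x ^ 2 * ((1 - y) / 2)) := by
  rw [greenKernel, clamp_of_mem hx, clamp_of_mem hy, min_eq_right h, max_eq_left h]
  ring

theorem greenKernel_of_ge {x y : ℝ} (hx : x ∈ Icc (0 : ℝ) 1) (hy : y ∈ Icc (0 : ℝ) 1)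
    (h : x ≤ y) :
    greenKernel x y = x * (y * (1 - y) / 2) - x ^ 2 * ((1 - y) / 2) := by
  rw [greenKernel, clamp_of_mem hx, clamp_of_mem hy, min_eq_left h, max_eq_right h]
  ring

/-- The value at `x` of the Green operator applied to `f`. -/
def greenFun (f : ℝ → ℂ) (x : ℝ) : ℂ := ∫ y, (greenKernel x y : ℂ) * f y ∂volI

theorem continuous_greenKernel_right (x : ℝ) : Continuous fun y => (greenKernel x y : ℂ) :=
  Complex.continuous_ofReal.comp (continuous_greenKernel.comp (by fun_prop : Continuous fun y => (x, y)))

theorem norm_greenKernel_le (x y : ℝ) : ‖(greenKernel x y : ℂ)‖ ≤ 1 := by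
  rw [Complex.norm_real]; exact abs_greenKernel_le x y

theorem integrable_greenKernel_mul {f : ℝ → ℂ} (hf : Integrable f volI) (x : ℝ) :
    Integrable (fun y => (greenKernel x y : ℂ) * f y) volI :=
  hf.bdd_mul (c := 1) (continuous_greenKernel_right x).aestronglyMeasurable
    (.of_forall fun y => norm_greenKernel_le x y)

theorem continuous_greenFun {f : ℝ → ℂ} (hf : Integrable f volI) : Continuous (greenFun f) := by
  refine continuous_of_dominated (bound := fun y => ‖f y‖)
    (fun x => (integrable_greenKernel_mul hf x).aestronglyMeasurable) (fun x => .of_forall fun y => ?_)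
    hf.norm (.of_forall fun y => ?_)
  · rw [norm_mul]
    exact mul_le_of_le_one_left (norm_nonneg _) (norm_greenKernel_le x y)
  · exact (Complex.continuous_ofReal.comp (continuous_greenKernel.comp
      (by fun_prop : Continuous fun x => (x, y)))).mul continuous_const

theorem greenFun_congr {f g : ℝ → ℂ} (h : f =ᵐ[volI] g) (x : ℝ) : greenFun f x = greenFun g x :=
  integral_congr_ae (h.mono fun y hy => by simp only [hy])

theorem integral_norm_le_norm (f : L2C) : ∫ x, ‖f x‖ ∂volI ≤ ‖f‖ := by
  have h1 : eLpNorm f 1 volI ≤ eLpNorm f 2 volI :=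
    eLpNorm_le_eLpNorm_of_exponent_le (by norm_num) (Lp.aestronglyMeasurable f)
  rw [integral_norm_eq_lintegral_enorm (Lp.aestronglyMeasurable f), Lp.norm_def,
    ← eLpNorm_one_eq_lintegral_enorm]
  exact ENNReal.toReal_mono (Lp.eLpNorm_ne_top f) h1

theorem norm_greenFun_le (f : L2C) (x : ℝ) : ‖greenFun f x‖ ≤ ‖f‖ := by
  refine (norm_integral_le_integral_norm _).trans (le_trans ?_ (integral_norm_le_norm f))
  refine integral_mono (integrable_greenKernel_mul (integrable_coeFn f) x).norm
    (integrable_coeFn f).norm fun y => ?_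
  dsimp only
  rw [norm_mul]
  exact mul_le_of_le_one_left (norm_nonneg _) (norm_greenKernel_le x y)

theorem greenFun_add (f g : L2C) (x : ℝ) :
    greenFun (f + g : L2C) x = greenFun f x + greenFun g x := by
  rw [greenFun_congr (Lp.coeFn_add f g)]
  simp only [greenFun, Pi.add_apply, mul_add]
  exact integral_add (integrable_greenKernel_mul (integrable_coeFn f) x)
    (integrable_greenKernel_mul (integrable_coeFn g) x)

theorem greenFun_smul (c : ℂ) (f : L2C) (x : ℝ) :
    greenFun (c • f : L2C) x = c * greenFun f x := by
  rw [greenFun_congr (Lp.coeFn_smul c f)]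
  simp only [greenFun, Pi.smul_apply, smul_eq_mul, mul_left_comm _ c]
  exact integral_const_mul _ _

theorem coeFn_toL2_greenFun (f : L2C) : toL2 (greenFun f) =ᵐ[volI] greenFun f :=
  coeFn_toL2_of_continuous (continuous_greenFun (integrable_coeFn f))

/-- The Green operator, the inverse of `∂³` with the given boundary conditions. -/
def greenOp : L2C →L[ℂ] L2C :=
  LinearMap.mkContinuous
    { toFun := fun f => toL2 (greenFun f)
      map_add' := fun f g => by
        apply Lp.ext
        filter_upwards [coeFn_toL2_greenFun f, coeFn_toL2_greenFun g, coeFn_toL2_greenFun (f + g),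
          Lp.coeFn_add (toL2 (greenFun f)) (toL2 (greenFun g))] with x h1 h2 h3 h4
        rw [h3, h4, Pi.add_apply, h1, h2, greenFun_add]
      map_smul' := fun c f => by
        apply Lp.ext
        filter_upwards [coeFn_toL2_greenFun f, coeFn_toL2_greenFun (c • f),
          Lp.coeFn_smul c (toL2 (greenFun f))] with x h1 h3 h4
        rw [h3, RingHom.id_apply, h4, Pi.smul_apply, h1, greenFun_smul, smul_eq_mul] }
    1 fun f => by
      rw [one_mul]
      refine norm_Lp_le_of_ae_bound (norm_nonneg _) ?_
      filter_upwards [coeFn_toL2_greenFun f] with x h1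
      simp only [LinearMap.coe_mk, AddHom.coe_mk]
      rw [h1]
      exact norm_greenFun_le f x

theorem coeFn_greenOp (f : L2C) : greenOp f =ᵐ[volI] greenFun f := coeFn_toL2_greenFun f

/-- Evaluation of the Green operator at a point, as a functional. -/
def greenEval (x : ℝ) : L2C →L[ℂ] ℂ :=
  LinearMap.mkContinuous
    { toFun := fun f => greenFun f x
      map_add' := fun f g => greenFun_add f g x
      map_smul' := fun c f => greenFun_smul c f x }
    1 fun f => by rw [one_mul]; exact norm_greenFun_le f x

/-- With `x'` the grid point below `x`, this turns the uniform continuity of the kernel into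
operator norm convergence of `greenApprox`. -/
theorem norm_greenFun_sub_le (f : L2C) {x x' ε : ℝ} (hε : 0 ≤ ε)
    (h : ∀ y ∈ Icc (0 : ℝ) 1, |greenKernel x y - greenKernel x' y| ≤ ε) :
    ‖greenFun f x - greenFun f x'‖ ≤ ε * ‖f‖ := by
  have hi := integrable_coeFn f
  rw [greenFun, greenFun, ← integral_sub (integrable_greenKernel_mul hi x)
    (integrable_greenKernel_mul hi x')]
  refine (norm_integral_le_integral_norm _).trans ?_
  calc _ ≤ ∫ y, ε * ‖f y‖ ∂volI := by
        refine integral_mono_ae ((integrable_greenKernel_mul hi x).sub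
          (integrable_greenKernel_mul hi x')).norm (hi.norm.const_mul ε) ?_
        filter_upwards [ae_volI_mem] with y hy
        rw [← sub_mul, norm_mul, ← Complex.ofReal_sub, Complex.norm_real]
        exact mul_le_mul_of_nonneg_right (h y (Ioo_subset_Icc_self hy)) (norm_nonneg _)
    _ ≤ ε * ‖f‖ := by
        rw [integral_const_mul]
        exact mul_le_mul_of_nonneg_left (integral_norm_le_norm f) hε

/-! ### Compactness of the Green operator by finite rank approximation. -/

/-- The `j`-th piece of the partition of `[0,1)` into `N` intervals of equal length. -/
def floorPiece (N j : ℕ) : Set ℝ := {x | ⌊(N : ℝ) * x⌋₊ = j}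

theorem measurableSet_floorPiece (N j : ℕ) : MeasurableSet (floorPiece N j) :=
  (Nat.measurable_floor.comp (measurable_const_mul (N : ℝ))) (measurableSet_singleton j)

/-- The finite rank approximation of the Green operator that evaluates it at `j / N` on the
`j`-th piece. -/
def greenApprox (N : ℕ) : L2C →L[ℂ] L2C :=
  ∑ j ∈ Finset.range N, (greenEval (j / N)).smulRight
    (indicatorConstLp 2 (measurableSet_floorPiece N j) (measure_ne_top volI _) (1 : ℂ))

theorem isCompactOperator_greenApprox (N : ℕ) : IsCompactOperator (greenApprox N) := by
  unfold greenApprox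
  induction Finset.range N using Finset.induction_on with
  | empty => simpa using isCompactOperator_zero
  | insert a s ha ih =>
    rw [Finset.sum_insert ha]
    refine IsCompactOperator.add ?_ ih
    exact (isCompactOperator_of_locallyCompactSpace_dom (greenEval (a / N))).clm_comp
      (ContinuousLinearMap.toSpanSingleton ℂ (indicatorConstLp 2 (measurableSet_floorPiece N a)
        (measure_ne_top volI _) (1 : ℂ)))

theorem coeFn_greenApprox {N : ℕ} (hpos : 0 < N) (f : L2C) :
    ∀ᵐ x ∂volI, greenApprox N f x = greenFun f (⌊(N : ℝ) * x⌋₊ / N) := by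
  have h1 : ∀ᵐ x ∂volI, greenApprox N f x = ∑ j ∈ Finset.range N, greenFun f (j / N) *
      (floorPiece N j).indicator (fun _ => (1 : ℂ)) x := by
    have h2 : greenApprox N f = ∑ j ∈ Finset.range N, greenFun f (j / N) •
      indicatorConstLp 2 (measurableSet_floorPiece N j) (measure_ne_top volI _) (1 : ℂ) := by
      simp only [greenApprox, sum_apply, ContinuousLinearMap.smulRight_apply]
      rfl
    have h3 : ∀ j : ℕ, ∀ᵐ x ∂volI, (greenFun f (j / N) •
        indicatorConstLp 2 (measurableSet_floorPiece N j) (measure_ne_top volI _) (1 : ℂ) : L2C) x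
        = greenFun f (j / N) * (floorPiece N j).indicator (fun _ => (1 : ℂ)) x := fun j => by
      filter_upwards [Lp.coeFn_smul (greenFun f (j / N)) (indicatorConstLp 2
        (measurableSet_floorPiece N j) (measure_ne_top volI _) (1 : ℂ)),
        indicatorConstLp_coeFn (p := 2) (hs := measurableSet_floorPiece N j)
          (hμs := measure_ne_top volI _) (c := (1 : ℂ))] with x hx1 hx2
      rw [hx1, Pi.smul_apply, hx2, smul_eq_mul]
    rw [h2]
    filter_upwards [ae_all_iff.2 h3, Lp.coeFn_finsetSum (Finset.range N) (fun j : ℕ =>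
      greenFun f (j / N) • indicatorConstLp 2 (measurableSet_floorPiece N j)
        (measure_ne_top volI _) (1 : ℂ))] with x hx1 hx2
    rw [hx2]
    simp only [Finset.sum_apply]
    exact Finset.sum_congr rfl fun j _ => hx1 j
  filter_upwards [h1, ae_volI_mem] with x hx hx01
  rw [hx, Finset.sum_eq_single ⌊(N : ℝ) * x⌋₊]
  · simp [floorPiece]
  · intro j _ hj
    rw [indicator_of_notMem (fun h => hj h.symm), mul_zero]
  -- Since `x < 1`, the index `⌊N x⌋₊` is smaller than `N`, so it does occur in the sum.
  · intro hN
    exfalso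
    apply hN
    rw [Finset.mem_range]
    rw [Nat.floor_lt (by have := hx01.1; positivity)]
    have : (0 : ℝ) < N := by exact_mod_cast hpos
    nlinarith [hx01.2]

theorem tendsto_greenApprox : Filter.Tendsto greenApprox Filter.atTop (nhds greenOp) := by
  rw [Metric.tendsto_atTop]
  intro ε hε
  have huc := (isCompact_Icc.prod isCompact_Icc).uniformContinuousOn_of_continuous
    (s := Icc (0 : ℝ) 1 ×ˢ Icc (0 : ℝ) 1) continuous_greenKernel.continuousOn
  obtain ⟨δ, hδ, h⟩ := Metric.uniformContinuousOn_iff.1 huc (ε / 2) (by positivity)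
  obtain ⟨N₀, hN₀⟩ := exists_nat_gt (1 / δ)
  refine ⟨N₀ + 1, fun N hN => ?_⟩
  have hN' : (0 : ℝ) < N := by
    have : 0 < N := by omega
    exact_mod_cast this
  have hNδ : 1 / (N : ℝ) < δ := by
    have : (N₀ : ℝ) < N := by exact_mod_cast hN
    rw [div_lt_iff₀ hN', mul_comm, ← div_lt_iff₀ hδ]
    linarith
  rw [dist_eq_norm]
  refine lt_of_le_of_lt (ContinuousLinearMap.opNorm_le_bound _ (by positivity : 0 ≤ ε / 2)
    fun f => ?_) (by linarith)
  refine norm_Lp_le_of_ae_bound (by positivity) ?_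
  filter_upwards [coeFn_greenApprox (by omega : 0 < N) f, coeFn_greenOp f, ae_volI_mem,
    Lp.coeFn_sub (greenApprox N f) (greenOp f)] with x h1 h2 hx h3
  rw [sub_apply, h3, Pi.sub_apply, h1, h2]
  have hfl : (⌊(N : ℝ) * x⌋₊ : ℝ) ≤ N * x := Nat.floor_le (by have := hx.1; positivity)
  have hfl' : (N : ℝ) * x < ⌊(N : ℝ) * x⌋₊ + 1 := Nat.lt_floor_add_one _
  have hle : (⌊(N : ℝ) * x⌋₊ : ℝ) / N ≤ x := by rw [div_le_iff₀ hN']; linarith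
  have hge : x - 1 / N < (⌊(N : ℝ) * x⌋₊ : ℝ) / N := by
    rw [lt_div_iff₀ hN', sub_mul, one_div, inv_mul_cancel₀ hN'.ne']; linarith
  refine norm_greenFun_sub_le f (by positivity) fun y hy => ?_
  refine (h (_, y) ⟨⟨by positivity, hle.trans hx.2.le⟩, hy⟩ (x, y)
    ⟨Ioo_subset_Icc_self hx, hy⟩ ?_).le
  rw [Prod.dist_eq, dist_self, Real.dist_eq]
  refine max_lt ?_ hδ
  rw [abs_sub_comm, abs_of_nonneg (by linarith)]
  linarith

theorem isCompactOperator_greenOp : IsCompactOperator greenOp :=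
  isCompactOperator_of_tendsto tendsto_greenApprox
    (.of_forall isCompactOperator_greenApprox)

/-- Fubini's theorem and the antisymmetry of the real kernel. -/
theorem inner_greenOp_left (f g : L2C) : inner ℂ (greenOp f) g = -inner ℂ f (greenOp g) := by
  have hf := integrable_coeFn f
  have hg := integrable_coeFn g
  have h1 : inner ℂ (greenOp f) g
      = ∫ x, ∫ y, (greenKernel x y : ℂ) * (g x * conj (f y)) ∂volI ∂volI := by
    rw [inner_eq_integral]
    refine integral_congr_ae ((coeFn_greenOp f).mono fun x hx => ?_)
    simp only [hx, greenFun]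
    rw [← integral_conj, ← integral_mul_const]
    refine integral_congr_ae (.of_forall fun y => ?_)
    simp only [map_mul, Complex.conj_ofReal]
    ring
  have h2 : inner ℂ f (greenOp g)
      = ∫ y, ∫ x, (greenKernel y x : ℂ) * (g x * conj (f y)) ∂volI ∂volI := by
    rw [inner_eq_integral]
    refine integral_congr_ae ((coeFn_greenOp g).mono fun x hx => ?_)
    simp only [hx, greenFun]
    rw [← integral_const_mul]
    refine integral_congr_ae (.of_forall fun y => ?_)
    ring
  rw [h1, h2, integral_integral_swap]
  · simp only [← integral_neg]
    refine integral_congr_ae (.of_forall fun y => integral_congr_ae (.of_forall fun x => ?_))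
    simp only [greenKernel_antisymm x y]
    push_cast
    ring
  · have hi : Integrable (fun z : ℝ × ℝ => g z.1 * conj (f z.2)) (volI.prod volI) :=
      hg.mul_prod (((Complex.conjCLE : ℂ →L[ℝ] ℂ).integrable_comp hf))
    exact hi.bdd_mul (c := 1)
      (Complex.continuous_ofReal.comp continuous_greenKernel).aestronglyMeasurable
      (.of_forall fun z => norm_greenKernel_le z.1 z.2)

/-- The Green kernel inverts the third derivative on functions that satisfy the boundary
conditions. -/
theorem greenFun_of_hasDerivAt {f f₁ f₂ f₃ : ℝ → ℂ} (h₁ : ∀ x, HasDerivAt f (f₁ x) x)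
    (h₂ : ∀ x, HasDerivAt f₁ (f₂ x) x) (h₃ : ∀ x, HasDerivAt f₂ (f₃ x) x) (hc : Continuous f₃)
    (h0 : f 0 = 0) (h1 : f 1 = 0) (hp : f₁ 1 = f₁ 0) {x : ℝ} (hx : x ∈ Icc (0 : ℝ) 1) :
    greenFun f₃ x = f x := by
  have hid : ∀ y : ℝ, HasDerivAt (fun y : ℝ => (y : ℂ)) 1 y := fun y =>
    (hasDerivAt_id (y : ℂ)).comp_ofReal
  -- Three integrations by parts at once: for a polynomial `P` of degree at most two, `P f₂ - P' f₁
  -- + P'' f` is an antiderivative of `P f₃`. It is used with `P = (x - y)²/2`, `y(1 - y)/2` and `(1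
  -- - y)/2`, the polynomials in `y` that make up the kernel.
  have key1 : ∫ y in (0 : ℝ)..x, ((x : ℂ) - y) ^ 2 / 2 * f₃ y
      = f x - ((x : ℂ) ^ 2 / 2 * f₂ 0 + x * f₁ 0) := by
    rw [intervalIntegral.integral_eq_sub_of_hasDerivAt
      (f := fun y : ℝ => ((x : ℂ) - y) ^ 2 / 2 * f₂ y + (x - y) * f₁ y + f y)]
    · simp [h0]
    · intro y _
      convert! (((((hid y).const_sub (x : ℂ)).pow 2).div_const 2).mul (h₃ y)).add
        (((hid y).const_sub (x : ℂ)).mul (h₂ y)) |>.add (h₁ y) using 1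
      push_cast
      simp only [Pi.pow_apply]
      ring
    · exact Continuous.intervalIntegrable (by fun_prop) _ _
  have key2 : ∫ y in (0 : ℝ)..1, ((y : ℂ) * (1 - y) / 2) * f₃ y = f₁ 0 := by
    rw [intervalIntegral.integral_eq_sub_of_hasDerivAt
      (f := fun y : ℝ => (y : ℂ) * (1 - y) / 2 * f₂ y - (1 - 2 * (y : ℂ)) / 2 * f₁ y - f y)]
    · simp [h0, h1, hp]; ring
    · intro y _
      convert! (((((hid y).mul ((hid y).const_sub 1)).div_const 2).mul (h₃ y)).sub
        (((((hid y).const_mul 2).const_sub 1).div_const 2).mul (h₂ y))).sub (h₁ y) using 1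
      simp only [Pi.mul_apply]
      ring
    · exact Continuous.intervalIntegrable (by fun_prop) _ _
  have key3 : ∫ y in (0 : ℝ)..1, ((1 - y : ℂ) / 2) * f₃ y = -f₂ 0 / 2 := by
    rw [intervalIntegral.integral_eq_sub_of_hasDerivAt
      (f := fun y : ℝ => (1 - y : ℂ) / 2 * f₂ y + f₁ y / 2)]
    · simp [hp]; ring
    · intro y _
      convert! ((((hid y).const_sub 1).div_const 2).mul (h₃ y)).add ((h₂ y).div_const 2) using 1
      ring
    · exact Continuous.intervalIntegrable (by fun_prop) _ _
  have hg : Continuous fun y => (greenKernel x y : ℂ) * f₃ y :=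
    (continuous_greenKernel_right x).mul hc
  have hq : Continuous fun y : ℝ => ((x : ℂ) * (y * (1 - y) / 2) - x ^ 2 * ((1 - y) / 2)) * f₃ y := by
    fun_prop
  have hq' : Continuous fun y : ℝ => ((x : ℂ) - y) ^ 2 / 2 * f₃ y := by fun_prop
  rw [greenFun, integral_volI, ← intervalIntegral.integral_add_adjacent_intervals
    (hg.intervalIntegrable 0 x) (hg.intervalIntegrable x 1)]
  have e1 : ∫ y in (0 : ℝ)..x, (greenKernel x y : ℂ) * f₃ y
      = ∫ y in (0 : ℝ)..x, (((x : ℂ) - y) ^ 2 / 2 * f₃ y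
        + ((x : ℂ) * (y * (1 - y) / 2) - x ^ 2 * ((1 - y) / 2)) * f₃ y) := by
    refine intervalIntegral.integral_congr fun y hy => ?_
    rw [uIcc_of_le hx.1] at hy
    rw [greenKernel_of_le hx ⟨hy.1, hy.2.trans hx.2⟩ hy.2]
    push_cast
    ring
  have e2 : ∫ y in x..1, (greenKernel x y : ℂ) * f₃ y
      = ∫ y in x..1, ((x : ℂ) * (y * (1 - y) / 2) - x ^ 2 * ((1 - y) / 2)) * f₃ y := by
    refine intervalIntegral.integral_congr fun y hy => ?_
    rw [uIcc_of_le hx.2] at hy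
    rw [greenKernel_of_ge hx ⟨hx.1.trans hy.1, hy.2⟩ hy.1]
    push_cast
    ring
  rw [e1, e2, intervalIntegral.integral_add (hq'.intervalIntegrable _ _)
    (hq.intervalIntegrable _ _), add_assoc, intervalIntegral.integral_add_adjacent_intervals
    (hq.intervalIntegrable 0 x) (hq.intervalIntegrable x 1), key1]
  have e3 : ∫ y in (0 : ℝ)..1, ((x : ℂ) * (y * (1 - y) / 2) - x ^ 2 * ((1 - y) / 2)) * f₃ y
      = x * f₁ 0 - x ^ 2 * (-f₂ 0 / 2) := by
    rw [← key2, ← key3, ← intervalIntegral.integral_const_mul,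
      ← intervalIntegral.integral_const_mul, ← intervalIntegral.integral_sub]
    · exact intervalIntegral.integral_congr fun y _ => by ring
    · exact Continuous.intervalIntegrable (by fun_prop) _ _
    · exact Continuous.intervalIntegrable (by fun_prop) _ _
  rw [e3]
  ring

theorem greenOp_of_hasDerivAt {f f₁ f₂ f₃ : ℝ → ℂ} (h₁ : ∀ x, HasDerivAt f (f₁ x) x)
    (h₂ : ∀ x, HasDerivAt f₁ (f₂ x) x) (h₃ : ∀ x, HasDerivAt f₂ (f₃ x) x) (hc : Continuous f₃)
    (h0 : f 0 = 0) (h1 : f 1 = 0) (hp : f₁ 1 = f₁ 0) : greenOp (toL2 f₃) = toL2 f := by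
  have hf : Continuous f := continuous_iff_continuousAt.2 fun x => (h₁ x).continuousAt
  apply Lp.ext
  filter_upwards [coeFn_greenOp (toL2 f₃), coeFn_toL2_of_continuous hf, ae_volI_mem]
    with x hx1 hx2 hx
  rw [hx1, hx2, greenFun_congr (coeFn_toL2_of_continuous hc),
    greenFun_of_hasDerivAt h₁ h₂ h₃ hc h0 h1 hp (Ioo_subset_Icc_self hx)]

theorem greenOp_iteratedDeriv {φ : ℝ → ℝ} (hφ : IsTestFunction φ) :
    greenOp (toL2 fun x => ((iteratedDeriv 3 φ x : ℝ) : ℂ)) = toL2 fun x => (φ x : ℂ) := by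
  have hdiff : ∀ n : ℕ, Differentiable ℝ (iteratedDeriv n φ) := fun n =>
    hφ.smooth.differentiable_iteratedDeriv n (by exact_mod_cast WithTop.coe_lt_top _)
  have hd : ∀ n x, HasDerivAt (iteratedDeriv n φ) (iteratedDeriv (n + 1) φ x) x := fun n x => by
    rw [iteratedDeriv_succ]
    exact (hdiff n x).hasDerivAt
  refine greenOp_of_hasDerivAt (f₁ := fun x => ((iteratedDeriv 1 φ x : ℝ) : ℂ))
    (f₂ := fun x => ((iteratedDeriv 2 φ x : ℝ) : ℂ)) (fun x => ?_) (fun x => (hd 1 x).ofReal_comp)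
    (fun x => (hd 2 x).ofReal_comp) ?_ ?_ ?_ ?_
  · simpa using (hd 0 x).ofReal_comp
  · exact Complex.continuous_ofReal.comp (hdiff 3).continuous
  · simp [hφ.zero_left]
  · simp [hφ.zero_right]
  · simp [iteratedDeriv_one, hφ.deriv_eq]

theorem isTestFunction_of_tsupport_subset {φ : ℝ → ℝ} (hφ : ContDiff ℝ (⊤ : ℕ∞) φ)
    (hs : tsupport φ ⊆ Ioo 0 1) : IsTestFunction φ where
  smooth := hφ
  zero_left := image_eq_zero_of_notMem_tsupport fun h => by simpa using hs h
  zero_right := image_eq_zero_of_notMem_tsupport fun h => by simpa using hs h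
  deriv_eq := by
    have h : ∀ x, x ∉ Ioo (0 : ℝ) 1 → deriv φ x = 0 := fun x hx =>
      image_eq_zero_of_notMem_tsupport fun h => hx (hs (tsupport_deriv_subset h))
    rw [h 1 (by simp), h 0 (by simp)]

/-- Every `φ` compactly supported in `(0,1)` is `greenOp φ'''`, so by skew-adjointness a function in
the kernel is orthogonal to all such `φ`. -/
theorem greenOp_injective {f : L2C} (hf : greenOp f = 0) : f = 0 := by
  have h := isOpen_Ioo.ae_eq_zero_of_integral_contDiff_smul_eq_zero (μ := volume)
    (U := Ioo (0 : ℝ) 1) (f := f) ?_ ?_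
  · apply Lp.ext
    filter_upwards [(ae_restrict_iff' measurableSet_Ioo).2 h, Lp.coeFn_zero ℂ 2 volI] with x h1 h2
    rw [h1, h2, Pi.zero_apply]
  · exact IntegrableOn.locallyIntegrableOn (integrable_coeFn f)
  · intro φ hφ _ hs
    have ht := isTestFunction_of_tsupport_subset hφ hs
    have h1 := inner_greenOp_left (toL2 fun x => ((iteratedDeriv 3 φ x : ℝ) : ℂ)) f
    rw [hf, inner_zero_right, neg_zero, greenOp_iteratedDeriv ht,
      inner_toL2_left (memLp_of_continuous (f := fun x => (φ x : ℂ))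
        (Complex.continuous_ofReal.comp hφ.continuous) 2)] at h1
    rw [← h1, setIntegral_eq_integral_of_forall_compl_eq_zero]
    · simp
    · intro x hx
      simp [image_eq_zero_of_notMem_tsupport fun h => hx (hs h)]

/-! ### Exponential modes -/

/-- The sixth root of `-1` given by `e^{iπ/6}`. -/
def rootA : ℂ := (Real.sqrt 3 / 2 : ℝ) + Complex.I / 2

/-- The conjugate of `rootA`. -/
def rootB : ℂ := (Real.sqrt 3 / 2 : ℝ) - Complex.I / 2

theorem sqrt_three_half_sq : ((Real.sqrt 3 / 2 : ℝ) : ℂ) ^ 2 = 3 / 4 := by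
  rw [← Complex.ofReal_pow, div_pow, Real.sq_sqrt (by norm_num)]
  norm_num

/-- `rootA` and `-rootB` are the roots of `z² - iz - 1`, a factor of `z³ - i = (z + i)(z² - iz -
1)`. Later identities use this relation and its analogue for `rootB`, so that `√3` need not appear
in them. -/
theorem rootA_sq : rootA ^ 2 = 1 + Complex.I * rootA := by
  have := sqrt_three_half_sq
  unfold rootA
  linear_combination this - (1 / 4 : ℂ) * Complex.I_sq

theorem rootB_sq : rootB ^ 2 = 1 - Complex.I * rootB := by
  have := sqrt_three_half_sq
  unfold rootB
  linear_combination this - (1 / 4 : ℂ) * Complex.I_sq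

theorem rootA_sub_rootB : rootA - rootB = Complex.I := by
  unfold rootA rootB; ring

theorem rootA_cube : rootA ^ 3 = Complex.I := by
  linear_combination (rootA + Complex.I) * rootA_sq + rootA * Complex.I_sq

theorem rootB_cube : rootB ^ 3 = -Complex.I := by
  linear_combination (rootB - Complex.I) * rootB_sq + rootB * Complex.I_sq

theorem rootA_mul_rootB : rootA * rootB = 1 := by
  linear_combination rootA_sq - rootA * rootA_sub_rootB

theorem conj_rootA : conj rootA = rootB := by
  simp only [rootA, rootB, map_add, Complex.conj_ofReal, map_div₀, Complex.conj_I, map_ofNat]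
  ring

theorem conj_rootB : conj rootB = rootA := by
  rw [← conj_rootA, Complex.conj_conj]

theorem rootA_re : rootA.re = Real.sqrt 3 / 2 := by simp [rootA]

theorem rootB_re : rootB.re = Real.sqrt 3 / 2 := by simp [rootB]

theorem norm_rootA : ‖rootA‖ = 1 := by
  have h : ‖rootA‖ ^ 3 = 1 := by rw [← norm_pow, rootA_cube, Complex.norm_I]
  exact (pow_eq_one_iff_of_nonneg (norm_nonneg _) (by norm_num)).1 h

theorem norm_rootB : ‖rootB‖ = 1 := by
  rw [← conj_rootA, Complex.norm_conj, norm_rootA]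

/-- A combination of the three exponentials `e^{zx}` with `z³ = -iκ³`, normalized to be bounded
on `[0,1]` for `κ > 0`. -/
def expComb (κ : ℝ) (a b c : ℂ) (x : ℝ) : ℂ :=
  a * Complex.exp (Complex.I * κ * x) + b * Complex.exp (-rootA * κ * x)
    + c * Complex.exp (-rootB * κ * (1 - x))

/-- Differentiation acts diagonally on the coefficients, so derivatives of every order and their
boundary values are computed on `a`, `b`, `c` alone. -/
theorem hasDerivAt_expComb (κ : ℝ) (a b c : ℂ) (x : ℝ) :
    HasDerivAt (expComb κ a b c)
      (expComb κ (Complex.I * κ * a) (-rootA * κ * b) (rootB * κ * c) x) x := by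
  have hid : HasDerivAt (fun y : ℝ => (y : ℂ)) 1 x := (hasDerivAt_id (x : ℂ)).comp_ofReal
  have h := (((hid.const_mul (Complex.I * κ)).cexp.const_mul a).add
    ((hid.const_mul (-rootA * κ)).cexp.const_mul b)).add
    (((hid.const_sub 1).const_mul (-rootB * κ)).cexp.const_mul c)
  convert! h using 1
  unfold expComb
  ring

theorem contDiff_expComb (κ : ℝ) (a b c : ℂ) : ContDiff ℝ (⊤ : ℕ∞) (expComb κ a b c) := by
  have : ContDiff ℝ (⊤ : ℕ∞) (fun x : ℝ => (x : ℂ)) := Complex.ofRealCLM.contDiff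
  unfold expComb
  fun_prop

theorem continuous_expComb (κ : ℝ) (a b c : ℂ) : Continuous (expComb κ a b c) :=
  (contDiff_expComb κ a b c).continuous

theorem expComb_smul (κ : ℝ) (r a b c : ℂ) (x : ℝ) :
    expComb κ (r * a) (r * b) (r * c) x = r * expComb κ a b c x := by
  unfold expComb; ring

theorem expComb_third (κ : ℝ) (a b c : ℂ) (x : ℝ) :
    expComb κ (Complex.I * κ * (Complex.I * κ * (Complex.I * κ * a)))
      (-rootA * κ * (-rootA * κ * (-rootA * κ * b)))
      (rootB * κ * (rootB * κ * (rootB * κ * c))) x = -Complex.I * κ ^ 3 * expComb κ a b c x := by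
  rw [← expComb_smul]
  congr 1
  · linear_combination Complex.I * κ ^ 3 * a * Complex.I_sq
  · linear_combination -κ ^ 3 * b * rootA_cube
  · linear_combination κ ^ 3 * c * rootB_cube

/-- `e^{-ακ}`. -/
def decayA (κ : ℝ) : ℂ := Complex.exp (-rootA * κ)

/-- `e^{-ᾱκ}`. -/
def decayB (κ : ℝ) : ℂ := Complex.exp (-rootB * κ)

/-- The amplitude of the boundary layer at `0`. -/
def layerB (κ : ℝ) : ℂ :=
  (-1 + decayB κ * Complex.exp (Complex.I * κ)) / (1 - decayA κ * decayB κ)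

/-- The amplitude of the boundary layer at `1`. -/
def layerC (κ : ℝ) : ℂ :=
  (-Complex.exp (Complex.I * κ) + decayA κ) / (1 - decayA κ * decayB κ)

/-- The combination of exponentials that vanishes at `0` and `1`. -/
def airyMode (κ : ℝ) : ℝ → ℂ := expComb κ 1 (layerB κ) (layerC κ)

/-- The characteristic function: `κ χ(κ) = φ'(1) - φ'(0)` for the mode `φ` of wave number `κ`. -/
def chi (κ : ℝ) : ℂ :=
  Complex.I * (Complex.exp (Complex.I * κ) - 1) + rootA * layerB κ * (1 - decayA κ)
    + rootB * layerC κ * (1 - decayB κ)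

theorem decayA_mul_decayB (κ : ℝ) :
    decayA κ * decayB κ = ((Real.exp (-(Real.sqrt 3 * κ)) : ℝ) : ℂ) := by
  rw [decayA, decayB, ← Complex.exp_add, Complex.ofReal_exp]
  congr 1
  simp only [rootA, rootB]
  push_cast
  ring

theorem norm_decayA (κ : ℝ) : ‖decayA κ‖ = Real.exp (-(Real.sqrt 3 / 2 * κ)) := by
  rw [decayA, Complex.norm_exp]
  simp [rootA]

theorem norm_decayB (κ : ℝ) : ‖decayB κ‖ = Real.exp (-(Real.sqrt 3 / 2 * κ)) := by
  rw [decayB, Complex.norm_exp]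
  simp [rootB]

/-- This is the determinant of the linear system that the Dirichlet conditions impose on the two
layer amplitudes. -/
theorem one_sub_decay_ne_zero {κ : ℝ} (hκ : 0 < κ) : 1 - decayA κ * decayB κ ≠ 0 := by
  rw [decayA_mul_decayB, ← Complex.ofReal_one, ← Complex.ofReal_sub, Complex.ofReal_ne_zero]
  have : Real.exp (-(Real.sqrt 3 * κ)) < 1 := by
    rw [Real.exp_lt_one_iff, neg_lt_zero]
    positivity
  linarith

theorem expComb_zero (κ : ℝ) (a b c : ℂ) : expComb κ a b c 0 = a + b + c * decayB κ := by
  simp [expComb, decayB]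

theorem expComb_one (κ : ℝ) (a b c : ℂ) :
    expComb κ a b c 1 = a * Complex.exp (Complex.I * κ) + b * decayA κ + c := by
  simp [expComb, decayA]

theorem layerB_mul {κ : ℝ} (hκ : 0 < κ) :
    layerB κ * (1 - decayA κ * decayB κ) = -1 + decayB κ * Complex.exp (Complex.I * κ) :=
  div_mul_cancel₀ _ (one_sub_decay_ne_zero hκ)

theorem layerC_mul {κ : ℝ} (hκ : 0 < κ) :
    layerC κ * (1 - decayA κ * decayB κ) = -Complex.exp (Complex.I * κ) + decayA κ :=
  div_mul_cancel₀ _ (one_sub_decay_ne_zero hκ)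

theorem airyMode_zero {κ : ℝ} (hκ : 0 < κ) : airyMode κ 0 = 0 := by
  rw [airyMode, expComb_zero]
  apply mul_right_cancel₀ (one_sub_decay_ne_zero hκ)
  linear_combination layerB_mul hκ + decayB κ * layerC_mul hκ

theorem airyMode_one {κ : ℝ} (hκ : 0 < κ) : airyMode κ 1 = 0 := by
  rw [airyMode, expComb_one]
  apply mul_right_cancel₀ (one_sub_decay_ne_zero hκ)
  linear_combination decayA κ * layerB_mul hκ + layerC_mul hκ

theorem expComb_deriv_jump (κ : ℝ) :
    expComb κ (Complex.I * κ * 1) (-rootA * κ * layerB κ) (rootB * κ * layerC κ) 1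
      - expComb κ (Complex.I * κ * 1) (-rootA * κ * layerB κ) (rootB * κ * layerC κ) 0
      = κ * chi κ := by
  rw [expComb_zero, expComb_one, chi]
  ring

/-- A combination of exponentials that satisfies the Dirichlet conditions is a multiple of the
mode. -/
theorem layer_eq {κ : ℝ} (hκ : 0 < κ) {a b c : ℂ} (h0 : expComb κ a b c 0 = 0)
    (h1 : expComb κ a b c 1 = 0) : b = a * layerB κ ∧ c = a * layerC κ := by
  rw [expComb_zero] at h0
  rw [expComb_one] at h1
  constructor <;> apply mul_right_cancel₀ (one_sub_decay_ne_zero hκ)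
  · linear_combination h0 - decayB κ * h1 - a * layerB_mul hκ
  · linear_combination h1 - decayA κ * h0 - a * layerC_mul hκ

/-! ### The eigenvalue problem -/

/-- A root of `chi` supplies the third boundary condition, so the Green operator undoes `∂³`, which
multiplies the mode by `-iκ³`. -/
theorem greenOp_airyMode {κ : ℝ} (hκ : 0 < κ) (hχ : chi κ = 0) :
    greenOp (toL2 (airyMode κ)) = (Complex.I / κ ^ 3) • toL2 (airyMode κ) := by
  have hκ' : (κ : ℂ) ≠ 0 := by exact_mod_cast hκ.ne'
  have h := greenOp_of_hasDerivAt (hasDerivAt_expComb κ 1 (layerB κ) (layerC κ))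
    (hasDerivAt_expComb κ _ _ _) (hasDerivAt_expComb κ _ _ _) (continuous_expComb κ _ _ _)
    (airyMode_zero hκ) (airyMode_one hκ)
    (sub_eq_zero.1 (by rw [expComb_deriv_jump, hχ, mul_zero]))
  have h3 : toL2 (expComb κ (Complex.I * κ * (Complex.I * κ * (Complex.I * κ * 1)))
      (-rootA * κ * (-rootA * κ * (-rootA * κ * layerB κ)))
      (rootB * κ * (rootB * κ * (rootB * κ * layerC κ))))
      = (-Complex.I * κ ^ 3) • toL2 (airyMode κ) := by
    apply Lp.ext
    filter_upwards [coeFn_toL2_of_continuous (continuous_expComb κ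
      (Complex.I * κ * (Complex.I * κ * (Complex.I * κ * 1)))
      (-rootA * κ * (-rootA * κ * (-rootA * κ * layerB κ)))
      (rootB * κ * (rootB * κ * (rootB * κ * layerC κ)))),
      coeFn_toL2_of_continuous (continuous_expComb κ 1 (layerB κ) (layerC κ)),
      Lp.coeFn_smul (-Complex.I * κ ^ 3 : ℂ) (toL2 (airyMode κ))] with x h1 h2 h3
    rw [h1, h3, Pi.smul_apply, airyMode, h2, expComb_third, smul_eq_mul]
  rw [h3, map_smul] at h
  change _ = toL2 (airyMode κ) at h
  conv_rhs => rw [← h]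
  rw [smul_smul]
  have : Complex.I / κ ^ 3 * (-Complex.I * κ ^ 3) = 1 := by
    field_simp
    linear_combination -Complex.I_sq
  rw [this, one_smul]

/-- Since `∂³ - z³ = (∂ - z)(∂² + z∂ + z²)`, the function `f'' + z f' + z² f` solves `y' = z y`. -/
theorem eq_mul_exp_of_ode {f f₁ f₂ f₃ : ℝ → ℂ} (h₁ : ∀ x, HasDerivAt f (f₁ x) x)
    (h₂ : ∀ x, HasDerivAt f₁ (f₂ x) x) (h₃ : ∀ x, HasDerivAt f₂ (f₃ x) x) {l z : ℂ}
    (hl : ∀ x ∈ Icc (0 : ℝ) 1, f₃ x = l * f x) (hz : z ^ 3 = l) {x : ℝ} (hx : x ∈ Icc (0 : ℝ) 1) :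
    f₂ x + z * f₁ x + z ^ 2 * f x = (f₂ 0 + z * f₁ 0 + z ^ 2 * f 0) * Complex.exp (z * x) := by
  have hd : ∀ y ∈ Icc (0 : ℝ) 1, HasDerivAt
      (fun y : ℝ => (f₂ y + z * f₁ y + z ^ 2 * f y) * Complex.exp (-z * y)) 0 y := fun y hy => by
    have hid : HasDerivAt (fun y : ℝ => (y : ℂ)) 1 y := (hasDerivAt_id (y : ℂ)).comp_ofReal
    have h := (((h₃ y).add ((h₂ y).const_mul z)).add ((h₁ y).const_mul (z ^ 2))).mul
      (hid.const_mul (-z)).cexp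
    convert! h using 1
    simp only [Pi.add_apply]
    rw [hl y hy, ← hz]
    ring
  have hc := constant_of_has_deriv_right_zero (a := (0 : ℝ)) (b := 1)
    (fun y hy => (hd y hy).continuousAt.continuousWithinAt)
    (fun y hy => (hd y (Ico_subset_Icc_self hy)).hasDerivWithinAt) x hx
  simp only [Complex.ofReal_zero, mul_zero, Complex.exp_zero, mul_one] at hc
  rw [← hc, mul_assoc, ← Complex.exp_add]
  simp

/-- The first order equations for the three cube roots `z` of `-iκ³` are inverted as a discrete
Fourier transform: weighting `f'' + z f' + z² f` by `z` and summing leaves `3z³ f`, weighting by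
`z²` leaves `3z³ f'`. -/
theorem expComb_of_ode {f f₁ f₂ f₃ : ℝ → ℂ} (h₁ : ∀ x, HasDerivAt f (f₁ x) x)
    (h₂ : ∀ x, HasDerivAt f₁ (f₂ x) x) (h₃ : ∀ x, HasDerivAt f₂ (f₃ x) x) {κ : ℝ} (hκ : 0 < κ)
    (hl : ∀ x ∈ Icc (0 : ℝ) 1, f₃ x = -Complex.I * κ ^ 3 * f x) :
    ∃ a b c : ℂ, ∀ x ∈ Icc (0 : ℝ) 1, f x = expComb κ a b c x ∧
      f₁ x = expComb κ (Complex.I * κ * a) (-rootA * κ * b) (rootB * κ * c) x := by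
  have hκ' : (κ : ℂ) ≠ 0 := by exact_mod_cast hκ.ne'
  have hI := Complex.I_sq
  have e0 : ∀ x ∈ Icc (0 : ℝ) 1, _ := fun x hx => eq_mul_exp_of_ode h₁ h₂ h₃ hl
    (z := Complex.I * κ) (by linear_combination Complex.I * κ ^ 3 * hI) hx
  have e1 : ∀ x ∈ Icc (0 : ℝ) 1, _ := fun x hx => eq_mul_exp_of_ode h₁ h₂ h₃ hl
    (z := -rootA * κ) (by linear_combination -κ ^ 3 * rootA_cube) hx
  have e2 : ∀ x ∈ Icc (0 : ℝ) 1, _ := fun x hx => eq_mul_exp_of_ode h₁ h₂ h₃ hl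
    (z := rootB * κ) (by linear_combination κ ^ 3 * rootB_cube) hx
  set c0 := f₂ 0 + Complex.I * κ * f₁ 0 + (Complex.I * κ) ^ 2 * f 0
  set c1 := f₂ 0 + -rootA * κ * f₁ 0 + (-rootA * κ) ^ 2 * f 0
  set c2 := f₂ 0 + rootB * κ * f₁ 0 + (rootB * κ) ^ 2 * f 0
  have hI0 := Complex.I_ne_zero
  -- The weights `z / (3z³)`. The last one carries `e^{rootB κ}` because `expComb` normalizes the
  -- growing exponential at `x = 1`.
  refine ⟨c0 * (Complex.I * κ) / (3 * (-Complex.I * κ ^ 3)),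
    c1 * (-rootA * κ) / (3 * (-Complex.I * κ ^ 3)),
    c2 * (rootB * κ) / (3 * (-Complex.I * κ ^ 3)) * Complex.exp (rootB * κ), fun x hx => ?_⟩
  have hexp : Complex.exp (rootB * κ) * Complex.exp (-rootB * κ * (1 - x))
      = Complex.exp (rootB * κ * x) := by
    rw [← Complex.exp_add]; congr 1; ring
  -- Power sums of the cube roots `i`, `-rootA`, `rootB` of `-i`: they vanish unless the exponent is
  -- a multiple of three.
  have hsum : Complex.I - rootA + rootB = 0 := by linear_combination -rootA_sub_rootB
  have hsq : Complex.I ^ 2 + rootA ^ 2 + rootB ^ 2 = 0 := by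
    linear_combination 2 * hI + rootA_sq + rootB_sq + Complex.I * rootA_sub_rootB
  have hcu : Complex.I ^ 3 - rootA ^ 3 + rootB ^ 3 = -3 * Complex.I := by
    linear_combination Complex.I * hI - rootA_cube + rootB_cube
  have hq : Complex.I ^ 4 + rootA ^ 4 + rootB ^ 4 = 0 := by
    linear_combination rootA * rootA_cube + rootB * rootB_cube + Complex.I * rootA_sub_rootB
      + (Complex.I ^ 2 + 0) * hI
  replace e0 := e0 x hx
  replace e1 := e1 x hx
  replace e2 := e2 x hx
  have hd : (3 * (-Complex.I * κ ^ 3) : ℂ) ≠ 0 := by simp [hI0, hκ']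
  unfold expComb
  constructor
  · have : c2 * (rootB * κ) / (3 * (-Complex.I * κ ^ 3)) * Complex.exp (rootB * κ)
        * Complex.exp (-rootB * κ * (1 - x))
        = rootB * κ * (c2 * Complex.exp (rootB * κ * x)) / (3 * (-Complex.I * κ ^ 3)) := by
      rw [mul_assoc, hexp]; ring
    rw [this, ← e2]
    have h' : f x * (3 * (-Complex.I * κ ^ 3))
        = Complex.I * κ * (c0 * Complex.exp (Complex.I * κ * x))
          + -rootA * κ * (c1 * Complex.exp (-rootA * κ * x))
          + rootB * κ * (f₂ x + rootB * κ * f₁ x + (rootB * κ) ^ 2 * f x) := by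
      rw [← e0, ← e1]
      linear_combination -κ * f₂ x * hsum - κ ^ 2 * f₁ x * hsq - κ ^ 3 * f x * hcu
    rw [← eq_div_iff hd] at h'
    refine h'.trans ?_
    ring
  · have : rootB * κ * (c2 * (rootB * κ) / (3 * (-Complex.I * κ ^ 3)) * Complex.exp (rootB * κ))
        * Complex.exp (-rootB * κ * (1 - x))
        = (rootB * κ) ^ 2 * (c2 * Complex.exp (rootB * κ * x)) / (3 * (-Complex.I * κ ^ 3)) := by
      rw [← hexp]; ring
    rw [this, ← e2]
    have h' : f₁ x * (3 * (-Complex.I * κ ^ 3))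
        = (Complex.I * κ) ^ 2 * (c0 * Complex.exp (Complex.I * κ * x))
          + (-rootA * κ) ^ 2 * (c1 * Complex.exp (-rootA * κ * x))
          + (rootB * κ) ^ 2 * (f₂ x + rootB * κ * f₁ x + (rootB * κ) ^ 2 * f x) := by
      rw [← e0, ← e1]
      linear_combination -κ ^ 2 * f₂ x * hsq - κ ^ 3 * f₁ x * hcu - κ ^ 4 * f x * hq
    rw [← eq_div_iff hd] at h'
    refine h'.trans ?_
    ring

theorem hasDerivAt_integral_zero {f : ℝ → ℂ} (hf : Continuous f) (x : ℝ) :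
    HasDerivAt (fun x => ∫ y in (0 : ℝ)..x, f y) (f x) x :=
  intervalIntegral.integral_hasDerivAt_right (hf.intervalIntegrable _ _)
    (hf.stronglyMeasurableAtFilter _ _) hf.continuousAt

/-- The values of the Green operator are three times differentiable and satisfy the boundary
conditions. -/
theorem exists_primitive_greenFun {h : ℝ → ℂ} (hh : Continuous h) :
    ∃ f f₁ f₂ : ℝ → ℂ, (∀ x, HasDerivAt f (f₁ x) x) ∧ (∀ x, HasDerivAt f₁ (f₂ x) x) ∧
      (∀ x, HasDerivAt f₂ (h x) x) ∧ f 0 = 0 ∧ f 1 = 0 ∧ f₁ 1 = f₁ 0 ∧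
      ∀ x ∈ Icc (0 : ℝ) 1, greenFun h x = f x := by
  set J₁ : ℝ → ℂ := fun x => ∫ y in (0 : ℝ)..x, h y with hJ₁
  have d₁ : ∀ x, HasDerivAt J₁ (h x) x := hasDerivAt_integral_zero hh
  have c₁ : Continuous J₁ := continuous_iff_continuousAt.2 fun x => (d₁ x).continuousAt
  set J₂ : ℝ → ℂ := fun x => ∫ y in (0 : ℝ)..x, J₁ y with hJ₂
  have d₂ : ∀ x, HasDerivAt J₂ (J₁ x) x := hasDerivAt_integral_zero c₁
  have c₂ : Continuous J₂ := continuous_iff_continuousAt.2 fun x => (d₂ x).continuousAt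
  set J₃ : ℝ → ℂ := fun x => ∫ y in (0 : ℝ)..x, J₂ y with hJ₃
  have d₃ : ∀ x, HasDerivAt J₃ (J₂ x) x := hasDerivAt_integral_zero c₂
  have z₂ : J₂ 0 = 0 := by simp [hJ₂]
  have z₃ : J₃ 0 = 0 := by simp [hJ₃]
  -- The triple primitive is corrected by `a x + b x²`: `b` equalizes the slopes at the two ends,
  -- then `a` gives the value `0` at `1`.
  set b : ℂ := -J₂ 1 / 2 with hb
  set a : ℂ := -J₃ 1 - b with ha
  have hid : ∀ y : ℝ, HasDerivAt (fun y : ℝ => (y : ℂ)) 1 y := fun y =>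
    (hasDerivAt_id (y : ℂ)).comp_ofReal
  have h1 : ∀ x, HasDerivAt (fun x : ℝ => J₃ x + a * x + b * (x : ℂ) ^ 2) (J₂ x + a + 2 * b * x) x :=
    fun x => by
      convert! ((d₃ x).add ((hid x).const_mul a)).add (((hid x).pow 2).const_mul b) using 1
      push_cast
      ring
  have h2 : ∀ x, HasDerivAt (fun x : ℝ => J₂ x + a + 2 * b * x) (J₁ x + 2 * b) x := fun x => by
    convert! ((d₂ x).add_const a).add ((hid x).const_mul (2 * b)) using 1
    ring
  have h3 : ∀ x, HasDerivAt (fun x : ℝ => J₁ x + 2 * b) (h x) x := fun x => (d₁ x).add_const _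
  have e0 : J₃ 0 + a * ((0 : ℝ) : ℂ) + b * ((0 : ℝ) : ℂ) ^ 2 = 0 := by simp [z₃]
  have e1 : J₃ 1 + a * ((1 : ℝ) : ℂ) + b * ((1 : ℝ) : ℂ) ^ 2 = 0 := by simp [ha]; ring
  have ep : J₂ 1 + a + 2 * b * ((1 : ℝ) : ℂ) = J₂ 0 + a + 2 * b * ((0 : ℝ) : ℂ) := by
    simp [hb, z₂]; ring
  exact ⟨_, _, _, h1, h2, h3, e0, e1, ep, fun x hx => greenFun_of_hasDerivAt h1 h2 h3 hh e0 e1 ep hx⟩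

/-- The eigenfunctions of the Green operator are multiples of modes. -/
theorem eq_smul_airyMode_of_greenOp {κ : ℝ} (hκ : 0 < κ) {f : L2C}
    (hf : greenOp f = (Complex.I / κ ^ 3) • f) :
    f = 0 ∨ chi κ = 0 ∧ ∃ r : ℂ, f = r • toL2 (airyMode κ) := by
  have hκ' : (κ : ℂ) ≠ 0 := by exact_mod_cast hκ.ne'
  -- Regularity by bootstrapping: the eigenvalue equation identifies `f` almost everywhere with the
  -- continuous function `h`, and the Green integral of `h` is then three times differentiable.
  set h : ℝ → ℂ := fun x => -Complex.I * κ ^ 3 * greenFun f x with hh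
  have hc : Continuous h := continuous_const.mul (continuous_greenFun (integrable_coeFn f))
  have hfh : f =ᵐ[volI] h := by
    filter_upwards [coeFn_greenOp f, Lp.coeFn_smul (Complex.I / κ ^ 3 : ℂ) f] with x h1 h2
    rw [hf, h2, Pi.smul_apply, smul_eq_mul] at h1
    rw [hh]
    simp only
    rw [← h1]
    field_simp
    linear_combination f x * Complex.I_sq
  obtain ⟨φ, φ₁, φ₂, d₁, d₂, d₃, e0, e1, ep, hφ⟩ := exists_primitive_greenFun hc
  have hhφ : ∀ x ∈ Icc (0 : ℝ) 1, h x = -Complex.I * κ ^ 3 * φ x := fun x hx => by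
    rw [hh]
    simp only
    rw [greenFun_congr hfh, hφ x hx]
  obtain ⟨a, b, c, habc⟩ := expComb_of_ode d₁ d₂ d₃ hκ hhφ
  have m0 : (0 : ℝ) ∈ Icc (0 : ℝ) 1 := by simp
  have m1 : (1 : ℝ) ∈ Icc (0 : ℝ) 1 := by simp
  obtain ⟨hb, hc'⟩ := layer_eq hκ (by rw [← (habc 0 m0).1, e0]) (by rw [← (habc 1 m1).1, e1])
  have hfa : ∀ᵐ x ∂volI, f x = -Complex.I * κ ^ 3 * a * airyMode κ x := by
    filter_upwards [hfh, ae_volI_mem] with x hx hx01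
    have := expComb_smul κ a 1 (layerB κ) (layerC κ) x
    rw [mul_one] at this
    rw [hx, hhφ x (Ioo_subset_Icc_self hx01), (habc x (Ioo_subset_Icc_self hx01)).1, hb, hc',
      airyMode, mul_assoc (-Complex.I * κ ^ 3 : ℂ), this]
  -- The Dirichlet conditions have reduced `f` to a multiple of the mode; the condition on the
  -- derivative now forces the factor or `chi κ` to vanish.
  have hjump : a * (κ * chi κ) = 0 := by
    rw [(habc 0 m0).2, (habc 1 m1).2, hb, hc'] at ep
    rw [← expComb_deriv_jump, mul_sub, ← expComb_smul, ← expComb_smul, sub_eq_zero]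
    convert! ep using 2 <;> ring
  rcases mul_eq_zero.1 hjump with ha | hχ
  · left
    apply Lp.ext
    filter_upwards [hfa, Lp.coeFn_zero ℂ 2 volI] with x h1 h2
    rw [h1, h2, ha]
    simp
  · right
    refine ⟨(mul_eq_zero.1 hχ).resolve_left hκ', -Complex.I * κ ^ 3 * a, ?_⟩
    apply Lp.ext
    filter_upwards [hfa, Lp.coeFn_smul (-Complex.I * κ ^ 3 * a : ℂ) (toL2 (airyMode κ)),
      coeFn_toL2_of_continuous (continuous_expComb κ 1 (layerB κ) (layerC κ))] with x h1 h2 h3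
    rw [h1, h2, Pi.smul_apply, airyMode, h3, smul_eq_mul]

/-! ### Completeness of the modes -/

/-- The kernel is real. Hence conjugation maps eigenfunctions to eigenfunctions with conjugate
eigenvalue, which replaces a separate study of negative wave numbers. -/
theorem greenFun_star (f : L2C) (x : ℝ) : greenFun (star f : L2C) x = conj (greenFun f x) := by
  rw [greenFun_congr (Lp.coeFn_star f), greenFun, greenFun, ← integral_conj]
  refine integral_congr_ae (.of_forall fun y => ?_)
  simp

theorem greenOp_star (f : L2C) : greenOp (star f) = star (greenOp f) := by
  apply Lp.ext
  filter_upwards [coeFn_greenOp f, coeFn_greenOp (star f), Lp.coeFn_star (greenOp f)] with x h1 h2 h3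
  rw [h2, h3, Pi.star_apply, h1, greenFun_star]
  rfl

theorem star_smul_L2C (c : ℂ) (f : L2C) : star (c • f) = conj c • star f := by
  apply Lp.ext
  filter_upwards [Lp.coeFn_star (c • f), Lp.coeFn_smul c f, Lp.coeFn_star f,
    Lp.coeFn_smul (conj c) (star f)] with x h1 h2 h3 h4
  rw [h1, h4, Pi.star_apply, h2, Pi.smul_apply, Pi.smul_apply, h3, Pi.star_apply, smul_eq_mul,
    smul_eq_mul, star_mul', starRingEnd_apply]

theorem inner_star_star (f g : L2C) : inner ℂ (star f) (star g) = conj (inner ℂ f g) := by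
  rw [inner_eq_integral, inner_eq_integral, ← integral_conj]
  refine integral_congr_ae ?_
  filter_upwards [Lp.coeFn_star f, Lp.coeFn_star g] with x h1 h2
  simp [h1, h2]

theorem isSymmetric_I_smul_greenOp : (Complex.I • greenOp : L2C →L[ℂ] L2C).IsSymmetric := by
  intro f g
  simp only [ContinuousLinearMap.coe_coe, smul_apply, inner_smul_left,
    inner_smul_right, inner_greenOp_left, Complex.conj_I]
  ring

theorem exists_pos_cube_eq {r : ℝ} (hr : 0 < r) : ∃ κ : ℝ, 0 < κ ∧ κ ^ 3 = r := by
  refine ⟨r ^ (1 / 3 : ℝ), by positivity, ?_⟩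
  rw [← Real.rpow_natCast, ← Real.rpow_mul hr.le]
  norm_num

/-- A real function that is orthogonal to all modes vanishes. -/
theorem eq_zero_of_forall_inner_airyMode {w : L2C} (hw : star w = w)
    (h : ∀ κ : ℝ, 0 < κ → chi κ = 0 → inner ℂ (toL2 (airyMode κ)) w = 0) : w = 0 := by
  have hspec := ContinuousLinearMap.orthogonalComplement_iSup_eigenspaces_eq_bot
    (T := (Complex.I • greenOp : L2C →L[ℂ] L2C)) (isCompactOperator_greenOp.smul Complex.I)
    isSymmetric_I_smul_greenOp
  suffices hmem : w ∈ (⨆ μ, Module.End.eigenspace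
      ((Complex.I • greenOp : L2C →L[ℂ] L2C) : Module.End ℂ L2C) μ)ᗮ by
    rwa [hspec, Submodule.mem_bot] at hmem
  have hpos : ∀ κ : ℝ, 0 < κ → ∀ f : L2C, greenOp f = (Complex.I / κ ^ 3) • f →
      inner ℂ f w = 0 := by
    intro κ hκ f hf
    rcases eq_smul_airyMode_of_greenOp hκ hf with rfl | ⟨hχ, r, rfl⟩
    · exact inner_zero_left _
    · rw [inner_smul_left, h κ hκ hχ, mul_zero]
  rw [Submodule.mem_orthogonal]
  intro v hv
  refine Submodule.iSup_induction _ (motive := fun v => inner ℂ v w = 0) hv ?_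
    (inner_zero_left _) fun x y hx hy => by rw [inner_add_left, hx, hy, add_zero]
  intro μ f hfμ
  by_cases hf0 : f = 0
  · rw [hf0, inner_zero_left]
  have hμ : conj μ = μ := isSymmetric_I_smul_greenOp.conj_eigenvalue_eq_self
    (Module.End.hasEigenvalue_of_hasEigenvector ⟨hfμ, hf0⟩)
  rw [Module.End.mem_eigenspace_iff] at hfμ
  obtain ⟨r, rfl⟩ := Complex.conj_eq_iff_real.1 hμ
  have hf : greenOp f = (-Complex.I * r) • f := by
    have : Complex.I • greenOp f = (r : ℂ) • f := hfμ
    rw [mul_smul, ← this, smul_smul]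
    simp
  -- A negative `r` belongs to the wave number with `κ³ = -1/r`, and `r = 0` is excluded by
  -- injectivity. For `r > 0` the conjugate of `f` belongs to a positive wave number; as `w` is
  -- real, orthogonality to the conjugate is orthogonality to `f`.
  rcases lt_trichotomy r 0 with hr | rfl | hr
  · obtain ⟨κ, hκ, hκr⟩ := exists_pos_cube_eq (r := (-r)⁻¹) (by rw [inv_pos]; linarith)
    refine hpos κ hκ f ?_
    rw [hf, ← Complex.ofReal_pow, hκr]
    congr 1
    push_cast
    rw [div_inv_eq_mul]
    ring
  · exact absurd (greenOp_injective (by rw [hf]; simp)) hf0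
  · obtain ⟨κ, hκ, hκr⟩ := exists_pos_cube_eq (inv_pos.2 hr)
    have := hpos κ hκ (star f) (by
      rw [greenOp_star, hf, star_smul_L2C, ← Complex.ofReal_pow, hκr]
      congr 1
      simp)
    have h2 := inner_star_star f w
    rw [hw, this] at h2
    exact (map_eq_zero _).1 h2.symm

/-! ### The orthonormal system of modes -/

theorem inner_eq_zero_of_greenOp {f g : L2C} {a b : ℝ} (hf : greenOp f = (Complex.I * a) • f)
    (hg : greenOp g = (Complex.I * b) • g) (hab : a ≠ b) : inner ℂ f g = 0 := by
  have h := inner_greenOp_left f g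
  rw [hf, hg, inner_smul_left, inner_smul_right] at h
  simp only [map_mul, Complex.conj_I, Complex.conj_ofReal] at h
  have h2 : Complex.I * ((b - a : ℝ) : ℂ) * inner ℂ f g = 0 := by
    push_cast
    linear_combination h
  have h3 : ((b - a : ℝ) : ℂ) ≠ 0 := by
    rw [Complex.ofReal_ne_zero]; exact sub_ne_zero.2 hab.symm
  exact (mul_eq_zero.1 h2).resolve_left (mul_ne_zero Complex.I_ne_zero h3)

theorem toL2_airyMode_ne_zero {κ : ℝ} (hκ : 0 < κ) : toL2 (airyMode κ) ≠ 0 := by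
  intro h
  have hc := continuous_expComb κ 1 (layerB κ) (layerC κ)
  have hae : airyMode κ =ᵐ[volume.restrict (Ioo (0 : ℝ) 1)] fun _ => (0 : ℂ) := by
    have h1 := coeFn_toL2_of_continuous hc
    change toL2 (airyMode κ) =ᵐ[volI] airyMode κ at h1
    rw [h] at h1
    filter_upwards [h1, Lp.coeFn_zero ℂ 2 volI] with x h1 h2
    rw [← h1, h2, Pi.zero_apply]
  have heq : EqOn (airyMode κ) (fun _ => (0 : ℂ)) (Ioo 0 1) :=
    Measure.eqOn_open_of_ae_eq hae isOpen_Ioo hc.continuousOn continuousOn_const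
  have step : ∀ f f' : ℝ → ℂ, (∀ x, HasDerivAt f (f' x) x) → EqOn f (fun _ => 0) (Ioo 0 1) →
      EqOn f' (fun _ => 0) (Ioo 0 1) := by
    intro f f' hd hf x hx
    have h0 : HasDerivAt f 0 x := (hasDerivAt_const x (0 : ℂ)).congr_of_eventuallyEq
      (Filter.eventuallyEq_of_mem (isOpen_Ioo.mem_nhds hx) hf)
    exact (hd x).unique h0
  have h1 := step _ _ (hasDerivAt_expComb κ _ _ _) heq
  have h2 := step _ _ (hasDerivAt_expComb κ _ _ _) h1
  have hm : (1 / 2 : ℝ) ∈ Ioo (0 : ℝ) 1 := by norm_num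
  have e0 := heq hm
  have e1 := h1 hm
  have e2 := h2 hm
  simp only [airyMode, expComb] at e0 e1 e2
  set E := Complex.exp (Complex.I * κ * ((1 / 2 : ℝ) : ℂ)) with hE
  -- By `rootA_sq` and `rootB_sq` the operator `∂² + iκ∂ - κ²` annihilates both layers, and it
  -- multiplies `e^{iκx}` by `-3κ²`.
  have hz : 3 * (κ : ℂ) ^ 2 * E = 0 := by
    generalize Complex.exp (-rootA * κ * ((1 / 2 : ℝ) : ℂ)) = EA at e0 e1 e2
    generalize Complex.exp (-rootB * κ * (1 - ((1 / 2 : ℝ) : ℂ))) = EB at e0 e1 e2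
    linear_combination -e2 - Complex.I * κ * e1 + κ ^ 2 * e0
      + κ ^ 2 * (2 * E) * Complex.I_sq
      + κ ^ 2 * layerB κ * EA * rootA_sq + κ ^ 2 * layerC κ * EB * rootB_sq
  have hE0 : E ≠ 0 := Complex.exp_ne_zero _
  have hκ' : (κ : ℂ) ≠ 0 := by exact_mod_cast hκ.ne'
  simp [hE0, hκ'] at hz

/-- The wave numbers of the boundary value problem. -/
abbrev WaveSet : Type := {κ : ℝ // 0 < κ ∧ chi κ = 0}

/-- The normalized modes. -/
def unitMode (κ : WaveSet) : L2C := (‖toL2 (airyMode κ)‖⁻¹ : ℂ) • toL2 (airyMode κ)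

theorem greenOp_unitMode (κ : WaveSet) :
    greenOp (unitMode κ) = (Complex.I * ((1 / (κ : ℝ) ^ 3 : ℝ) : ℂ)) • unitMode κ := by
  rw [unitMode, map_smul, greenOp_airyMode κ.2.1 κ.2.2, smul_comm]
  congr 2
  push_cast
  ring

theorem greenOp_star_unitMode (κ : WaveSet) :
    greenOp (star (unitMode κ))
      = (Complex.I * ((-(1 / (κ : ℝ) ^ 3) : ℝ) : ℂ)) • star (unitMode κ) := by
  rw [greenOp_star, greenOp_unitMode, star_smul_L2C]
  congr 1
  rw [map_mul, Complex.conj_I, Complex.conj_ofReal]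
  push_cast
  ring

theorem one_div_cube_injOn {a b : ℝ} (ha : 0 < a) (hb : 0 < b) (h : 1 / a ^ 3 = 1 / b ^ 3) :
    a = b := by
  rw [one_div, one_div, inv_inj] at h
  exact (pow_left_inj₀ ha.le hb.le (by norm_num)).1 h

theorem orthonormal_unitMode : Orthonormal ℂ unitMode := by
  constructor
  · intro κ
    have : ‖toL2 (airyMode κ)‖ ≠ 0 := norm_ne_zero_iff.2 (toL2_airyMode_ne_zero κ.2.1)
    rw [unitMode, norm_smul, norm_inv, Complex.norm_real, norm_norm, inv_mul_cancel₀ this]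
  · intro κ κ' hne
    exact inner_eq_zero_of_greenOp (greenOp_unitMode κ) (greenOp_unitMode κ') fun h =>
      hne (Subtype.ext (one_div_cube_injOn κ.2.1 κ'.2.1 h))

/-- The two eigenvalues are `-i/κ³` and `i/κ'³`, which differ because both wave numbers are
positive. -/
theorem inner_star_unitMode (κ κ' : WaveSet) : inner ℂ (star (unitMode κ)) (unitMode κ') = 0 := by
  refine inner_eq_zero_of_greenOp (greenOp_star_unitMode κ) (greenOp_unitMode κ') ?_
  have h1 := κ.2.1
  have h2 := κ'.2.1
  have h3 : 0 < 1 / (κ : ℝ) ^ 3 := by positivity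
  have h4 : 0 < 1 / (κ' : ℝ) ^ 3 := by positivity
  linarith

/-! ### Real and complex functions -/

/-- The inclusion of `L²((0,1); ℝ)` in `L²((0,1); ℂ)`. -/
def complexify : L2I →L[ℝ] L2C := Complex.ofRealCLM.compLpL 2 volI

/-- The real part of an element of `L²((0,1); ℂ)`. -/
def realPart : L2C →L[ℝ] L2I := Complex.reCLM.compLpL 2 volI

theorem coeFn_complexify (v : L2I) : ∀ᵐ x ∂volI, complexify v x = (v x : ℂ) :=
  Complex.ofRealCLM.coeFn_compLpL v

theorem coeFn_realPart (f : L2C) : ∀ᵐ x ∂volI, realPart f x = (f x).re :=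
  Complex.reCLM.coeFn_compLpL f

theorem star_complexify (v : L2I) : star (complexify v) = complexify v := by
  apply Lp.ext
  filter_upwards [coeFn_complexify v, Lp.coeFn_star (complexify v)] with x h1 h2
  rw [h2, Pi.star_apply, h1]
  exact Complex.conj_ofReal _

theorem complexify_injective {v : L2I} (h : complexify v = 0) : v = 0 := by
  apply Lp.ext
  have h1 := coeFn_complexify v
  rw [h] at h1
  filter_upwards [h1, Lp.coeFn_zero ℂ 2 volI, Lp.coeFn_zero ℝ 2 volI] with x h1 h2 h3
  rw [h3, Pi.zero_apply]
  rw [h2, Pi.zero_apply] at h1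
  exact_mod_cast h1.symm

theorem complexify_two_realPart (f : L2C) :
    complexify ((2 : ℝ) • realPart f) = f + star f := by
  apply Lp.ext
  filter_upwards [coeFn_complexify ((2 : ℝ) • realPart f), Lp.coeFn_smul (2 : ℝ) (realPart f),
    coeFn_realPart f, Lp.coeFn_add f (star f), Lp.coeFn_star f] with x h1 h2 h3 h4 h5
  rw [h1, h2, h4, Pi.smul_apply, Pi.add_apply, h5, Pi.star_apply, h3]
  apply Complex.ext <;> simp
  ring

theorem inner_toL2_complexify {f : ℝ → ℂ} (hf : MemLp f 2 volI) (v : L2I) :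
    inner ℂ (toL2 f) (complexify v) = ∫ x, conj (f x) * (v x : ℂ) ∂volI := by
  rw [inner_toL2_left hf]
  exact integral_congr_ae ((coeFn_complexify v).mono fun x hx => by simp only [hx])

theorem inner_toL2_ofReal_complexify {φ : ℝ → ℝ} (hφ : Continuous φ) (v : L2I) :
    inner ℂ (toL2 fun x => (φ x : ℂ)) (complexify v) = ((∫ x, v x * φ x ∂volI : ℝ) : ℂ) := by
  have hc : Continuous fun x => (φ x : ℂ) := Complex.continuous_ofReal.comp hφ
  rw [inner_toL2_complexify (memLp_of_continuous hc 2),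
    ← integral_complex_ofReal]
  refine integral_congr_ae (.of_forall fun x => ?_)
  simp [mul_comm]

/-- Real functions are determined by their inner products with the modes. -/
theorem eq_of_forall_inner_unitMode {v w : L2I}
    (h : ∀ κ : WaveSet, inner ℂ (unitMode κ) (complexify v) = inner ℂ (unitMode κ) (complexify w)) :
    v = w := by
  rw [← sub_eq_zero]
  apply complexify_injective
  apply eq_zero_of_forall_inner_airyMode (star_complexify _)
  intro κ hκ hχ
  have := h ⟨κ, hκ, hχ⟩
  have hne : ‖toL2 (airyMode κ)‖ ≠ 0 := norm_ne_zero_iff.2 (toL2_airyMode_ne_zero hκ)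
  rw [← sub_eq_zero, ← inner_sub_right, ← map_sub, unitMode, inner_smul_left] at this
  refine (mul_eq_zero.1 this).resolve_left ?_
  simpa using hne

/-! ### The flow -/

theorem norm_exp_I_mul (a t : ℝ) : ‖Complex.exp (Complex.I * (a : ℂ) ^ 3 * t)‖ = 1 := by
  have : Complex.I * (a : ℂ) ^ 3 * t = ((a ^ 3 * t : ℝ) : ℂ) * Complex.I := by push_cast; ring
  rw [this, Complex.norm_exp_ofReal_mul_I]

/-- The coefficients of the flow at time `t`. -/
def flowCoeff (v : L2I) (t : ℝ) (κ : WaveSet) : ℂ :=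
  Complex.exp (Complex.I * ((κ : ℝ) : ℂ) ^ 3 * t) * inner ℂ (unitMode κ) (complexify v)

theorem norm_flowCoeff (v : L2I) (t : ℝ) (κ : WaveSet) :
    ‖flowCoeff v t κ‖ = ‖inner ℂ (unitMode κ) (complexify v)‖ := by
  rw [flowCoeff, norm_mul, norm_exp_I_mul, one_mul]

theorem memℓp_flowCoeff (v : L2I) (t : ℝ) : Memℓp (flowCoeff v t) 2 := by
  refine (memℓp_gen_iff (by norm_num)).2 ?_
  simp only [norm_flowCoeff]
  exact_mod_cast orthonormal_unitMode.inner_products_summable (x := complexify v)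

/-- The coefficient sequence of the flow as an element of `ℓ²`. -/
def flowSeq (v : L2I) (t : ℝ) : lp (fun _ : WaveSet => ℂ) 2 := ⟨flowCoeff v t, memℓp_flowCoeff v t⟩

/-- Each coefficient is continuous with constant modulus, so dominated convergence applies to the
square of the `ℓ²` distance, with four times the squared moduli as bound. -/
theorem continuous_flowSeq (v : L2I) : Continuous (flowSeq v) := by
  rw [continuous_iff_continuousAt]
  intro t
  have hsum := orthonormal_unitMode.inner_products_summable (x := complexify v)
  have h1 : Filter.Tendsto (fun s => ∑' κ, ‖flowCoeff v s κ - flowCoeff v t κ‖ ^ 2) (nhds t)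
      (nhds (∑' _ : WaveSet, (0 : ℝ))) := by
    refine tendsto_tsum_of_dominated_convergence (hsum.mul_left 4) (fun κ => ?_)
      (.of_forall fun s κ => ?_)
    · have : Continuous fun s => ‖flowCoeff v s κ - flowCoeff v t κ‖ ^ 2 := by
        unfold flowCoeff; fun_prop
      simpa using this.tendsto t
    · have := norm_sub_le (flowCoeff v s κ) (flowCoeff v t κ)
      rw [norm_flowCoeff, norm_flowCoeff] at this
      rw [Real.norm_of_nonneg (by positivity)]
      nlinarith [norm_nonneg (flowCoeff v s κ - flowCoeff v t κ)]
  rw [tsum_zero] at h1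
  have h2 : ∀ s, ‖flowSeq v s - flowSeq v t‖ ^ 2 = ∑' κ, ‖flowCoeff v s κ - flowCoeff v t κ‖ ^ 2 := by
    intro s
    have := lp.norm_rpow_eq_tsum (p := 2) (by norm_num) (flowSeq v s - flowSeq v t)
    simp only [ENNReal.toReal_ofNat, Real.rpow_ofNat] at this
    exact this
  rw [ContinuousAt, tendsto_iff_norm_sub_tendsto_zero]
  have h3 := (Real.continuous_sqrt.tendsto 0).comp h1
  rw [Real.sqrt_zero] at h3
  refine h3.congr fun s => ?_
  rw [Function.comp_apply, ← h2, Real.sqrt_sq (norm_nonneg _)]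

/-- The component of the solution with positive wave numbers. -/
def flow (v : L2I) (t : ℝ) : L2C :=
  orthonormal_unitMode.orthogonalFamily.linearIsometry (flowSeq v t)

theorem continuous_flow (v : L2I) : Continuous (flow v) :=
  (LinearIsometry.continuous _).comp (continuous_flowSeq v)

theorem hasSum_flow (v : L2I) (t : ℝ) :
    HasSum (fun κ => flowCoeff v t κ • unitMode κ) (flow v t) :=
  orthonormal_unitMode.orthogonalFamily.hasSum_linearIsometry (flowSeq v t)

theorem hasSum_inner_flow (f : L2C) (v : L2I) (t : ℝ) :
    HasSum (fun κ => flowCoeff v t κ * inner ℂ f (unitMode κ)) (inner ℂ f (flow v t)) := by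
  have := (hasSum_flow v t).mapL (innerSL ℂ f)
  simpa [inner_smul_right] using this

theorem inner_unitMode_flow (κ : WaveSet) (v : L2I) (t : ℝ) :
    inner ℂ (unitMode κ) (flow v t) = flowCoeff v t κ := by
  classical
  refine (hasSum_inner_flow (unitMode κ) v t).unique ?_
  convert hasSum_single κ fun κ' hne => ?_ using 1
  · rw [inner_self_eq_norm_sq_to_K, orthonormal_unitMode.1]; simp
  · rw [orthonormal_unitMode.2 hne.symm, mul_zero]

theorem inner_star_unitMode_flow (κ : WaveSet) (v : L2I) (t : ℝ) :
    inner ℂ (star (unitMode κ)) (flow v t) = 0 := by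
  refine (hasSum_inner_flow (star (unitMode κ)) v t).unique ?_
  simp only [inner_star_unitMode, mul_zero]
  exact hasSum_zero

/-- The solution of the boundary value problem with initial value `v`. -/
def airySolution (v : L2I) (t : ℝ) : L2I := (2 : ℝ) • realPart (flow v t)

theorem complexify_airySolution (v : L2I) (t : ℝ) :
    complexify (airySolution v t) = flow v t + star (flow v t) :=
  complexify_two_realPart _

theorem inner_unitMode_airySolution (κ : WaveSet) (v : L2I) (t : ℝ) :
    inner ℂ (unitMode κ) (complexify (airySolution v t)) = flowCoeff v t κ := by
  have h := inner_star_star (star (unitMode κ)) (flow v t)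
  rw [star_star, inner_star_unitMode_flow, map_zero] at h
  rw [complexify_airySolution, inner_add_right, inner_unitMode_flow, h, add_zero]

/-- At time `0` the flow alone is only the part of `v` with positive wave numbers. Adding its
conjugate restores `v`, because real functions are determined by their coefficients on these modes.
-/
theorem airySolution_zero (v : L2I) : airySolution v 0 = v :=
  eq_of_forall_inner_unitMode fun κ => by
    rw [inner_unitMode_airySolution, flowCoeff]; simp

theorem star_toL2_ofReal {φ : ℝ → ℝ} (hφ : Continuous φ) :
    star (toL2 fun x => (φ x : ℂ)) = toL2 fun x => (φ x : ℂ) := by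
  have hc : Continuous fun x => (φ x : ℂ) := Complex.continuous_ofReal.comp hφ
  apply Lp.ext
  filter_upwards [coeFn_toL2_of_continuous hc, Lp.coeFn_star (toL2 fun x => (φ x : ℂ))] with x h1 h2
  rw [h2, Pi.star_apply, h1]
  exact Complex.conj_ofReal _

theorem integral_airySolution_mul {φ : ℝ → ℝ} (hφ : Continuous φ) (v : L2I) (t : ℝ) :
    ∫ x, airySolution v t x * φ x ∂volI
      = 2 * (inner ℂ (toL2 fun x => (φ x : ℂ)) (flow v t) : ℂ).re := by
  have h := inner_toL2_ofReal_complexify hφ (airySolution v t)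
  have h2 := inner_star_star (toL2 fun x => (φ x : ℂ)) (flow v t)
  rw [star_toL2_ofReal hφ] at h2
  rw [complexify_airySolution, inner_add_right, h2, Complex.add_conj] at h
  exact_mod_cast h.symm

theorem summable_norm_flowCoeff_mul (f : L2C) (v : L2I) :
    Summable fun κ => ‖inner ℂ (unitMode κ) (complexify v)‖ * ‖inner ℂ f (unitMode κ)‖ := by
  have h1 := orthonormal_unitMode.inner_products_summable (x := complexify v)
  have h2 := orthonormal_unitMode.inner_products_summable (x := f)
  refine Summable.of_nonneg_of_le (fun κ => by positivity) (fun κ => ?_) (h1.add h2)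
  rw [norm_inner_symm f]
  nlinarith [sq_nonneg (‖inner ℂ (unitMode κ) (complexify v)‖ - ‖inner ℂ (unitMode κ) f‖),
    norm_nonneg (inner ℂ (unitMode κ) (complexify v) : ℂ), norm_nonneg (inner ℂ (unitMode κ) f : ℂ)]

/-- The factor `iκ³` from differentiating the phase is cancelled by the eigenvalue of the Green
operator, so the differentiated series has a summable bound that does not depend on time. -/
theorem hasDerivAt_inner_flow (f : L2C) (v : L2I) (t : ℝ) :
    HasDerivAt (fun s => (inner ℂ (greenOp f) (flow v s) : ℂ)) (inner ℂ f (flow v t)) t := by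
  have hsum := summable_norm_flowCoeff_mul f v
  have h := hasDerivAt_tsum (g := fun κ (s : ℝ) => flowCoeff v s κ * inner ℂ (greenOp f) (unitMode κ))
    (g' := fun κ s => flowCoeff v s κ * inner ℂ f (unitMode κ)) (y₀ := t) hsum ?_ ?_
    (hasSum_inner_flow _ v t).summable t
  · rw [(hasSum_inner_flow f v t).tsum_eq] at h
    refine h.congr_of_eventuallyEq (.of_forall fun s => ?_)
    exact (hasSum_inner_flow (greenOp f) v s).tsum_eq.symm
  · intro κ s
    have hid : HasDerivAt (fun y : ℝ => (y : ℂ)) 1 s := (hasDerivAt_id (s : ℂ)).comp_ofReal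
    have hd := (((hid.const_mul (Complex.I * ((κ : ℝ) : ℂ) ^ 3)).cexp.mul_const
      (inner ℂ (unitMode κ) (complexify v))).mul_const (inner ℂ (greenOp f) (unitMode κ)))
    convert! hd using 1
    rw [inner_greenOp_left, greenOp_unitMode, inner_smul_right, flowCoeff]
    have hκ : ((κ : ℝ) : ℂ) ≠ 0 := by exact_mod_cast κ.2.1.ne'
    push_cast
    field_simp
    linear_combination (inner ℂ (unitMode κ) (complexify v) : ℂ) * inner ℂ f (unitMode κ)
      * Complex.I_sq
  · intro κ s
    rw [norm_mul, norm_flowCoeff]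

theorem airySolution_isAirySolution {u₀ : ℝ → ℝ} (hu : MemLp u₀ 2 volI) :
    IsAirySolution u₀ (airySolution (hu.toLp u₀)) where
  continuous := (realPart.continuous.comp (continuous_flow _)).const_smul (2 : ℝ)
  initial := by
    rw [airySolution_zero]
    exact hu.coeFn_toLp
  weak := fun φ hφ t => by
    have hd : Continuous (iteratedDeriv 3 φ) :=
      hφ.smooth.continuous_iteratedDeriv 3 (WithTop.coe_le_coe.2 le_top)
    simp only [integral_airySolution_mul hφ.smooth.continuous, integral_airySolution_mul hd]
    -- Writing `φ` as `greenOp φ'''` brings the pairing to the form that `hasDerivAt_inner_flow`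
    -- differentiates.
    rw [← greenOp_iteratedDeriv hφ]
    have h := (hasDerivAt_inner_flow (toL2 fun x => ((iteratedDeriv 3 φ x : ℝ) : ℂ))
      (hu.toLp u₀) t)
    exact ((Complex.reCLM.hasFDerivAt.comp_hasDerivAt t h)).const_mul 2

/-! ### Uniqueness -/

/-- Test functions are real, so a mode enters the weak equation through its real and imaginary
parts: `L` will be `Complex.reCLM` and `Complex.imCLM`. -/
theorem airyMode_test_of_clm (L : ℂ →L[ℝ] ℝ) {κ : ℝ} (hκ : 0 < κ) (hχ : chi κ = 0) :
    IsTestFunction (fun x => L (airyMode κ x)) ∧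
      ∀ x, iteratedDeriv 3 (fun x => L (airyMode κ x)) x = L (-Complex.I * κ ^ 3 * airyMode κ x) := by
  have hd : ∀ a b c : ℂ, ∀ x, HasDerivAt (fun x => L (expComb κ a b c x))
      (L (expComb κ (Complex.I * κ * a) (-rootA * κ * b) (rootB * κ * c) x)) x :=
    fun a b c x => L.hasFDerivAt.comp_hasDerivAt x (hasDerivAt_expComb κ a b c x)
  have hd' : ∀ a b c : ℂ, deriv (fun x => L (expComb κ a b c x))
      = fun x => L (expComb κ (Complex.I * κ * a) (-rootA * κ * b) (rootB * κ * c) x) :=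
    fun a b c => funext fun x => (hd a b c x).deriv
  refine ⟨⟨L.contDiff.comp (contDiff_expComb κ _ _ _), ?_, ?_, ?_⟩, fun x => ?_⟩
  · simp only [airyMode_zero hκ, map_zero]
  · simp only [airyMode_one hκ, map_zero]
  · simp only [airyMode, hd']
    rw [sub_eq_zero.1 ((expComb_deriv_jump κ).trans (by rw [hχ, mul_zero]))]
  · rw [iteratedDeriv_eq_iterate]
    simp only [airyMode, Function.iterate_succ, Function.iterate_zero, Function.comp, id, hd']
    rw [expComb_third]

theorem integral_conj_mul_eq (g : ℝ → ℂ) (hg : Continuous g) (v : L2I) :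
    inner ℂ (toL2 g) (complexify v)
      = ((∫ x, v x * (g x).re ∂volI : ℝ) : ℂ) - Complex.I * ((∫ x, v x * (g x).im ∂volI : ℝ) : ℂ) := by
  have hre : Continuous fun x => (g x).re := Complex.continuous_re.comp hg
  have him : Continuous fun x => (g x).im := Complex.continuous_im.comp hg
  have hv : ∀ h : ℝ → ℝ, Continuous h → Integrable (fun x => ((v x * h x : ℝ) : ℂ)) volI :=
    fun h hh => ((Lp.memLp v).integrable_mul (memLp_of_continuous hh 2)).ofReal
  rw [inner_toL2_complexify (memLp_of_continuous hg 2), ← integral_complex_ofReal,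
    ← integral_complex_ofReal, ← integral_const_mul, ← integral_sub
      (hv _ hre) ((hv _ him).const_mul _)]
  refine integral_congr_ae (.of_forall fun x => ?_)
  apply Complex.ext <;> simp [mul_comm]

/-- The mode coefficients of a solution. -/
theorem IsAirySolution.inner_airyMode {u₀ : ℝ → ℝ} {u : ℝ → L2I} (hu : IsAirySolution u₀ u)
    {κ : ℝ} (hκ : 0 < κ) (hχ : chi κ = 0) (t : ℝ) :
    inner ℂ (toL2 (airyMode κ)) (complexify (u t))
      = Complex.exp (Complex.I * (κ : ℂ) ^ 3 * t)
        * inner ℂ (toL2 (airyMode κ)) (complexify (u 0)) := by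
  have hc : Continuous (airyMode κ) := continuous_expComb κ _ _ _
  obtain ⟨hre, hre3⟩ := airyMode_test_of_clm Complex.reCLM hκ hχ
  obtain ⟨him, him3⟩ := airyMode_test_of_clm Complex.imCLM hκ hχ
  set m : ℝ → ℂ := fun s => inner ℂ (toL2 (airyMode κ)) (complexify (u s)) with hm
  have hderiv : ∀ s, HasDerivAt m (Complex.I * κ ^ 3 * m s) s := by
    intro s
    have h1 := (hu.weak _ hre s).ofReal_comp
    have h2 := ((hu.weak _ him s).ofReal_comp).const_mul Complex.I
    have h3 := h1.sub h2
    simp only [hre3, him3] at h3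
    have e1 : ∀ x, Complex.reCLM (-Complex.I * κ ^ 3 * airyMode κ x) = κ ^ 3 * (airyMode κ x).im := by
      intro x
      rw [← Complex.ofReal_pow]
      simp [mul_assoc, -Complex.ofReal_pow]
    have e2 : ∀ x, Complex.imCLM (-Complex.I * κ ^ 3 * airyMode κ x) = -κ ^ 3 * (airyMode κ x).re := by
      intro x
      rw [← Complex.ofReal_pow]
      simp [mul_assoc, -Complex.ofReal_pow]
    simp only [e1, e2, mul_left_comm _ (κ ^ 3), mul_left_comm _ (-κ ^ 3), integral_const_mul] at h3
    convert! h3 using 1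
    · exact funext fun s => integral_conj_mul_eq _ hc (u s)
    · simp only [hm]
      rw [integral_conj_mul_eq _ hc (u s)]
      push_cast
      linear_combination -(κ : ℂ) ^ 3 * ((∫ x, u s x * (airyMode κ x).im ∂volI : ℝ) : ℂ) * Complex.I_sq
  have hconst : ∀ s, HasDerivAt (fun s : ℝ => Complex.exp (-(Complex.I * κ ^ 3) * s) * m s) 0 s := by
    intro s
    have hid : HasDerivAt (fun y : ℝ => (y : ℂ)) 1 s := (hasDerivAt_id (s : ℂ)).comp_ofReal
    convert! ((hid.const_mul (-(Complex.I * (κ : ℂ) ^ 3))).cexp).mul (hderiv s) using 1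
    ring
  have heq := is_const_of_deriv_eq_zero (fun s => (hconst s).differentiableAt)
    (fun s => (hconst s).deriv) t 0
  simp only [Complex.ofReal_zero, mul_zero, Complex.exp_zero, one_mul] at heq
  change m t = _ * m 0
  rw [← heq, ← mul_assoc, ← Complex.exp_add]
  simp

theorem IsAirySolution.eq_airySolution {u₀ : ℝ → ℝ} (h₀ : MemLp u₀ 2 volI) {u : ℝ → L2I}
    (hu : IsAirySolution u₀ u) : u = airySolution (h₀.toLp u₀) := by
  have hinit : u 0 = h₀.toLp u₀ :=
    Lp.ext (Filter.EventuallyEq.trans hu.initial h₀.coeFn_toLp.symm)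
  funext t
  refine eq_of_forall_inner_unitMode fun κ => ?_
  rw [inner_unitMode_airySolution, flowCoeff, unitMode, inner_smul_left, inner_smul_left,
    hu.inner_airyMode κ.2.1 κ.2.2, hinit]
  ring

theorem existsUnique_isAirySolution {u₀ : ℝ → ℝ} (h₀ : MemLp u₀ 2 volI) :
    ∃! u : ℝ → L2I, IsAirySolution u₀ u :=
  ⟨_, airySolution_isAirySolution h₀, fun _ hu => hu.eq_airySolution h₀⟩

/-! ### Boundary layers -/

theorem integral_exp_neg_mul_le {a : ℝ} (ha : 0 < a) :
    ∫ x in (0 : ℝ)..1, Real.exp (-(a * x)) ≤ 1 / a := by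
  rw [intervalIntegral.integral_eq_sub_of_hasDerivAt (f := fun x => -Real.exp (-(a * x)) / a)]
  · have := Real.exp_pos (-(a * 1))
    simp only [mul_zero, neg_zero, Real.exp_zero]
    rw [← sub_div]
    gcongr
    linarith
  · intro x _
    convert! (((((hasDerivAt_id x).const_mul a).neg).exp).neg).div_const a using 1
    simp
    field_simp
  · exact Continuous.intervalIntegrable (by fun_prop) _ _

theorem integral_mul_exp_neg_mul_le {a : ℝ} (ha : 0 < a) :
    ∫ x in (0 : ℝ)..1, x * Real.exp (-(a * x)) ≤ 1 / a ^ 2 := by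
  rw [intervalIntegral.integral_eq_sub_of_hasDerivAt
    (f := fun x => -((x / a + 1 / a ^ 2) * Real.exp (-(a * x))))]
  · have : 0 < (1 / a + 1 / a ^ 2) * Real.exp (-(a * 1)) := by positivity
    simp only [mul_zero, neg_zero, Real.exp_zero, zero_div, zero_add, mul_one]
    rw [mul_one] at this
    linarith
  · intro x _
    have h := ((((hasDerivAt_id x).div_const a).add_const (1 / a ^ 2)).mul
      ((((hasDerivAt_id x).const_mul a).neg).exp)).neg
    convert! h using 1
    simp
    field_simp
    ring
  · exact Continuous.intervalIntegrable (by fun_prop) _ _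

theorem integral_comp_one_sub (f : ℝ → ℝ) :
    ∫ x in (0 : ℝ)..1, f (1 - x) = ∫ x in (0 : ℝ)..1, f x := by
  rw [intervalIntegral.integral_comp_sub_left]; simp

/-- The size `e^{-√3κ/2}` of the boundary layers at the opposite endpoints. -/
def layerDecay (κ : ℝ) : ℝ := Real.exp (-(Real.sqrt 3 / 2 * κ))

theorem layerDecay_pos (κ : ℝ) : 0 < layerDecay κ := Real.exp_pos _

theorem sqrt_three_bounds : 1.73 < Real.sqrt 3 ∧ Real.sqrt 3 < 1.74 :=
  ⟨Real.lt_sqrt_of_sq_lt (by norm_num), (Real.sqrt_lt' (by norm_num)).2 (by norm_num)⟩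

theorem layerDecay_le_half {κ : ℝ} (hκ : 1 ≤ κ) : layerDecay κ ≤ 1 / 2 := by
  have h3 := sqrt_three_bounds.1
  have h1 : layerDecay κ ≤ Real.exp (-(1 / 2) * 1 - 1 / 4) := by
    rw [layerDecay]
    gcongr
    nlinarith
  have h2 : (2 : ℝ) ≤ Real.exp (3 / 4) := by
    have := Real.quadratic_le_exp_of_nonneg (x := 3 / 4) (by norm_num)
    linarith
  have h4 : Real.exp (-(1 / 2) * 1 - 1 / 4) = (Real.exp (3 / 4))⁻¹ := by
    rw [← Real.exp_neg]; norm_num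
  rw [h4] at h1
  refine h1.trans ?_
  rw [one_div]
  gcongr

theorem norm_exp_I_mul_ofReal (κ x : ℝ) : ‖Complex.exp (Complex.I * κ * x)‖ = 1 := by
  have : Complex.I * κ * x = ((κ * x : ℝ) : ℂ) * Complex.I := by push_cast; ring
  rw [this, Complex.norm_exp_ofReal_mul_I]

theorem norm_exp_I_mul_ofReal' (κ : ℝ) : ‖Complex.exp (Complex.I * κ)‖ = 1 := by
  simp

theorem norm_decay_mul (κ : ℝ) : ‖decayA κ * decayB κ‖ = layerDecay κ ^ 2 := by
  rw [norm_mul, norm_decayA, norm_decayB, layerDecay, sq]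

theorem norm_one_sub_decay_ge {κ : ℝ} (hκ : 1 ≤ κ) : 3 / 4 ≤ ‖1 - decayA κ * decayB κ‖ := by
  have h1 := norm_sub_norm_le (1 : ℂ) (decayA κ * decayB κ)
  rw [norm_decay_mul, norm_one] at h1
  have := layerDecay_le_half hκ
  have := layerDecay_pos κ
  nlinarith

/-- Up to the influence of the opposite end, the layer at `0` cancels the value `1` of `e^{iκx}`;
likewise the layer at `1` cancels `e^{iκ}`. -/
theorem norm_layerB_add_one_le {κ : ℝ} (hκ : 1 ≤ κ) : ‖layerB κ + 1‖ ≤ 2 * layerDecay κ := by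
  have hD := norm_one_sub_decay_ge hκ
  have he : (layerB κ + 1) * (1 - decayA κ * decayB κ)
      = decayB κ * Complex.exp (Complex.I * κ) - decayA κ * decayB κ := by
    rw [add_mul, layerB_mul (by linarith)]; ring
  have hn : ‖layerB κ + 1‖ * ‖1 - decayA κ * decayB κ‖ ≤ layerDecay κ + layerDecay κ ^ 2 := by
    rw [← norm_mul, he]
    refine (norm_sub_le _ _).trans ?_
    rw [norm_decay_mul, norm_mul, norm_exp_I_mul_ofReal', norm_decayB, mul_one, layerDecay]
  have := layerDecay_le_half hκ
  have := layerDecay_pos κ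
  nlinarith [norm_nonneg (layerB κ + 1)]

theorem norm_layerC_add_exp_le {κ : ℝ} (hκ : 1 ≤ κ) :
    ‖layerC κ + Complex.exp (Complex.I * κ)‖ ≤ 2 * layerDecay κ := by
  have hD := norm_one_sub_decay_ge hκ
  have he : (layerC κ + Complex.exp (Complex.I * κ)) * (1 - decayA κ * decayB κ)
      = decayA κ - Complex.exp (Complex.I * κ) * (decayA κ * decayB κ) := by
    rw [add_mul, layerC_mul (by linarith)]; ring
  have hn : ‖layerC κ + Complex.exp (Complex.I * κ)‖ * ‖1 - decayA κ * decayB κ‖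
      ≤ layerDecay κ + layerDecay κ ^ 2 := by
    rw [← norm_mul, he]
    refine (norm_sub_le _ _).trans ?_
    rw [norm_mul, norm_decay_mul, norm_exp_I_mul_ofReal', norm_decayA, one_mul, layerDecay]
  have := layerDecay_le_half hκ
  have := layerDecay_pos κ
  nlinarith [norm_nonneg (layerC κ + Complex.exp (Complex.I * κ))]

theorem norm_layerB_le {κ : ℝ} (hκ : 1 ≤ κ) : ‖layerB κ‖ ≤ 2 := by
  have h1 := norm_layerB_add_one_le hκ
  have h2 := norm_sub_le (layerB κ + 1) 1
  rw [add_sub_cancel_right, norm_one] at h2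
  linarith [layerDecay_le_half hκ]

theorem norm_layerC_le {κ : ℝ} (hκ : 1 ≤ κ) : ‖layerC κ‖ ≤ 2 := by
  have h1 := norm_layerC_add_exp_le hκ
  have h2 := norm_sub_le (layerC κ + Complex.exp (Complex.I * κ)) (Complex.exp (Complex.I * κ))
  rw [add_sub_cancel_right, norm_exp_I_mul_ofReal'] at h2
  linarith [layerDecay_le_half hκ]

/-! ### The characteristic function -/

theorem conj_exp_I_mul (κ : ℝ) :
    conj (Complex.exp (Complex.I * κ)) = Complex.exp (-(Complex.I * κ)) := by
  rw [← Complex.exp_conj]; simp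

theorem conj_decayA (κ : ℝ) : conj (decayA κ) = decayB κ := by
  rw [decayA, decayB, ← Complex.exp_conj]; simp [conj_rootA]

theorem conj_decayB (κ : ℝ) : conj (decayB κ) = decayA κ := by
  rw [← conj_decayA, Complex.conj_conj]

/-- The boundary value problem is invariant under `x ↦ 1 - x` combined with conjugation, which maps
`e^{iκx}` to `e^{-iκ} e^{iκx}` and exchanges the layers. For `chi` this symmetry says that
`e^{-iκ/2} chi κ` is real, so its roots can be found by sign changes. -/
theorem conj_layerB (κ : ℝ) : conj (layerB κ) = Complex.exp (-(Complex.I * κ)) * layerC κ := by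
  rw [layerB, layerC, map_div₀, ← mul_div_assoc]
  simp only [map_add, map_sub, map_neg, map_one, map_mul, conj_decayA, conj_decayB, conj_exp_I_mul]
  rw [mul_comm (decayB κ) (decayA κ)]
  congr 1
  have : Complex.exp (-(Complex.I * κ)) * Complex.exp (Complex.I * κ) = 1 := by
    rw [← Complex.exp_add]; simp
  linear_combination this

theorem conj_layerC (κ : ℝ) : conj (layerC κ) = Complex.exp (-(Complex.I * κ)) * layerB κ := by
  have h := congrArg conj (conj_layerB κ)
  rw [Complex.conj_conj, map_mul, ← conj_exp_I_mul, Complex.conj_conj] at h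
  rw [h, ← mul_assoc, ← Complex.exp_add]
  simp

theorem conj_chi (κ : ℝ) : conj (chi κ) = Complex.exp (-(Complex.I * κ)) * chi κ := by
  have : Complex.exp (-(Complex.I * κ)) * Complex.exp (Complex.I * κ) = 1 := by
    rw [← Complex.exp_add]; simp
  rw [chi]
  simp only [map_add, map_sub, map_one, map_mul, conj_decayA, conj_decayB, conj_exp_I_mul,
    conj_layerB, conj_layerC, conj_rootA, conj_rootB, Complex.conj_I]
  linear_combination -Complex.I * this

/-- The characteristic function, turned to a real function. -/
def chiReal (κ : ℝ) : ℝ := (Complex.exp (-(Complex.I * (κ / 2 : ℝ))) * chi κ).re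

theorem ofReal_chiReal (κ : ℝ) :
    (chiReal κ : ℂ) = Complex.exp (-(Complex.I * (κ / 2 : ℝ))) * chi κ := by
  refine Complex.conj_eq_iff_re.1 ?_
  rw [map_mul, conj_chi, ← conj_exp_I_mul, Complex.conj_conj, ← mul_assoc, conj_exp_I_mul,
    ← Complex.exp_add]
  congr 2
  push_cast
  ring

theorem chi_eq_zero_iff (κ : ℝ) : chi κ = 0 ↔ chiReal κ = 0 := by
  rw [← Complex.ofReal_eq_zero, ofReal_chiReal]
  simp [Complex.exp_ne_zero]

/-- With the limiting amplitudes `-1` and `-e^{iκ}` inserted, four errors remain, each at most twice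
`layerDecay κ`. -/
theorem norm_chi_sub_le {κ : ℝ} (hκ : 1 ≤ κ) :
    ‖chi κ - (Complex.I * (Complex.exp (Complex.I * κ) - 1) - rootA
      - rootB * Complex.exp (Complex.I * κ))‖ ≤ 8 * layerDecay κ := by
  have he : chi κ - (Complex.I * (Complex.exp (Complex.I * κ) - 1) - rootA
      - rootB * Complex.exp (Complex.I * κ)) = rootA * (layerB κ + 1) - rootA * layerB κ * decayA κ
        + (rootB * (layerC κ + Complex.exp (Complex.I * κ)) - rootB * layerC κ * decayB κ) := by
    rw [chi]; ring
  rw [he]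
  refine (norm_add_le _ _).trans ((add_le_add (norm_sub_le _ _) (norm_sub_le _ _)).trans ?_)
  simp only [norm_mul, norm_rootA, norm_rootB, one_mul, norm_decayA, norm_decayB]
  have h1 := norm_layerB_add_one_le hκ
  have h2 := norm_layerC_add_exp_le hκ
  have h3 := mul_le_mul_of_nonneg_right (norm_layerB_le hκ) (layerDecay_pos κ).le
  have h4 := mul_le_mul_of_nonneg_right (norm_layerC_le hκ) (layerDecay_pos κ).le
  rw [← layerDecay]
  linarith

/-- The sine vanishes at `κ = 2nπ - π/3`: this is where the `1/3` in `waveNumber` comes from. -/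
theorem chi_main_term (κ : ℝ) :
    Complex.exp (-(Complex.I * (κ / 2 : ℝ))) * (Complex.I * (Complex.exp (Complex.I * κ) - 1) - rootA
      - rootB * Complex.exp (Complex.I * κ))
      = ((-(2 * Real.sqrt 3 * Real.sin (κ / 2 + Real.pi / 6)) : ℝ) : ℂ) := by
  have h1 : Complex.exp (-(Complex.I * (κ / 2 : ℝ))) * Complex.exp (Complex.I * κ)
      = Complex.exp (((κ / 2 : ℝ) : ℂ) * Complex.I) := by
    rw [← Complex.exp_add]; congr 1; push_cast; ring
  have h2 : Complex.exp (-(Complex.I * (κ / 2 : ℝ)))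
      = Complex.exp (((-(κ / 2) : ℝ) : ℂ) * Complex.I) := by
    congr 1; push_cast; ring
  have h3 : Complex.exp (-(Complex.I * (κ / 2 : ℝ))) * (Complex.I * (Complex.exp (Complex.I * κ) - 1)
      - rootA - rootB * Complex.exp (Complex.I * κ))
      = (Complex.I - rootB) * Complex.exp (((κ / 2 : ℝ) : ℂ) * Complex.I)
        - (Complex.I + rootA) * Complex.exp (((-(κ / 2) : ℝ) : ℂ) * Complex.I) := by
    rw [← h1, ← h2]; ring
  have hs : Real.sqrt 3 * Real.sqrt 3 = 3 := Real.mul_self_sqrt (by norm_num)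
  have hE : ∀ x : ℝ, Complex.exp ((x : ℂ) * Complex.I)
      = ((Real.cos x : ℝ) : ℂ) + ((Real.sin x : ℝ) : ℂ) * Complex.I := fun x => by
    rw [Complex.exp_mul_I, Complex.ofReal_cos, Complex.ofReal_sin]
  rw [h3, hE, hE, Real.sin_add, Real.sin_pi_div_six, Real.cos_pi_div_six, Real.sin_neg,
    Real.cos_neg, rootA, rootB]
  generalize Real.sin (κ / 2) = S
  generalize Real.cos (κ / 2) = C
  apply Complex.ext
  · simp
    linear_combination S * hs
  · simp

theorem abs_chiReal_add_le {κ : ℝ} (hκ : 1 ≤ κ) :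
    |chiReal κ + 2 * Real.sqrt 3 * Real.sin (κ / 2 + Real.pi / 6)| ≤ 8 * layerDecay κ := by
  rw [← Real.norm_eq_abs, ← Complex.norm_real, ← sub_neg_eq_add, Complex.ofReal_sub, ofReal_chiReal,
    ← chi_main_term, ← mul_sub, norm_mul, ← conj_exp_I_mul, Complex.norm_conj,
    norm_exp_I_mul_ofReal', one_mul]
  exact norm_chi_sub_le hκ

theorem sin_half_add (n : ℕ) (κ : ℝ) :
    Real.sin (κ / 2 + Real.pi / 6) = (-1) ^ n * Real.sin ((κ - waveNumber n) / 2) := by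
  have : κ / 2 + Real.pi / 6 = (κ - waveNumber n) / 2 + n * Real.pi := by
    rw [waveNumber]; ring
  rw [this, Real.sin_add_nat_mul_pi]

theorem continuousOn_chiReal : ContinuousOn chiReal (Ioi 0) := by
  have hA : Continuous decayA := by unfold decayA; fun_prop
  have hB : Continuous decayB := by unfold decayB; fun_prop
  have hlB : ContinuousOn layerB (Ioi 0) := by
    unfold layerB
    exact ContinuousOn.div (by fun_prop) (by fun_prop) fun x hx => one_sub_decay_ne_zero hx
  have hlC : ContinuousOn layerC (Ioi 0) := by
    unfold layerC
    exact ContinuousOn.div (by fun_prop) (by fun_prop) fun x hx => one_sub_decay_ne_zero hx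
  unfold chiReal chi
  exact Complex.continuous_re.comp_continuousOn (by fun_prop)

theorem two_le_waveNumber_sub {n : ℕ} (hn : 1 ≤ n) : 2 ≤ waveNumber n - Real.pi := by
  have h1 : (1 : ℝ) ≤ n := by exact_mod_cast hn
  have := Real.pi_gt_three
  rw [waveNumber]
  nlinarith

theorem eight_layerDecay_lt {κ : ℝ} (hκ : 2 ≤ κ) : 8 * layerDecay κ < 2 * Real.sqrt 3 := by
  have h3 := sqrt_three_bounds.1
  have h1 : layerDecay κ ≤ Real.exp (-1) := by
    rw [layerDecay]
    gcongr
    nlinarith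
  have h2 := Real.exp_neg_one_lt_d9
  linarith

/-- At distance `π` on either side of `waveNumber n` the sine is `±1`, and its amplitude `2√3`
exceeds the error `8/e`. The intermediate value theorem then gives a root. -/
theorem exists_chi_eq_zero {n : ℕ} (hn : 1 ≤ n) :
    ∃ κ : ℝ, |κ - waveNumber n| ≤ Real.pi ∧ chi κ = 0 := by
  have h2 := two_le_waveNumber_sub hn
  have hpi := Real.pi_pos
  have hc : ContinuousOn (fun κ => (-1 : ℝ) ^ n * chiReal κ)
      (Icc (waveNumber n - Real.pi) (waveNumber n + Real.pi)) :=
    (continuousOn_const.mul continuousOn_chiReal).mono fun x hx => by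
      have := hx.1
      exact lt_of_lt_of_le (by linarith : (0 : ℝ) < waveNumber n - Real.pi) this
  have hiv := intermediate_value_Icc' (by linarith) hc
  have hsgn : ((-1 : ℝ) ^ n) * (-1) ^ n = 1 := by rw [← mul_pow]; simp
  have key : ∀ κ : ℝ, 2 ≤ κ → |(-1 : ℝ) ^ n * chiReal κ
      + 2 * Real.sqrt 3 * Real.sin ((κ - waveNumber n) / 2)| < 2 * Real.sqrt 3 := by
    intro κ hκ
    have h := (abs_chiReal_add_le (by linarith : 1 ≤ κ)).trans_lt (eight_layerDecay_lt hκ)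
    rw [sin_half_add n] at h
    have e : (-1 : ℝ) ^ n * chiReal κ + 2 * Real.sqrt 3 * Real.sin ((κ - waveNumber n) / 2)
        = (-1) ^ n * (chiReal κ
          + 2 * Real.sqrt 3 * ((-1) ^ n * Real.sin ((κ - waveNumber n) / 2))) := by
      linear_combination -2 * Real.sqrt 3 * Real.sin ((κ - waveNumber n) / 2) * hsgn
    rw [e, abs_mul, abs_pow, abs_neg, abs_one, one_pow, one_mul]
    exact h
  have hl := key (waveNumber n - Real.pi) h2
  have hr := key (waveNumber n + Real.pi) (by linarith)
  have e1 : (waveNumber n - Real.pi - waveNumber n) / 2 = -(Real.pi / 2) := by ring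
  have e2 : (waveNumber n + Real.pi - waveNumber n) / 2 = Real.pi / 2 := by ring
  rw [e1, Real.sin_neg, Real.sin_pi_div_two, abs_lt] at hl
  rw [e2, Real.sin_pi_div_two, abs_lt] at hr
  obtain ⟨κ, hκ, h0⟩ := hiv (⟨by linarith, by linarith⟩ : (0 : ℝ) ∈ Icc _ _)
  refine ⟨κ, by rw [abs_le]; constructor <;> linarith [hκ.1, hκ.2], ?_⟩
  rw [chi_eq_zero_iff]
  exact (mul_eq_zero.1 h0).resolve_left (pow_ne_zero _ (by norm_num))

/-- At a root the sine is bounded by the error in `chiReal`, and Jordan's inequality `|sin y| ≥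
2|y|/π` converts this into a bound for the distance. -/
theorem abs_sub_waveNumber_le {κ : ℝ} {n : ℕ} (hκ : 1 ≤ κ) (hχ : chi κ = 0)
    (hn : |κ - waveNumber n| ≤ Real.pi) : |κ - waveNumber n| ≤ 16 * layerDecay κ := by
  have h := abs_chiReal_add_le hκ
  rw [(chi_eq_zero_iff κ).1 hχ, zero_add, sin_half_add n, abs_mul, abs_mul, abs_mul, abs_pow, abs_neg,
    abs_one, one_pow, one_mul, abs_two, abs_of_nonneg (Real.sqrt_nonneg 3)] at h
  have h1 := Real.mul_abs_le_abs_sin (x := (κ - waveNumber n) / 2)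
    (by rw [abs_div, abs_two]; linarith)
  rw [abs_div, abs_two] at h1
  have h3 := sqrt_three_bounds.1
  have h4 : |κ - waveNumber n| / 4 ≤ 2 / Real.pi * (|κ - waveNumber n| / 2) := by
    have : 1 / 4 ≤ 1 / Real.pi := by
      gcongr
      linarith [Real.pi_le_four]
    have e : 2 / Real.pi * (|κ - waveNumber n| / 2) = 1 / Real.pi * |κ - waveNumber n| := by ring
    rw [e]
    nlinarith [abs_nonneg (κ - waveNumber n)]
  nlinarith [abs_nonneg (Real.sin ((κ - waveNumber n) / 2))]

theorem exists_waveNumber_near {κ : ℝ} {N : ℕ} (hκ : waveNumber N - Real.pi ≤ κ) :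
    ∃ n, N ≤ n ∧ |κ - waveNumber n| ≤ Real.pi := by
  have hpi := Real.pi_pos
  set m := ⌊(κ - (waveNumber N - Real.pi)) / (2 * Real.pi)⌋₊ with hm
  have h1 : (m : ℝ) ≤ (κ - (waveNumber N - Real.pi)) / (2 * Real.pi) :=
    Nat.floor_le (div_nonneg (by linarith) (by positivity))
  have h2 : (κ - (waveNumber N - Real.pi)) / (2 * Real.pi) < m + 1 := Nat.lt_floor_add_one _
  rw [le_div_iff₀ (by positivity)] at h1
  rw [div_lt_iff₀ (by positivity)] at h2
  refine ⟨N + m, by omega, ?_⟩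
  have e : waveNumber (N + m) = waveNumber N + m * (2 * Real.pi) := by
    simp only [waveNumber]; push_cast; ring
  rw [e, abs_le]
  constructor <;> linarith

/-! ### Inner products of modes -/

/-- The boundary layer part of a mode. -/
def layerPart (κ x : ℝ) : ℂ :=
  layerB κ * Complex.exp (-rootA * κ * x) + layerC κ * Complex.exp (-rootB * κ * (1 - x))

theorem airyMode_eq (κ x : ℝ) :
    airyMode κ x = Complex.exp (Complex.I * κ * x) + layerPart κ x := by
  rw [airyMode, expComb, layerPart]; ring

theorem continuous_layerPart (κ : ℝ) : Continuous (layerPart κ) := by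
  unfold layerPart; fun_prop

theorem norm_exp_rootA (κ x : ℝ) :
    ‖Complex.exp (-rootA * κ * x)‖ = Real.exp (-(Real.sqrt 3 / 2 * κ * x)) := by
  rw [Complex.norm_exp]; simp [rootA]

theorem norm_exp_rootB (κ x : ℝ) :
    ‖Complex.exp (-rootB * κ * (1 - x))‖ = Real.exp (-(Real.sqrt 3 / 2 * κ * (1 - x))) := by
  rw [Complex.norm_exp]; simp [rootB]

theorem norm_layerPart_le {κ : ℝ} (hκ : 1 ≤ κ) (x : ℝ) :
    ‖layerPart κ x‖ ≤ 2 * Real.exp (-(Real.sqrt 3 / 2 * κ * x))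
      + 2 * Real.exp (-(Real.sqrt 3 / 2 * κ * (1 - x))) := by
  refine (norm_add_le _ _).trans ?_
  rw [norm_mul, norm_mul, norm_exp_rootA, norm_exp_rootB]
  have h1 := norm_layerB_le hκ
  have h2 := norm_layerC_le hκ
  gcongr

theorem norm_layerPart_le_four {κ x : ℝ} (hκ : 1 ≤ κ) (hx : x ∈ Icc (0 : ℝ) 1) :
    ‖layerPart κ x‖ ≤ 4 := by
  refine (norm_layerPart_le hκ x).trans ?_
  have h1 : Real.exp (-(Real.sqrt 3 / 2 * κ * x)) ≤ 1 := by
    rw [Real.exp_le_one_iff, neg_nonpos]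
    have := hx.1
    positivity
  have h2 : Real.exp (-(Real.sqrt 3 / 2 * κ * (1 - x))) ≤ 1 := by
    rw [Real.exp_le_one_iff, neg_nonpos]
    have : 0 ≤ 1 - x := by linarith [hx.2]
    positivity
  linarith

theorem integral_norm_layerPart_le {κ : ℝ} (hκ : 1 ≤ κ) :
    ∫ x in (0 : ℝ)..1, ‖layerPart κ x‖ ≤ 5 / κ := by
  have h3 := sqrt_three_bounds.1
  have ha : 0 < Real.sqrt 3 / 2 * κ := by positivity
  have h1 := integral_exp_neg_mul_le ha
  have h2 := integral_comp_one_sub fun x => Real.exp (-(Real.sqrt 3 / 2 * κ * x))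
  have hi1 : IntervalIntegrable (fun x => 2 * Real.exp (-(Real.sqrt 3 / 2 * κ * x))) volume 0 1 :=
    Continuous.intervalIntegrable (by fun_prop) _ _
  have hi2 : IntervalIntegrable (fun x => 2 * Real.exp (-(Real.sqrt 3 / 2 * κ * (1 - x)))) volume 0 1 :=
    Continuous.intervalIntegrable (by fun_prop) _ _
  calc _ ≤ ∫ x in (0 : ℝ)..1, (2 * Real.exp (-(Real.sqrt 3 / 2 * κ * x))
        + 2 * Real.exp (-(Real.sqrt 3 / 2 * κ * (1 - x)))) :=
        intervalIntegral.integral_mono_on zero_le_one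
          ((continuous_layerPart κ).norm.intervalIntegrable _ _) (hi1.add hi2)
          fun x _ => norm_layerPart_le hκ x
    _ ≤ 4 * (1 / (Real.sqrt 3 / 2 * κ)) := by
        rw [intervalIntegral.integral_add hi1 hi2, intervalIntegral.integral_const_mul,
          intervalIntegral.integral_const_mul, h2]
        linarith
    _ ≤ 5 / κ := by
        have e : 4 * (1 / (Real.sqrt 3 / 2 * κ)) = (8 / Real.sqrt 3) / κ := by field_simp; ring
        rw [e]
        gcongr
        rw [div_le_iff₀ (by positivity)]
        linarith

/-- Apart from the layers the modes are plane waves. A layer has `L¹` norm at most `5/κ` and is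
multiplied by a plane wave or by a mode, of modulus at most `1` and `5`. -/
theorem norm_inner_airyMode_sub_le {κ κ' : ℝ} (hκ : 1 ≤ κ) (hκ' : 1 ≤ κ') :
    ‖inner ℂ (toL2 (airyMode κ)) (toL2 (airyMode κ'))
      - ∫ x in (0 : ℝ)..1, Complex.exp (Complex.I * ((κ' - κ : ℝ) : ℂ) * x)‖ ≤ 5 / κ + 25 / κ' := by
  have hc : ∀ κ, Continuous (airyMode κ) := fun κ => continuous_expComb κ _ _ _
  have h1 : inner ℂ (toL2 (airyMode κ)) (toL2 (airyMode κ'))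
      = ∫ x in (0 : ℝ)..1, conj (airyMode κ x) * airyMode κ' x := by
    rw [inner_toL2_left (memLp_of_continuous (hc κ) 2), ← integral_volI]
    exact integral_congr_ae ((coeFn_toL2_of_continuous (hc κ')).mono fun x hx => by simp only [hx])
  have hcl := continuous_layerPart
  have hcc : Continuous fun x => conj (airyMode κ x) := Complex.continuous_conj.comp (hc κ)
  have hi0 : IntervalIntegrable (fun x => conj (airyMode κ x) * airyMode κ' x) volume 0 1 :=
    (hcc.mul (hc κ')).intervalIntegrable _ _
  rw [h1, ← intervalIntegral.integral_sub hi0 (Continuous.intervalIntegrable (by fun_prop) _ _)]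
  have hi1 := (hcl κ).norm.intervalIntegrable (μ := volume) 0 1
  have hi2 := ((hcl κ').norm.const_mul 5).intervalIntegrable (μ := volume) 0 1
  have hp : ∀ x ∈ Icc (0 : ℝ) 1, ‖conj (airyMode κ x) * airyMode κ' x
      - Complex.exp (Complex.I * ((κ' - κ : ℝ) : ℂ) * x)‖
      ≤ ‖layerPart κ x‖ + 5 * ‖layerPart κ' x‖ := by
    intro x hx
    have e : Complex.exp (Complex.I * ((κ' - κ : ℝ) : ℂ) * x)
        = conj (Complex.exp (Complex.I * κ * x)) * Complex.exp (Complex.I * κ' * x) := by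
      rw [← Complex.exp_conj, ← Complex.exp_add]
      congr 1
      simp
      ring
    have e2 : conj (airyMode κ x) * airyMode κ' x - Complex.exp (Complex.I * ((κ' - κ : ℝ) : ℂ) * x)
        = conj (layerPart κ x) * Complex.exp (Complex.I * κ' * x)
          + conj (airyMode κ x) * layerPart κ' x := by
      rw [e, airyMode_eq κ', airyMode_eq κ, map_add]
      ring
    have h5 : ‖airyMode κ x‖ ≤ 5 := by
      rw [airyMode_eq]
      refine (norm_add_le _ _).trans ?_
      rw [norm_exp_I_mul_ofReal]
      linarith [norm_layerPart_le_four hκ hx]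
    rw [e2]
    refine (norm_add_le _ _).trans ?_
    rw [norm_mul, norm_mul, Complex.norm_conj, Complex.norm_conj, norm_exp_I_mul_ofReal, mul_one]
    gcongr
  refine (intervalIntegral.norm_integral_le_of_norm_le zero_le_one
    (.of_forall fun x hx => hp x (Ioc_subset_Icc_self hx)) (hi1.add hi2)).trans ?_
  rw [intervalIntegral.integral_add hi1 hi2, intervalIntegral.integral_const_mul]
  have a1 := integral_norm_layerPart_le hκ
  have a2 := integral_norm_layerPart_le hκ'
  have e : 25 / κ' = 5 * (5 / κ') := by ring
  rw [e]
  linarith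

theorem norm_exp_I_mul_sub_one_le (a : ℝ) : ‖Complex.exp (Complex.I * a) - 1‖ ≤ |a| := by
  simpa using Real.norm_exp_I_mul_ofReal_sub_one_le (x := a)

theorem norm_integral_exp_sub_one_le (a : ℝ) :
    ‖(∫ x in (0 : ℝ)..1, Complex.exp (Complex.I * a * x)) - 1‖ ≤ |a| := by
  have h : (∫ x in (0 : ℝ)..1, Complex.exp (Complex.I * a * x)) - 1
      = ∫ x in (0 : ℝ)..1, (Complex.exp (Complex.I * a * x) - 1) := by
    rw [intervalIntegral.integral_sub (Continuous.intervalIntegrable (by fun_prop) _ _)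
      (Continuous.intervalIntegrable (by fun_prop) _ _)]
    simp
  rw [h]
  have := intervalIntegral.norm_integral_le_of_norm_le_const (a := (0 : ℝ)) (b := 1) (C := |a|)
    (f := fun x : ℝ => Complex.exp (Complex.I * a * x) - 1) fun x hx => by
      rw [uIoc_of_le zero_le_one] at hx
      have h1 := norm_exp_I_mul_sub_one_le (a * x)
      rw [abs_mul, abs_of_pos hx.1] at h1
      push_cast at h1
      rw [← mul_assoc] at h1
      exact h1.trans (mul_le_of_le_one_right (abs_nonneg _) hx.2)
  simpa using this

/-- Near each large approximate wave number there is only one wave number. -/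
theorem chi_root_unique {κ κ' : ℝ} {n : ℕ} (hκ : 200 ≤ κ) (hκ' : 200 ≤ κ') (hχ : chi κ = 0)
    (hχ' : chi κ' = 0) (hn : |κ - waveNumber n| ≤ Real.pi) (hn' : |κ' - waveNumber n| ≤ Real.pi) :
    κ = κ' := by
  by_contra hne
  have hsmall : ∀ κ : ℝ, 200 ≤ κ → layerDecay κ ≤ 1 / 100 := by
    intro κ hκ
    rw [layerDecay, Real.exp_neg, one_div]
    have h3 := sqrt_three_bounds.1
    have := Real.add_one_le_exp (Real.sqrt 3 / 2 * κ)
    gcongr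
    nlinarith
  -- No derivative of `chi` is needed: distinct roots have orthogonal modes, while modes of nearly
  -- equal large wave numbers have inner product near `1`. Beyond `200` the deviation from `1` is at
  -- most `5/200 + 25/200 + 32/100`.
  have h0 : inner ℂ (toL2 (airyMode κ)) (toL2 (airyMode κ')) = 0 := by
    refine inner_eq_zero_of_greenOp (a := 1 / κ ^ 3) (b := 1 / κ' ^ 3) ?_ ?_ fun h =>
      hne (one_div_cube_injOn (by linarith) (by linarith) h)
    · rw [greenOp_airyMode (by linarith) hχ]; push_cast; congr 1; ring
    · rw [greenOp_airyMode (by linarith) hχ']; push_cast; congr 1; ring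
  have h1 := norm_inner_airyMode_sub_le (by linarith : 1 ≤ κ) (by linarith : 1 ≤ κ')
  rw [h0, zero_sub, norm_neg] at h1
  have h2 := norm_integral_exp_sub_one_le (κ' - κ)
  have h3 : (1 : ℝ) ≤ 5 / κ + 25 / κ' + |κ' - κ| := by
    have := norm_sub_le (∫ x in (0 : ℝ)..1, Complex.exp (Complex.I * ((κ' - κ : ℝ) : ℂ) * x))
      ((∫ x in (0 : ℝ)..1, Complex.exp (Complex.I * ((κ' - κ : ℝ) : ℂ) * x)) - 1)
    rw [sub_sub_cancel, norm_one] at this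
    linarith
  have h4 := abs_sub_waveNumber_le (by linarith) hχ hn
  have h5 := abs_sub_waveNumber_le (by linarith) hχ' hn'
  have h6 := abs_sub_le κ' (waveNumber n) κ
  rw [abs_sub_comm (waveNumber n)] at h6
  have h7 := hsmall κ hκ
  have h8 := hsmall κ' hκ'
  have h9 : 5 / κ ≤ 5 / 200 := by gcongr
  have h10 : 25 / κ' ≤ 25 / 200 := by gcongr
  linarith

/-- An enumeration of the large wave numbers. -/
theorem exists_wave_enumeration : ∃ (N : ℕ) (w : ℕ → ℝ), 1 ≤ N ∧
    (∀ n, N ≤ n → 200 ≤ w n ∧ chi (w n) = 0 ∧ |w n - waveNumber n| ≤ 16 * layerDecay (w n)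
      ∧ |w n - waveNumber n| ≤ 1) ∧
    (∀ κ, waveNumber N - 1 < κ → chi κ = 0 → ∃ n, N ≤ n ∧ κ = w n) ∧
    (∀ n m, N ≤ n → N ≤ m → w n = w m → n = m) := by
  have h := fun n : ℕ => exists_chi_eq_zero (n := n + 1) (by omega)
  choose f hf hf0 using h
  have hpi3 := Real.pi_gt_three
  have hpi4 := Real.pi_le_four
  -- `f m` is the root near `waveNumber (m + 1)`; the shift aligns the indices, and the value at `n
  -- = 0` is never used.
  set w : ℕ → ℝ := fun n => f (n - 1) with hw
  have hwn : ∀ n, 1 ≤ n → |w n - waveNumber n| ≤ Real.pi ∧ chi (w n) = 0 := by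
    intro n hn
    obtain ⟨m, rfl⟩ : ∃ m, n = m + 1 := ⟨n - 1, by omega⟩
    exact ⟨hf m, hf0 m⟩
  have hlarge : ∀ n : ℕ, 100 ≤ n → 204 ≤ waveNumber n - Real.pi := by
    intro n hn
    have : (100 : ℝ) ≤ n := by exact_mod_cast hn
    rw [waveNumber]
    nlinarith
  have hsmall : ∀ κ : ℝ, 200 ≤ κ → 16 * layerDecay κ ≤ 1 := by
    intro κ hκ
    have h3 := sqrt_three_bounds.1
    have := Real.add_one_le_exp (Real.sqrt 3 / 2 * κ)
    rw [layerDecay, Real.exp_neg, ← div_eq_mul_inv, div_le_one (Real.exp_pos _)]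
    nlinarith
  have hw200 : ∀ n, 100 ≤ n → 200 ≤ w n := fun n hn => by
    have h1 := (abs_le.1 (hwn n (by omega)).1).1
    have := hlarge n hn
    linarith
  have hloc : ∀ n, 100 ≤ n → |w n - waveNumber n| ≤ 16 * layerDecay (w n) := fun n hn =>
    abs_sub_waveNumber_le (by linarith [hw200 n hn]) (hwn n (by omega)).2 (hwn n (by omega)).1
  have hloc1 : ∀ n, 100 ≤ n → |w n - waveNumber n| ≤ 1 := fun n hn =>
    (hloc n hn).trans (hsmall _ (hw200 n hn))
  -- From index `100` on, the roots exceed `200` and `chi_root_unique` applies. Smaller roots are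
  -- not enumerated; only their boundedness will matter.
  refine ⟨100, w, by omega, fun n hn => ⟨hw200 n hn, (hwn n (by omega)).2, hloc n hn, hloc1 n hn⟩,
    fun κ hκ hχ => ?_, fun n m hn hm hnm => ?_⟩
  · obtain ⟨n, hn, hnear⟩ := exists_waveNumber_near (N := 100) (κ := κ) (by linarith)
    refine ⟨n, hn, chi_root_unique ?_ (hw200 n hn) hχ (hwn n (by omega)).2 hnear
      (hwn n (by omega)).1⟩
    have := hlarge 100 le_rfl
    linarith
  · have h1 := abs_le.1 (hloc1 n hn)
    have h2 := abs_le.1 (hloc1 m hm)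
    have h3 : |((n : ℝ) - m) * (2 * Real.pi)| ≤ 2 := by
      have e : ((n : ℝ) - m) * (2 * Real.pi) = waveNumber n - waveNumber m := by
        simp only [waveNumber]; ring
      rw [e, abs_le]
      constructor <;> linarith
    by_contra hne
    have h4 : (1 : ℝ) ≤ |(n : ℝ) - m| := by
      have : (1 : ℤ) ≤ |(n : ℤ) - m| := Int.one_le_abs (sub_ne_zero.2 (by exact_mod_cast hne))
      exact_mod_cast this
    rw [abs_mul, abs_of_pos (by positivity : 0 < 2 * Real.pi)] at h3
    nlinarith

/-! ### Piecewise Lipschitz functions -/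

/-- An oscillatory integral of a Lipschitz function decays like the inverse of the frequency. -/
theorem exists_norm_integral_lipschitz_mul_exp_le {K : NNReal} {g : ℝ → ℝ} (hg : LipschitzWith K g)
    {a b : ℝ} (ha : 0 ≤ a) (hab : a ≤ b) (hb : b ≤ 1) :
    ∃ C : ℝ, ∀ κ : ℝ, 1 ≤ κ →
      ‖∫ y in a..b, (g y : ℂ) * Complex.exp (-Complex.I * κ * y)‖ ≤ C / κ := by
  -- The shifted integrand below evaluates `g` at points up to `1 + h` with `h ≤ 4`, whence the
  -- interval `[0,5]`.
  set M : ℝ := |g 0| + K * 5 with hM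
  have hgM : ∀ y ∈ Icc (0 : ℝ) 5, |g y| ≤ M := by
    intro y hy
    have h1 := hg.dist_le_mul y 0
    rw [Real.dist_eq, Real.dist_eq, sub_zero, abs_of_nonneg hy.1] at h1
    have h2 : |g y| ≤ |g 0| + |g y - g 0| := by
      have := abs_add_le (g 0) (g y - g 0)
      rwa [add_sub_cancel] at this
    have h3 : (K : ℝ) * y ≤ K * 5 := mul_le_mul_of_nonneg_left hy.2 K.2
    linarith
  have hM0 : 0 ≤ M := by positivity
  refine ⟨Real.pi * (K + 2 * M), fun κ hκ => ?_⟩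
  have hpi := Real.pi_pos
  have hpi4 := Real.pi_le_four
  -- Half a period: translation by `h` changes the sign of the exponential. Averaging the integral
  -- with its translate leaves a difference of `g`, of size `K h`, and two end pieces of length `h`.
  set h : ℝ := Real.pi / κ with hh
  have h0 : 0 < h := by positivity
  have h4 : h ≤ 4 := by
    rw [hh, div_le_iff₀ (by linarith)]
    nlinarith
  have hgc : Continuous g := hg.continuous
  set F : ℝ → ℂ := fun y => (g y : ℂ) * Complex.exp (-Complex.I * κ * y) with hF
  set S : ℝ → ℂ := fun y => (g (y + h) : ℂ) * Complex.exp (-Complex.I * κ * y) with hS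
  have hFc : Continuous F := by fun_prop
  have hSc : Continuous S := by fun_prop
  have hne : (κ : ℂ) ≠ 0 := by exact_mod_cast (by linarith : κ ≠ 0)
  have hshift : ∀ y, F (y + h) = -S y := by
    intro y
    have : Complex.exp (-Complex.I * κ * ((y + h : ℝ) : ℂ)) = -Complex.exp (-Complex.I * κ * y) := by
      have e : -Complex.I * κ * ((y + h : ℝ) : ℂ) = -Complex.I * κ * y - Real.pi * Complex.I := by
        rw [hh]; push_cast; field_simp; ring
      rw [e, Complex.exp_sub, Complex.exp_pi_mul_I, div_neg, div_one]
    simp only [hF, hS]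
    rw [this]
    ring
  have hI1 : ∫ y in a..b, F y = -∫ y in (a - h)..(b - h), S y := by
    rw [← intervalIntegral.integral_neg]
    simp only [← hshift]
    rw [intervalIntegral.integral_comp_add_right]
    simp
  have hI2 : ∫ y in (a - h)..(b - h), S y
      = (∫ y in a..b, S y) + (∫ y in (a - h)..a, S y) - ∫ y in (b - h)..b, S y := by
    have e1 := intervalIntegral.integral_add_adjacent_intervals
      (hSc.intervalIntegrable (μ := volume) (a - h) a) (hSc.intervalIntegrable a b)
    have e2 := intervalIntegral.integral_add_adjacent_intervals
      (hSc.intervalIntegrable (μ := volume) (a - h) (b - h)) (hSc.intervalIntegrable (b - h) b)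
    linear_combination e2 - e1
  have hSbd : ∀ y ∈ Icc (-h) 1, ‖S y‖ ≤ M := by
    intro y hy
    have hn : ‖Complex.exp (-Complex.I * κ * y)‖ = 1 := by
      simpa using norm_exp_I_mul_ofReal (-κ) y
    simp only [hS]
    rw [norm_mul, hn, mul_one, Complex.norm_real]
    exact hgM _ ⟨by linarith [hy.1], by linarith [hy.2]⟩
  have hB1 : ‖∫ y in (a - h)..a, S y‖ ≤ M * h := by
    have := intervalIntegral.norm_integral_le_of_norm_le_const (a := a - h) (b := a) (C := M)
      (f := S) fun y hy => by
        rw [uIoc_of_le (by linarith)] at hy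
        exact hSbd y ⟨by linarith [hy.1], by linarith [hy.2]⟩
    rwa [sub_sub_cancel, abs_of_pos h0] at this
  have hB2 : ‖∫ y in (b - h)..b, S y‖ ≤ M * h := by
    have := intervalIntegral.norm_integral_le_of_norm_le_const (a := b - h) (b := b) (C := M)
      (f := S) fun y hy => by
        rw [uIoc_of_le (by linarith)] at hy
        exact hSbd y ⟨by linarith [hy.1], by linarith [hy.2]⟩
    rwa [sub_sub_cancel, abs_of_pos h0] at this
  have hB3 : ‖∫ y in a..b, (F y - S y)‖ ≤ K * h := by
    have := intervalIntegral.norm_integral_le_of_norm_le_const (a := a) (b := b) (C := K * h)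
      (f := fun y => F y - S y) fun y hy => by
        have hn : ‖Complex.exp (-Complex.I * κ * y)‖ = 1 := by
          simpa using norm_exp_I_mul_ofReal (-κ) y
        simp only [hF, hS]
        rw [← sub_mul, norm_mul, hn, mul_one, ← Complex.ofReal_sub, Complex.norm_real]
        have := hg.dist_le_mul y (y + h)
        rwa [Real.dist_eq, Real.dist_eq, sub_add_cancel_left, abs_neg, abs_of_pos h0] at this
    refine this.trans (mul_le_of_le_one_right (by positivity) ?_)
    rw [abs_le]; constructor <;> linarith
  have htwo : 2 * ∫ y in a..b, F y = (∫ y in a..b, (F y - S y)) - (∫ y in (a - h)..a, S y)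
      + ∫ y in (b - h)..b, S y := by
    rw [intervalIntegral.integral_sub (hFc.intervalIntegrable _ _) (hSc.intervalIntegrable _ _)]
    rw [hI2] at hI1
    linear_combination hI1
  have hn2 : 2 * ‖∫ y in a..b, F y‖ ≤ K * h + M * h + M * h := by
    have : ‖2 * ∫ y in a..b, F y‖ = 2 * ‖∫ y in a..b, F y‖ := by rw [norm_mul]; simp
    rw [← this, htwo]
    exact (norm_add_le _ _).trans (add_le_add ((norm_sub_le _ _).trans (add_le_add hB3 hB1)) hB2)
  have : Real.pi * (K + 2 * M) / κ = (K + 2 * M) * h := by rw [hh]; ring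
  rw [this]
  have hK : 0 ≤ (K : ℝ) * h := by positivity
  have hMh : 0 ≤ M * h := by positivity
  linarith

/-- The points of the unit interval lie in the open pieces of a partition, except for its nodes. -/
theorem Ioo_subset_iUnion_pieces {k : ℕ} {x : Fin (k + 2) → ℝ} (h0 : x 0 = 0)
    (h1 : x (Fin.last (k + 1)) = 1) :
    Ioo (0 : ℝ) 1 ⊆ (⋃ j : Fin (k + 1), Ioo (x j.castSucc) (x j.succ)) ∪ range x := by
  intro y hy
  by_contra hcon
  simp only [mem_union, mem_iUnion, mem_range, not_or, not_exists] at hcon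
  obtain ⟨hp, hr⟩ := hcon
  have : ∀ j : Fin (k + 2), x j < y := by
    intro j
    induction j using Fin.induction with
    | zero => rw [h0]; exact hy.1
    | succ j ih =>
      have h2 : ¬ y < x j.succ := fun h => hp j ⟨ih, h⟩
      exact lt_of_le_of_ne (not_lt.1 h2) (hr j.succ)
  have h2 := this (Fin.last (k + 1))
  rw [h1] at h2
  exact absurd hy.2 (not_lt.2 h2.le)

theorem piece_subset {k : ℕ} {x : Fin (k + 2) → ℝ} (hx : StrictMono x) (h0 : x 0 = 0)
    (h1 : x (Fin.last (k + 1)) = 1) (j : Fin (k + 2)) : x j ∈ Icc (0 : ℝ) 1 :=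
  ⟨h0 ▸ hx.monotone (Fin.zero_le j), h1 ▸ hx.monotone (Fin.le_last j)⟩

theorem Ioo_ae_eq_iUnion_pieces {k : ℕ} {x : Fin (k + 2) → ℝ} (hx : StrictMono x) (h0 : x 0 = 0)
    (h1 : x (Fin.last (k + 1)) = 1) :
    (Ioo (0 : ℝ) 1 : Set ℝ) =ᵐ[volume] ⋃ j : Fin (k + 1), Ioo (x j.castSucc) (x j.succ) := by
  have hnull : ∀ᵐ y : ℝ, y ∉ range x :=
    measure_eq_zero_iff_ae_notMem.1 ((finite_range x).measure_zero _)
  filter_upwards [hnull] with y hy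
  refine propext ⟨fun h => ?_, fun h => ?_⟩
  · exact (Ioo_subset_iUnion_pieces h0 h1 h).resolve_right hy
  · obtain ⟨j, hj⟩ := mem_iUnion.1 h
    exact ⟨(piece_subset hx h0 h1 _).1.trans_lt hj.1, hj.2.trans_le (piece_subset hx h0 h1 _).2⟩

theorem pairwise_disjoint_pieces {k : ℕ} {x : Fin (k + 2) → ℝ} (hx : StrictMono x) :
    Pairwise (Function.onFun Disjoint fun j : Fin (k + 1) => Ioo (x j.castSucc) (x j.succ)) := by
  have aux : ∀ i j : Fin (k + 1), i < j →
      Disjoint (Ioo (x i.castSucc) (x i.succ)) (Ioo (x j.castSucc) (x j.succ)) := by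
    intro i j hij
    rw [Set.disjoint_left]
    intro y hi hj
    have : x i.succ ≤ x j.castSucc := hx.monotone (by
      rw [Fin.le_def, Fin.val_succ, Fin.val_castSucc]; exact hij)
    linarith [hi.2, hj.1]
  intro i j hij
  rcases lt_or_gt_of_ne hij with h | h
  · exact aux i j h
  · exact (aux j i h).symm

theorem PiecewiseLipschitz.aestronglyMeasurable {u₀ : ℝ → ℝ} (hu : PiecewiseLipschitz u₀) :
    AEStronglyMeasurable u₀ volI := by
  obtain ⟨k, x, hx, h0, h1, hL⟩ := hu
  rw [volI, Measure.restrict_congr_set (Ioo_ae_eq_iUnion_pieces hx h0 h1),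
    aestronglyMeasurable_iUnion_iff]
  intro j
  obtain ⟨K, hK⟩ := hL j
  exact hK.continuousOn.aestronglyMeasurable measurableSet_Ioo

theorem PiecewiseLipschitz.exists_bound {u₀ : ℝ → ℝ} (hu : PiecewiseLipschitz u₀) :
    ∃ M : ℝ, 0 ≤ M ∧ ∀ y ∈ Ioo (0 : ℝ) 1, |u₀ y| ≤ M := by
  obtain ⟨k, x, hx, h0, h1, hL⟩ := hu
  have hb : Bornology.IsBounded (u₀ '' Ioo (0 : ℝ) 1) := by
    refine Bornology.IsBounded.subset (t := (⋃ j : Fin (k + 1), u₀ '' Ioo (x j.castSucc) (x j.succ))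
      ∪ u₀ '' range x) ?_ ?_
    · refine Bornology.IsBounded.union ?_ ((finite_range x).image _).isBounded
      rw [Bornology.isBounded_iUnion]
      intro j
      obtain ⟨K, hK⟩ := hL j
      obtain ⟨g, hg, hgu⟩ := hK.extend_real
      rw [image_congr hgu]
      exact hg.isBounded_image (Metric.isBounded_Ioo _ _)
    · rw [← image_iUnion, ← image_union]
      exact image_mono (Ioo_subset_iUnion_pieces h0 h1)
  obtain ⟨M, hM⟩ := hb.exists_norm_le
  exact ⟨max M 0, le_max_right _ _, fun y hy =>
    (hM _ (mem_image_of_mem _ hy)).trans (le_max_left _ _)⟩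

theorem PiecewiseLipschitz.memLp {u₀ : ℝ → ℝ} (hu : PiecewiseLipschitz u₀) (p : ENNReal) :
    MemLp u₀ p volI := by
  obtain ⟨M, _, hM⟩ := hu.exists_bound
  exact MemLp.of_bound hu.aestronglyMeasurable M (ae_volI_mem.mono fun y hy => hM y hy)

/-- On each piece `u₀` is replaced by a Lipschitz extension to the whole line, to which the
translation argument applies. -/
theorem PiecewiseLipschitz.exists_norm_integral_mul_exp_le {u₀ : ℝ → ℝ}
    (hu : PiecewiseLipschitz u₀) : ∃ M : ℝ, ∀ κ : ℝ, 1 ≤ κ →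
      ‖∫ y in (0 : ℝ)..1, (u₀ y : ℂ) * Complex.exp (-Complex.I * κ * y)‖ ≤ M / κ := by
  have hint := (hu.memLp 1).integrable le_rfl
  obtain ⟨k, x, hx, h0, h1, hL⟩ := hu
  choose K hK using hL
  choose g hg hgu using fun j => (hK j).extend_real
  have hC := fun j : Fin (k + 1) => exists_norm_integral_lipschitz_mul_exp_le (hg j)
    (piece_subset hx h0 h1 j.castSucc).1 (hx Fin.castSucc_lt_succ).le
    (piece_subset hx h0 h1 j.succ).2
  choose C hC using hC
  refine ⟨∑ j, C j, fun κ hκ => ?_⟩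
  have hint2 : Integrable (fun y => (u₀ y : ℂ) * Complex.exp (-Complex.I * κ * y)) volI := by
    refine hint.ofReal.mul_bdd (c := 1) (Continuous.aestronglyMeasurable (by fun_prop))
      (.of_forall fun y => ?_)
    have : ‖Complex.exp (-Complex.I * κ * y)‖ = 1 := by
      simpa using norm_exp_I_mul_ofReal (-κ) y
    exact this.le
  rw [← integral_volI]
  rw [volI, Measure.restrict_congr_set (Ioo_ae_eq_iUnion_pieces hx h0 h1)] at hint2 ⊢
  rw [integral_iUnion_fintype (fun j => measurableSet_Ioo) (pairwise_disjoint_pieces hx)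
    fun j => hint2.mono_measure (Measure.restrict_mono (subset_iUnion _ j) le_rfl), Finset.sum_div]
  refine (norm_sum_le _ _).trans (Finset.sum_le_sum fun j _ => ?_)
  have : ∫ y in Ioo (x j.castSucc) (x j.succ), (u₀ y : ℂ) * Complex.exp (-Complex.I * κ * y)
      = ∫ y in (x j.castSucc)..(x j.succ), (g j y : ℂ) * Complex.exp (-Complex.I * κ * y) := by
    rw [intervalIntegral.integral_of_le (hx Fin.castSucc_lt_succ).le, integral_Ioc_eq_integral_Ioo]
    exact setIntegral_congr_fun measurableSet_Ioo fun y hy => by simp only [hgu j hy]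
  rw [this]
  exact hC j κ hκ

/-- Near `0` this is the Lipschitz bound of the first piece. Beyond that piece `y` is bounded below,
and the bound of `u₀` suffices. A linear bound on all of `(0,1)` spares the Laplace estimate a
splitting. -/
theorem PiecewiseLipschitz.exists_rightLim_bound {u₀ : ℝ → ℝ} (hu : PiecewiseLipschitz u₀) :
    ∃ M : ℝ, ∀ y ∈ Ioo (0 : ℝ) 1, |u₀ y - Function.rightLim u₀ 0| ≤ M * y := by
  obtain ⟨B, hB0, hB⟩ := hu.exists_bound
  obtain ⟨k, x, hx, h0, h1, hL⟩ := hu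
  obtain ⟨K, hK⟩ := hL 0
  obtain ⟨g, hg, hgu⟩ := hK.extend_real
  have hx1 : 0 < x (Fin.succ 0) := by rw [← h0]; exact hx (Fin.succ_pos 0)
  rw [Fin.castSucc_zero, h0] at hgu
  have hlim : Function.rightLim u₀ 0 = g 0 := by
    refine rightLim_eq_of_tendsto ?_
    refine ((hg.continuous.tendsto 0).mono_left nhdsWithin_le_nhds).congr' ?_
    filter_upwards [Ioo_mem_nhdsGT hx1] with y hy
    exact (hgu hy).symm
  have hg0 : |g 0| ≤ B + K := by
    have hm : min (x (Fin.succ 0)) 1 / 2 ∈ Ioo (0 : ℝ) (x (Fin.succ 0)) := by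
      constructor
      · have := lt_min hx1 one_pos
        linarith
      · have := min_le_left (x (Fin.succ 0)) 1
        have := lt_min hx1 one_pos
        linarith
    have hle1 := min_le_right (x (Fin.succ 0)) 1
    have hle2 : min (x (Fin.succ 0)) 1 / 2 ≤ 1 / 2 := by linarith
    set y := min (x (Fin.succ 0)) 1 / 2
    have h2 := hB y ⟨hm.1, by linarith⟩
    rw [hgu hm] at h2
    have h3 := hg.dist_le_mul 0 y
    rw [Real.dist_eq, Real.dist_eq, zero_sub, abs_neg, abs_of_pos hm.1] at h3
    have h4 : (K : ℝ) * y ≤ K * 1 := mul_le_mul_of_nonneg_left (by linarith) K.2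
    have h5 := abs_add_le (g 0 - g y) (g y)
    rw [sub_add_cancel] at h5
    linarith
  refine ⟨K + (2 * B + K) / x (Fin.succ 0), fun y hy => ?_⟩
  have hq : 0 ≤ (2 * B + K) / x (Fin.succ 0) := by positivity
  rw [hlim]
  rcases lt_or_ge y (x (Fin.succ 0)) with hlt | hge
  · rw [hgu ⟨hy.1, hlt⟩]
    have h3 := hg.dist_le_mul y 0
    rw [Real.dist_eq, Real.dist_eq, sub_zero, abs_of_pos hy.1] at h3
    have := mul_nonneg hq hy.1.le
    linarith
  · have h2 := abs_sub (u₀ y) (g 0)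
    have h3 := hB y hy
    have h4 : 2 * B + K ≤ (2 * B + K) / x (Fin.succ 0) * y := by
      rw [div_mul_eq_mul_div, le_div_iff₀ hx1]
      exact mul_le_mul_of_nonneg_left hge (by positivity)
    have h5 : 0 ≤ (K : ℝ) * y := mul_nonneg K.2 hy.1.le
    linarith

theorem PiecewiseLipschitz.exists_leftLim_bound {u₀ : ℝ → ℝ} (hu : PiecewiseLipschitz u₀) :
    ∃ M : ℝ, ∀ y ∈ Ioo (0 : ℝ) 1, |u₀ y - Function.leftLim u₀ 1| ≤ M * (1 - y) := by
  obtain ⟨B, hB0, hB⟩ := hu.exists_bound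
  obtain ⟨k, x, hx, h0, h1, hL⟩ := hu
  obtain ⟨K, hK⟩ := hL (Fin.last k)
  obtain ⟨g, hg, hgu⟩ := hK.extend_real
  rw [Fin.succ_last, h1] at hgu
  set a := x (Fin.last k).castSucc with ha
  have hx1 : a < 1 := by rw [← h1]; exact hx (Fin.castSucc_lt_last _)
  have ha0 : 0 ≤ a := (piece_subset hx h0 h1 _).1
  have hlim : Function.leftLim u₀ 1 = g 1 := by
    refine leftLim_eq_of_tendsto ?_
    refine ((hg.continuous.tendsto 1).mono_left nhdsWithin_le_nhds).congr' ?_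
    filter_upwards [Ioo_mem_nhdsLT hx1] with y hy
    exact (hgu hy).symm
  have hg0 : |g 1| ≤ B + K := by
    have hm : (a + 1) / 2 ∈ Ioo a 1 := by constructor <;> linarith
    set y := (a + 1) / 2
    have h2 := hB y ⟨by linarith [hm.1], hm.2⟩
    rw [hgu hm] at h2
    have h3 := hg.dist_le_mul 1 y
    rw [Real.dist_eq, Real.dist_eq, abs_of_pos (by linarith [hm.2] : 0 < 1 - y)] at h3
    have h4 : (K : ℝ) * (1 - y) ≤ K * 1 := mul_le_mul_of_nonneg_left (by linarith [hm.1]) K.2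
    have h5 := abs_add_le (g 1 - g y) (g y)
    rw [sub_add_cancel] at h5
    linarith
  have hx1' : 0 < 1 - a := by linarith
  refine ⟨K + (2 * B + K) / (1 - a), fun y hy => ?_⟩
  have hq : 0 ≤ (2 * B + K) / (1 - a) := by positivity
  have hy1 : 0 < 1 - y := by linarith [hy.2]
  rw [hlim]
  rcases lt_or_ge a y with hlt | hge
  · rw [hgu ⟨hlt, hy.2⟩]
    have h3 := hg.dist_le_mul y 1
    rw [Real.dist_eq, Real.dist_eq, abs_sub_comm y 1, abs_of_pos hy1] at h3
    have := mul_nonneg hq hy1.le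
    linarith
  · have h2 := abs_sub (u₀ y) (g 1)
    have h3 := hB y hy
    have h4 : 2 * B + K ≤ (2 * B + K) / (1 - a) * (1 - y) := by
      rw [div_mul_eq_mul_div, le_div_iff₀ hx1']
      exact mul_le_mul_of_nonneg_left (by linarith) (by positivity)
    have h5 : 0 ≤ (K : ℝ) * (1 - y) := mul_nonneg K.2 hy1.le
    linarith

open scoped Topology
open Filter Asymptotics

/-! ### Asymptotics of the coefficients -/

theorem intervalIntegrable_ofReal {v : ℝ → ℝ} {a b : ℝ} (h : IntervalIntegrable v volume a b) :
    IntervalIntegrable (fun y => (v y : ℂ)) volume a b :=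
  ⟨h.1.ofReal, h.2.ofReal⟩

/-- A Laplace integral is determined to leading order by the boundary value at `0`. -/
theorem norm_laplace_sub_le {v : ℝ → ℝ} (hv : IntervalIntegrable v volume 0 1) {c M : ℝ}
    (hM : 0 ≤ M) (hc : ∀ y ∈ Ioo (0 : ℝ) 1, |v y - c| ≤ M * y) {z : ℂ} (hz : ‖z‖ = 1)
    (hre : z.re = Real.sqrt 3 / 2) {κ : ℝ} (hκ : 1 ≤ κ) :
    ‖(∫ y in (0 : ℝ)..1, (v y : ℂ) * Complex.exp (-z * κ * y)) - c / (z * κ)‖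
      ≤ (2 * M + 2 * |c|) / κ ^ 2 := by
  have h3 := sqrt_three_bounds.1
  have hκ0 : 0 < κ := by linarith
  have hz0 : z ≠ 0 := by rw [← norm_ne_zero_iff, hz]; norm_num
  have hκc : (κ : ℂ) ≠ 0 := by exact_mod_cast hκ0.ne'
  have hnorm : ∀ y : ℝ, ‖Complex.exp (-z * κ * y)‖ = Real.exp (-(Real.sqrt 3 / 2 * κ * y)) := by
    intro y
    rw [Complex.norm_exp]
    simp [hre]
  have hec : Continuous fun y : ℝ => Complex.exp (-z * κ * y) := by fun_prop
  have hvc : IntervalIntegrable (fun y => ((v y - c : ℝ) : ℂ)) volume 0 1 :=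
    intervalIntegrable_ofReal (hv.sub intervalIntegrable_const)
  have hI1 : IntervalIntegrable (fun y => ((v y - c : ℝ) : ℂ) * Complex.exp (-z * κ * y)) volume 0 1 :=
    hvc.mul_continuousOn hec.continuousOn
  have hI2 : IntervalIntegrable (fun y : ℝ => (c : ℂ) * Complex.exp (-z * κ * y)) volume 0 1 :=
    (continuous_const.mul hec).intervalIntegrable _ _
  -- The boundary value is integrated exactly, with an exponentially small term from the other end.
  -- The remainder is at most `M y`, and the extra factor `y` gains a second power of `1/κ`.
  have hsplit : ∫ y in (0 : ℝ)..1, (v y : ℂ) * Complex.exp (-z * κ * y)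
      = (∫ y in (0 : ℝ)..1, ((v y - c : ℝ) : ℂ) * Complex.exp (-z * κ * y))
        + ∫ y in (0 : ℝ)..1, (c : ℂ) * Complex.exp (-z * κ * y) := by
    rw [← intervalIntegral.integral_add hI1 hI2]
    refine intervalIntegral.integral_congr fun y _ => ?_
    push_cast
    ring
  have hexp : ∫ y in (0 : ℝ)..1, (c : ℂ) * Complex.exp (-z * κ * y)
      = c / (z * κ) - c * Complex.exp (-z * κ) / (z * κ) := by
    rw [intervalIntegral.integral_const_mul, integral_exp_mul_complex
      (mul_ne_zero (neg_ne_zero.2 hz0) hκc)]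
    simp only [Complex.ofReal_one, mul_one, Complex.ofReal_zero, mul_zero, Complex.exp_zero]
    field_simp
    ring
  have ha : 0 < Real.sqrt 3 / 2 * κ := by positivity
  have hfirst : ‖∫ y in (0 : ℝ)..1, ((v y - c : ℝ) : ℂ) * Complex.exp (-z * κ * y)‖
      ≤ M * (1 / (Real.sqrt 3 / 2 * κ) ^ 2) := by
    refine (intervalIntegral.norm_integral_le_of_norm_le zero_le_one (g := fun y =>
      M * (y * Real.exp (-(Real.sqrt 3 / 2 * κ * y)))) ?_
      (Continuous.intervalIntegrable (by fun_prop) _ _)).trans ?_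
    · filter_upwards [(measure_eq_zero_iff_ae_notMem.1 (measure_singleton (1 : ℝ)) :
        ∀ᵐ y : ℝ, y ∉ ({1} : Set ℝ))] with y hy1 hy
      rw [norm_mul, hnorm, Complex.norm_real, Real.norm_eq_abs, ← mul_assoc]
      refine mul_le_mul_of_nonneg_right (hc y ⟨hy.1, lt_of_le_of_ne hy.2 hy1⟩) (Real.exp_pos _).le
    · rw [intervalIntegral.integral_const_mul]
      exact mul_le_mul_of_nonneg_left (integral_mul_exp_neg_mul_le ha) hM
  have hsecond : ‖(c : ℂ) * Complex.exp (-z * κ) / (z * κ)‖ ≤ |c| * (2 / κ) / κ := by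
    have hn := hnorm 1
    simp only [Complex.ofReal_one, mul_one] at hn
    rw [norm_div, norm_mul, norm_mul, hz, hn, one_mul, Complex.norm_real, Complex.norm_real,
      Real.norm_eq_abs, Real.norm_eq_abs, abs_of_pos hκ0]
    gcongr
    rw [Real.exp_neg, inv_eq_one_div, div_le_div_iff₀ (Real.exp_pos _) hκ0]
    have := Real.add_one_le_exp (Real.sqrt 3 / 2 * κ)
    nlinarith
  have hone : M * (1 / (Real.sqrt 3 / 2 * κ) ^ 2) ≤ 2 * M / κ ^ 2 := by
    have hs : Real.sqrt 3 ^ 2 = 3 := Real.sq_sqrt (by norm_num)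
    rw [mul_pow, div_pow, hs, mul_one_div, div_le_div_iff₀ (by positivity) (by positivity)]
    nlinarith [mul_nonneg hM (sq_nonneg κ)]
  rw [hsplit, hexp]
  have e : (∫ y in (0 : ℝ)..1, ((v y - c : ℝ) : ℂ) * Complex.exp (-z * κ * y))
      + (c / (z * κ) - c * Complex.exp (-z * κ) / (z * κ)) - c / (z * κ)
      = (∫ y in (0 : ℝ)..1, ((v y - c : ℝ) : ℂ) * Complex.exp (-z * κ * y))
        - c * Complex.exp (-z * κ) / (z * κ) := by ring
  rw [e]
  refine (norm_sub_le _ _).trans ?_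
  have e2 : (2 * M + 2 * |c|) / κ ^ 2 = 2 * M / κ ^ 2 + |c| * (2 / κ) / κ := by field_simp
  rw [e2]
  linarith

/-- The Fourier integral of `v` over the unit interval. -/
def oscIntegral (v : ℝ → ℝ) (κ : ℝ) : ℂ :=
  ∫ y in (0 : ℝ)..1, (v y : ℂ) * Complex.exp (-Complex.I * κ * y)

theorem norm_exp_sub_exp_le (a b : ℝ) :
    ‖Complex.exp (Complex.I * a) - Complex.exp (Complex.I * b)‖ ≤ |a - b| := by
  have : Complex.exp (Complex.I * a) - Complex.exp (Complex.I * b)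
      = Complex.exp (Complex.I * b) * (Complex.exp (Complex.I * ((a - b : ℝ) : ℂ)) - 1) := by
    rw [mul_sub, ← Complex.exp_add]
    congr 2
    · push_cast; ring
    · ring
  rw [this, norm_mul, norm_exp_I_mul_ofReal', one_mul]
  exact norm_exp_I_mul_sub_one_le _

theorem norm_oscIntegral_sub_le {v : ℝ → ℝ} (hv : IntervalIntegrable v volume 0 1) {M : ℝ}
    (hM : ∀ y ∈ Ioo (0 : ℝ) 1, |v y| ≤ M) (κ κ' : ℝ) :
    ‖oscIntegral v κ - oscIntegral v κ'‖ ≤ M * |κ - κ'| := by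
  have hi : ∀ κ : ℝ, IntervalIntegrable
      (fun y => (v y : ℂ) * Complex.exp (-Complex.I * κ * y)) volume 0 1 := fun κ =>
    (intervalIntegrable_ofReal hv).mul_continuousOn (Continuous.continuousOn (by fun_prop))
  rw [oscIntegral, oscIntegral, ← intervalIntegral.integral_sub (hi κ) (hi κ')]
  refine (intervalIntegral.norm_integral_le_of_norm_le zero_le_one
    (g := fun _ => M * |κ - κ'|) ?_ intervalIntegrable_const).trans (by simp)
  filter_upwards [(measure_eq_zero_iff_ae_notMem.1 (measure_singleton (1 : ℝ)) :
    ∀ᵐ y : ℝ, y ∉ ({1} : Set ℝ))] with y hy1 hy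
  have hv1 := hM y ⟨hy.1, lt_of_le_of_ne hy.2 hy1⟩
  rw [← mul_sub, norm_mul, Complex.norm_real, Real.norm_eq_abs]
  refine mul_le_mul hv1 ?_ (norm_nonneg _) ((abs_nonneg _).trans hv1)
  have h := norm_exp_sub_exp_le (-κ * y) (-κ' * y)
  have e : -κ * y - -κ' * y = -((κ - κ') * y) := by ring
  rw [e, abs_neg, abs_mul, abs_of_pos hy.1] at h
  have e1 : Complex.I * ((-κ * y : ℝ) : ℂ) = -Complex.I * κ * y := by push_cast; ring
  have e2 : Complex.I * ((-κ' * y : ℝ) : ℂ) = -Complex.I * κ' * y := by push_cast; ring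
  rw [e1, e2] at h
  exact h.trans (mul_le_of_le_one_right (abs_nonneg _) hy.2)

theorem intervalIntegrable_of_memLp {v : ℝ → ℝ} (hv : MemLp v 2 volI) :
    IntervalIntegrable v volume 0 1 := by
  rw [intervalIntegrable_iff_integrableOn_Ioo_of_le zero_le_one]
  exact hv.integrable (by norm_num)

/-- The layer at `1` is reflected to `0`, so that one Laplace estimate serves both ends. -/
theorem inner_airyMode_toLp {v : ℝ → ℝ} (hv : MemLp v 2 volI) (κ : ℝ) :
    inner ℂ (toL2 (airyMode κ)) (complexify (hv.toLp v)) = oscIntegral v κ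
      + conj (layerB κ) * (∫ y in (0 : ℝ)..1, (v y : ℂ) * Complex.exp (-rootB * κ * y))
      + conj (layerC κ) * (∫ y in (0 : ℝ)..1, (v (1 - y) : ℂ) * Complex.exp (-rootA * κ * y)) := by
  have hvi := intervalIntegrable_of_memLp hv
  have h1 : inner ℂ (toL2 (airyMode κ)) (complexify (hv.toLp v))
      = ∫ y in (0 : ℝ)..1, conj (airyMode κ y) * (v y : ℂ) := by
    have hc : Continuous (airyMode κ) := continuous_expComb κ _ _ _
    rw [inner_toL2_complexify (memLp_of_continuous hc 2), ← integral_volI]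
    exact integral_congr_ae (hv.coeFn_toLp.mono fun x hx => by simp only [hx])
  have h2 : ∫ y in (0 : ℝ)..1, (v (1 - y) : ℂ) * Complex.exp (-rootA * κ * y)
      = ∫ y in (0 : ℝ)..1, (v y : ℂ) * Complex.exp (-rootA * κ * (1 - y)) := by
    have := intervalIntegral.integral_comp_sub_left (a := (0 : ℝ)) (b := 1)
      (fun y : ℝ => (v y : ℂ) * Complex.exp (-rootA * κ * (1 - y))) 1
    rw [sub_self, sub_zero] at this
    rw [← this]
    refine intervalIntegral.integral_congr fun y _ => ?_
    simp
  rw [h1, h2, oscIntegral, ← intervalIntegral.integral_const_mul,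
    ← intervalIntegral.integral_const_mul, ← intervalIntegral.integral_add,
    ← intervalIntegral.integral_add]
  · refine intervalIntegral.integral_congr fun y _ => ?_
    simp only [airyMode, expComb, map_add, map_mul, ← Complex.exp_conj, Complex.conj_I,
      Complex.conj_ofReal, map_one, map_neg, map_sub, conj_rootA, conj_rootB, neg_mul]
    ring
  · exact ((intervalIntegrable_ofReal hvi).mul_continuousOn (Continuous.continuousOn (by fun_prop))).add
      (((intervalIntegrable_ofReal hvi).mul_continuousOn (Continuous.continuousOn (by fun_prop))).const_mul _)
  · exact ((intervalIntegrable_ofReal hvi).mul_continuousOn (Continuous.continuousOn (by fun_prop))).const_mul _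
  · exact (intervalIntegrable_ofReal hvi).mul_continuousOn (Continuous.continuousOn (by fun_prop))
  · exact ((intervalIntegrable_ofReal hvi).mul_continuousOn (Continuous.continuousOn (by fun_prop))).const_mul _

theorem rootB_sq_eq_exp (n : ℕ) : Complex.exp (Complex.I * waveNumber n) = rootB ^ 2 := by
  have e : Complex.I * waveNumber n
      = ((-(Real.pi / 3) : ℝ) : ℂ) * Complex.I + n * (2 * Real.pi * Complex.I) := by
    rw [waveNumber]; push_cast; ring
  rw [e, Complex.exp_add, Complex.exp_nat_mul_two_pi_mul_I, mul_one, Complex.exp_mul_I,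
    ← Complex.ofReal_cos, ← Complex.ofReal_sin, Real.cos_neg, Real.sin_neg, Real.cos_pi_div_three,
    Real.sin_pi_div_three, rootB_sq, rootB]
  push_cast
  linear_combination (-1 / 2 : ℂ) * Complex.I_sq

/-- At these frequencies a constant `c` has Fourier integral `-c rootA / waveNumber n`, the very
form of the leading layer contributions; hence the layers can be absorbed by adding a constant to
`u₀`. -/
theorem integral_exp_waveNumber (n : ℕ) (hn : 1 ≤ n) :
    ∫ y in (0 : ℝ)..1, Complex.exp (-Complex.I * waveNumber n * y) = -rootA / waveNumber n := by
  have h2 := two_le_waveNumber_sub hn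
  have hpi := Real.pi_pos
  have hk : (waveNumber n : ℂ) ≠ 0 := by exact_mod_cast (by linarith : waveNumber n ≠ 0)
  have hI := Complex.I_ne_zero
  rw [integral_exp_mul_complex (mul_ne_zero (neg_ne_zero.2 hI) hk)]
  have e : Complex.exp (-Complex.I * waveNumber n * ((1 : ℝ) : ℂ)) = rootA ^ 2 := by
    have := congrArg conj (rootB_sq_eq_exp n)
    rw [map_pow, conj_rootB, conj_exp_I_mul] at this
    rw [← this]
    simp
  rw [e, rootA_sq]
  simp only [Complex.ofReal_zero, mul_zero, Complex.exp_zero]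
  field_simp
  ring

theorem revivalCoeff_eq {u₀ : ℝ → ℝ} (hu : MemLp u₀ 2 volI) {n : ℕ} (hn : 1 ≤ n) :
    revivalCoeff u₀ n = oscIntegral u₀ (waveNumber n)
      - (Function.leftLim u₀ 1 + Function.rightLim u₀ 0 : ℝ) * rootA / waveNumber n := by
  have hvi := intervalIntegrable_of_memLp hu
  have e : ∀ y : ℝ, (shifted u₀ y : ℂ) * Complex.exp (-Complex.I * waveNumber n * y)
      = (u₀ y : ℂ) * Complex.exp (-Complex.I * waveNumber n * y)
        + (Function.leftLim u₀ 1 + Function.rightLim u₀ 0 : ℝ)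
          * Complex.exp (-Complex.I * waveNumber n * y) := by
    intro y
    rw [shifted]
    push_cast
    ring
  rw [revivalCoeff]
  simp only [e]
  rw [intervalIntegral.integral_add, intervalIntegral.integral_const_mul,
    integral_exp_waveNumber n hn, oscIntegral]
  · ring
  · exact (intervalIntegrable_ofReal hvi).mul_continuousOn (Continuous.continuousOn (by fun_prop))
  · exact Continuous.intervalIntegrable (by fun_prop) _ _

/-! ### Orders of magnitude along the wave numbers, in powers of `1/n`. -/

/-- A sequence of wave numbers that is asymptotic to `waveNumber`. -/
def IsWaveSeq (w : ℕ → ℝ) : Prop :=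
  ∀ᶠ n in atTop, 200 ≤ w n ∧ |w n - waveNumber n| ≤ 16 * layerDecay (w n)
    ∧ |w n - waveNumber n| ≤ 1

theorem le_waveNumber {n : ℕ} (hn : 1 ≤ n) : (n : ℝ) + 1 ≤ waveNumber n ∧ waveNumber n ≤ 8 * n := by
  have h1 : (1 : ℝ) ≤ n := by exact_mod_cast hn
  have := Real.pi_gt_three
  have := Real.pi_le_four
  rw [waveNumber]
  constructor <;> nlinarith

theorem IsWaveSeq.bounds {w : ℕ → ℝ} (hw : IsWaveSeq w) :
    ∀ᶠ n in atTop, 1 ≤ n ∧ 200 ≤ w n ∧ (n : ℝ) ≤ w n ∧ w n ≤ 9 * n := by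
  filter_upwards [hw, eventually_ge_atTop 1] with n h1 hn
  obtain ⟨a, b⟩ := le_waveNumber hn
  have hn1 : (1 : ℝ) ≤ n := by exact_mod_cast hn
  obtain ⟨c, d⟩ := abs_le.1 h1.2.2
  exact ⟨hn, h1.1, by linarith, by linarith⟩

theorem IsWaveSeq.isBigO_exp {w : ℕ → ℝ} (hw : IsWaveSeq w) {c : ℝ} (hc : 0 < c) (k : ℕ) :
    (fun n => Real.exp (-(c * w n))) =O[atTop] fun n : ℕ => ((n : ℝ)⁻¹) ^ k := by
  refine IsBigO.of_bound ((k.factorial : ℝ) / c ^ k) ?_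
  filter_upwards [hw.bounds] with n ⟨hn, _, h2, _⟩
  have hn1 : (1 : ℝ) ≤ n := by exact_mod_cast hn
  have h := Real.pow_div_factorial_le_exp (c * n) (by positivity) k
  rw [Real.norm_of_nonneg (Real.exp_pos _).le, Real.norm_of_nonneg (by positivity)]
  have h3 : Real.exp (-(c * w n)) ≤ Real.exp (-(c * n)) := by gcongr
  refine h3.trans ?_
  rw [Real.exp_neg]
  have h4 : (k.factorial : ℝ) / c ^ k * ((n : ℝ)⁻¹) ^ k = ((c * n) ^ k / k.factorial)⁻¹ := by
    rw [inv_div, mul_pow, inv_pow]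
    field_simp
  rw [h4]
  exact inv_anti₀ (by positivity) h

theorem IsWaveSeq.isBigO_layerDecay {w : ℕ → ℝ} (hw : IsWaveSeq w) (k : ℕ) :
    (fun n => layerDecay (w n)) =O[atTop] fun n : ℕ => ((n : ℝ)⁻¹) ^ k :=
  hw.isBigO_exp (by positivity) k

theorem IsWaveSeq.isBigO_sub {w : ℕ → ℝ} (hw : IsWaveSeq w) (k : ℕ) :
    (fun n => w n - waveNumber n) =O[atTop] fun n : ℕ => ((n : ℝ)⁻¹) ^ k := by
  refine IsBigO.trans (IsBigO.of_bound 16 ?_) (hw.isBigO_layerDecay k)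
  filter_upwards [hw] with n hn
  rw [Real.norm_eq_abs, Real.norm_of_nonneg (layerDecay_pos _).le]
  exact hn.2.1

theorem IsWaveSeq.isBigO_inv {w : ℕ → ℝ} (hw : IsWaveSeq w) :
    (fun n => (w n)⁻¹) =O[atTop] fun n : ℕ => ((n : ℝ)⁻¹) ^ 1 := by
  refine IsBigO.of_bound 1 ?_
  filter_upwards [hw.bounds] with n ⟨hn, h1, h2, _⟩
  have hn1 : (1 : ℝ) ≤ n := by exact_mod_cast hn
  rw [Real.norm_of_nonneg (by positivity), Real.norm_of_nonneg (by positivity), pow_one, one_mul]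
  exact inv_anti₀ (by positivity) h2

theorem isBigO_inv_waveNumber :
    (fun n => (waveNumber n)⁻¹) =O[atTop] fun n : ℕ => ((n : ℝ)⁻¹) ^ 1 := by
  refine IsBigO.of_bound 1 ?_
  filter_upwards [eventually_ge_atTop 1] with n hn
  obtain ⟨a, _⟩ := le_waveNumber hn
  have hn1 : (1 : ℝ) ≤ n := by exact_mod_cast hn
  rw [Real.norm_of_nonneg (inv_nonneg.2 (by linarith)), Real.norm_of_nonneg (by positivity), pow_one,
    one_mul]
  exact inv_anti₀ (by positivity) (by linarith)

theorem isBigO_inv_pow_of_le {j k : ℕ} (h : j ≤ k) :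
    (fun n : ℕ => ((n : ℝ)⁻¹) ^ k) =O[atTop] fun n : ℕ => ((n : ℝ)⁻¹) ^ j := by
  refine IsBigO.of_bound 1 ?_
  filter_upwards [eventually_ge_atTop 1] with n hn
  have hn1 : (1 : ℝ) ≤ n := by exact_mod_cast hn
  rw [Real.norm_of_nonneg (by positivity), Real.norm_of_nonneg (by positivity), one_mul]
  exact pow_le_pow_of_le_one (by positivity) (inv_le_one_of_one_le₀ hn1) h

theorem isBigO_mul_inv_pow {f g : ℕ → ℂ} {j k m : ℕ}
    (hf : f =O[atTop] fun n : ℕ => ((n : ℝ)⁻¹) ^ j) (hg : g =O[atTop] fun n : ℕ => ((n : ℝ)⁻¹) ^ k)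
    (h : m ≤ j + k) : (fun n => f n * g n) =O[atTop] fun n : ℕ => ((n : ℝ)⁻¹) ^ m := by
  have h1 := hf.mul hg
  simp only [← pow_add] at h1
  exact h1.trans (isBigO_inv_pow_of_le h)

theorem isBigO_ofReal {f : ℕ → ℝ} {g : ℕ → ℝ} (h : f =O[atTop] g) :
    (fun n => (f n : ℂ)) =O[atTop] g :=
  (IsBigO.of_norm_left (h.norm_left.congr_left fun n => by simp))

theorem IsWaveSeq.isBigO_layerB {w : ℕ → ℝ} (hw : IsWaveSeq w) (k : ℕ) :
    (fun n => conj (layerB (w n)) + 1) =O[atTop] fun n : ℕ => ((n : ℝ)⁻¹) ^ k := by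
  refine IsBigO.trans (IsBigO.of_bound 2 ?_) (hw.isBigO_layerDecay k)
  filter_upwards [hw.bounds] with n ⟨_, h1, _⟩
  have h := norm_layerB_add_one_le (by linarith : 1 ≤ w n)
  rw [← Complex.norm_conj, map_add, map_one] at h
  rwa [Real.norm_of_nonneg (layerDecay_pos _).le]

theorem IsWaveSeq.isBigO_layerC {w : ℕ → ℝ} (hw : IsWaveSeq w) (k : ℕ) :
    (fun n => conj (layerC (w n)) + rootA ^ 2) =O[atTop] fun n : ℕ => ((n : ℝ)⁻¹) ^ k := by
  have h1 : (fun n => conj (layerC (w n) + Complex.exp (Complex.I * w n))) =O[atTop]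
      fun n : ℕ => ((n : ℝ)⁻¹) ^ k := by
    refine IsBigO.trans (IsBigO.of_bound 2 ?_) (hw.isBigO_layerDecay k)
    filter_upwards [hw.bounds] with n ⟨_, h1, _⟩
    have h := norm_layerC_add_exp_le (by linarith : 1 ≤ w n)
    rwa [Real.norm_of_nonneg (layerDecay_pos _).le, Complex.norm_conj]
  have h2 : (fun n => conj (Complex.exp (Complex.I * w n) - Complex.exp (Complex.I * waveNumber n)))
      =O[atTop] fun n : ℕ => ((n : ℝ)⁻¹) ^ k := by
    refine IsBigO.trans (IsBigO.of_bound 1 ?_) (hw.isBigO_sub k)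
    refine .of_forall fun n => ?_
    rw [Complex.norm_conj, one_mul]
    exact norm_exp_sub_exp_le _ _
  refine (h1.sub h2).congr_left fun n => ?_
  rw [← map_sub, ← conj_rootB, ← map_pow, ← map_add, ← rootB_sq_eq_exp n]
  congr 1
  ring

/-- The amplitude of the mode of wave number `κ` in the expansion of `v`. -/
def amplitude (v : L2I) (κ : ℝ) : ℂ :=
  inner ℂ (toL2 (airyMode κ)) (complexify v) / ((‖toL2 (airyMode κ)‖ ^ 2 : ℝ) : ℂ)

theorem flowCoeff_smul_unitMode (v : L2I) (t : ℝ) (κ : WaveSet) :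
    flowCoeff v t κ • unitMode κ
      = (amplitude v κ * Complex.exp (Complex.I * ((κ : ℝ) : ℂ) ^ 3 * t)) • toL2 (airyMode κ) := by
  rw [flowCoeff, unitMode, inner_smul_left, smul_smul, amplitude]
  congr 1
  simp only [map_inv₀, Complex.conj_ofReal]
  push_cast
  ring

theorem norm_sq_airyMode_sub_one_le {κ : ℝ} (hκ : 1 ≤ κ) :
    |‖toL2 (airyMode κ)‖ ^ 2 - 1| ≤ 30 / κ := by
  have h := norm_inner_airyMode_sub_le hκ hκ
  have e : (∫ x in (0 : ℝ)..1, Complex.exp (Complex.I * ((κ - κ : ℝ) : ℂ) * x)) = 1 := by simp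
  rw [e, inner_self_eq_norm_sq_to_K] at h
  have e2 : 5 / κ + 25 / κ = 30 / κ := by ring
  rw [e2] at h
  rw [← Real.norm_eq_abs, ← Complex.norm_real]
  push_cast
  exact h

section Coefficients

variable {u₀ : ℝ → ℝ} {w : ℕ → ℝ}

theorem isBigO_oscIntegral_waveNumber (hu : PiecewiseLipschitz u₀) :
    (fun n => oscIntegral u₀ (waveNumber n)) =O[atTop] fun n : ℕ => ((n : ℝ)⁻¹) ^ 1 := by
  obtain ⟨M, hM⟩ := hu.exists_norm_integral_mul_exp_le
  refine IsBigO.trans (IsBigO.of_bound M ?_) isBigO_inv_waveNumber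
  filter_upwards [eventually_ge_atTop 1] with n hn
  obtain ⟨a, _⟩ := le_waveNumber hn
  have hn1 : (1 : ℝ) ≤ n := by exact_mod_cast hn
  rw [Real.norm_of_nonneg (inv_nonneg.2 (by linarith)), ← div_eq_mul_inv]
  exact hM _ (by linarith)

theorem isBigO_revivalCoeff (hu : PiecewiseLipschitz u₀) :
    (fun n => revivalCoeff u₀ n) =O[atTop] fun n : ℕ => ((n : ℝ)⁻¹) ^ 1 := by
  have h := (isBigO_oscIntegral_waveNumber hu).sub ((isBigO_ofReal isBigO_inv_waveNumber).const_mul_left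
    ((Function.leftLim u₀ 1 + Function.rightLim u₀ 0 : ℝ) * rootA))
  refine h.congr' ?_ (.refl _ _)
  filter_upwards [eventually_ge_atTop 1] with n hn
  rw [revivalCoeff_eq (hu.memLp 2) hn]
  push_cast
  ring

/-- The layer amplitudes tend to `-1` and `-rootA²` after conjugation, and the Laplace integrals are
`a₀/(rootB κ)` and `a₁/(rootA κ)` to leading order. As `rootA rootB = 1`, the layers contribute
`-(a₀ + a₁) rootA/κ`, the correction in `revivalCoeff_eq`. -/
theorem IsWaveSeq.isBigO_inner_sub (hw : IsWaveSeq w) (hu : PiecewiseLipschitz u₀) :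
    (fun n => inner ℂ (toL2 (airyMode (w n))) (complexify ((hu.memLp 2).toLp u₀))
      - revivalCoeff u₀ n) =O[atTop] fun n : ℕ => ((n : ℝ)⁻¹) ^ 2 := by
  have hvi := intervalIntegrable_of_memLp (hu.memLp 2)
  have hvi' : IntervalIntegrable (fun y => u₀ (1 - y)) volume 0 1 := by
    have := hvi.comp_sub_left 1
    simpa using this.symm
  set a₀ := Function.rightLim u₀ 0 with ha₀
  set a₁ := Function.leftLim u₀ 1 with ha₁
  set P : ℕ → ℂ := fun n => ∫ y in (0 : ℝ)..1, (u₀ y : ℂ) * Complex.exp (-rootB * w n * y) with hP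
  set Q : ℕ → ℂ := fun n => ∫ y in (0 : ℝ)..1, (u₀ (1 - y) : ℂ) * Complex.exp (-rootA * w n * y)
    with hQ
  have hinv2 : (fun n => 1 / w n ^ 2) =O[atTop] fun n : ℕ => ((n : ℝ)⁻¹) ^ 2 := by
    refine (hw.isBigO_inv.pow 2).congr (fun n => by rw [one_div, inv_pow]) fun n => by rw [pow_one]
  have hPO : (fun n => P n - a₀ * rootA * ((w n)⁻¹ : ℝ)) =O[atTop] fun n : ℕ => ((n : ℝ)⁻¹) ^ 2 := by
    obtain ⟨M, hM⟩ := hu.exists_rightLim_bound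
    refine IsBigO.trans (IsBigO.of_bound (2 * |M| + 2 * |a₀|) ?_) hinv2
    filter_upwards [hw.bounds] with n ⟨_, h1, _⟩
    have h := norm_laplace_sub_le hvi (abs_nonneg M) (fun y hy => (hM y hy).trans
      (mul_le_mul_of_nonneg_right (le_abs_self M) hy.1.le)) norm_rootB rootB_re
      (by linarith : 1 ≤ w n)
    rw [Real.norm_of_nonneg (by positivity), mul_one_div]
    have e : (a₀ : ℂ) * rootA * ((w n)⁻¹ : ℝ) = a₀ / (rootB * w n) := by
      have hB : rootB ≠ 0 := by rw [← norm_ne_zero_iff, norm_rootB]; norm_num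
      have hwn : (w n : ℂ) ≠ 0 := by exact_mod_cast (by linarith : w n ≠ 0)
      push_cast
      field_simp
      linear_combination (a₀ : ℂ) * rootA_mul_rootB
    rw [e]
    exact h
  have hQO : (fun n => Q n - a₁ * rootB * ((w n)⁻¹ : ℝ)) =O[atTop] fun n : ℕ => ((n : ℝ)⁻¹) ^ 2 := by
    obtain ⟨M, hM⟩ := hu.exists_leftLim_bound
    refine IsBigO.trans (IsBigO.of_bound (2 * |M| + 2 * |a₁|) ?_) hinv2
    filter_upwards [hw.bounds] with n ⟨_, h1, _⟩
    have h := norm_laplace_sub_le hvi' (abs_nonneg M) (c := a₁) (fun y hy => by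
      have := hM (1 - y) ⟨by linarith [hy.2], by linarith [hy.1]⟩
      rw [sub_sub_cancel] at this
      exact this.trans (mul_le_mul_of_nonneg_right (le_abs_self M) hy.1.le)) norm_rootA rootA_re
      (by linarith : 1 ≤ w n)
    rw [Real.norm_of_nonneg (by positivity), mul_one_div]
    have e : (a₁ : ℂ) * rootB * ((w n)⁻¹ : ℝ) = a₁ / (rootA * w n) := by
      have hA : rootA ≠ 0 := by rw [← norm_ne_zero_iff, norm_rootA]; norm_num
      have hwn : (w n : ℂ) ≠ 0 := by exact_mod_cast (by linarith : w n ≠ 0)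
      push_cast
      field_simp
      linear_combination (a₁ : ℂ) * rootA_mul_rootB
    rw [e]
    exact h
  have hwO := isBigO_ofReal hw.isBigO_inv
  have hP1 : P =O[atTop] fun n : ℕ => ((n : ℝ)⁻¹) ^ 1 := by
    refine ((hPO.trans (isBigO_inv_pow_of_le one_le_two)).add
      (hwO.const_mul_left (a₀ * rootA))).congr_left fun n => by ring
  have hQ1 : Q =O[atTop] fun n : ℕ => ((n : ℝ)⁻¹) ^ 1 := by
    refine ((hQO.trans (isBigO_inv_pow_of_le one_le_two)).add
      (hwO.const_mul_left (a₁ * rootB))).congr_left fun n => by ring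
  have hosc : (fun n => oscIntegral u₀ (w n) - oscIntegral u₀ (waveNumber n)) =O[atTop]
      fun n : ℕ => ((n : ℝ)⁻¹) ^ 2 := by
    obtain ⟨M, _, hM⟩ := hu.exists_bound
    refine IsBigO.trans (IsBigO.of_bound M (.of_forall fun n => ?_)) (hw.isBigO_sub 2)
    exact norm_oscIntegral_sub_le hvi hM _ _
  have hdiff : (fun n => (((w n)⁻¹ - (waveNumber n)⁻¹ : ℝ) : ℂ)) =O[atTop]
      fun n : ℕ => ((n : ℝ)⁻¹) ^ 2 := by
    have h1 := isBigO_mul_inv_pow (m := 2) (isBigO_mul_inv_pow (m := 2)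
      (isBigO_ofReal (hw.isBigO_sub 2)) hwO (by norm_num)) (isBigO_ofReal isBigO_inv_waveNumber)
      (by norm_num)
    refine h1.neg_left.congr' ?_ (.refl _ _)
    filter_upwards [hw.bounds] with n ⟨hn, h1, _⟩
    obtain ⟨a, _⟩ := le_waveNumber hn
    have hn1 : (1 : ℝ) ≤ n := by exact_mod_cast hn
    have h2 : w n ≠ 0 := by linarith
    have h3 : waveNumber n ≠ 0 := by linarith
    norm_cast
    field_simp
    ring
  -- The errors, each `O(n⁻²)`, add up to the difference: the frequency of the Fourier integral,
  -- amplitude and Laplace integral for each layer, and `1/w n` against `1/waveNumber n`.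
  have hall := ((((hosc.add (isBigO_mul_inv_pow (m := 2) (hw.isBigO_layerB 1) hP1 (by norm_num))).sub
    hPO).add (isBigO_mul_inv_pow (m := 2) (hw.isBigO_layerC 1) hQ1 (by norm_num))).sub
    (hQO.const_mul_left (rootA ^ 2))).sub (hdiff.const_mul_left ((a₁ + a₀ : ℝ) * rootA))
  refine hall.congr' ?_ (.refl _ _)
  filter_upwards [eventually_ge_atTop 1] with n hn
  rw [inner_airyMode_toLp, revivalCoeff_eq (hu.memLp 2) hn]
  simp only [hP, hQ, ← ha₀, ← ha₁]
  push_cast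
  linear_combination (a₁ : ℂ) * rootA * (w n : ℂ)⁻¹ * rootA_mul_rootB

theorem IsWaveSeq.isBigO_norm_sq_sub (hw : IsWaveSeq w) :
    (fun n => ((‖toL2 (airyMode (w n))‖ ^ 2 - 1 : ℝ) : ℂ)) =O[atTop] fun n : ℕ => ((n : ℝ)⁻¹) ^ 1 := by
  refine isBigO_ofReal (IsBigO.trans (IsBigO.of_bound 30 ?_) hw.isBigO_inv)
  filter_upwards [hw.bounds] with n ⟨_, h1, _⟩
  rw [Real.norm_eq_abs, Real.norm_of_nonneg (inv_nonneg.2 (by linarith)), ← div_eq_mul_inv]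
  exact norm_sq_airyMode_sub_one_le (by linarith)

/-- The squared norm of the mode is `1 + O(1/n)` and the coefficient is `O(1/n)`, so the
normalization costs only `O(n⁻²)`. -/
theorem IsWaveSeq.isBigO_amplitude_sub (hw : IsWaveSeq w) (hu : PiecewiseLipschitz u₀) :
    (fun n => amplitude ((hu.memLp 2).toLp u₀) (w n) - revivalCoeff u₀ n) =O[atTop]
      fun n : ℕ => ((n : ℝ)⁻¹) ^ 2 := by
  have hhalf : ∀ᶠ n in atTop, 1 / 2 ≤ ‖toL2 (airyMode (w n))‖ ^ 2 := by
    filter_upwards [hw.bounds] with n ⟨_, h1, _⟩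
    have h := (abs_le.1 (norm_sq_airyMode_sub_one_le (by linarith : 1 ≤ w n))).1
    have : 30 / w n ≤ 30 / 200 := by gcongr
    linarith
  have hN : (fun n => ((‖toL2 (airyMode (w n))‖ ^ 2 : ℝ) : ℂ)⁻¹) =O[atTop]
      fun n : ℕ => ((n : ℝ)⁻¹) ^ 0 := by
    refine IsBigO.of_bound 2 ?_
    filter_upwards [hhalf] with n hn
    rw [norm_inv, Complex.norm_real, Real.norm_of_nonneg (by positivity), pow_zero, norm_one, mul_one,
      inv_le_comm₀ (by linarith) (by norm_num)]
    linarith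
  have h := (isBigO_mul_inv_pow (m := 2) (hw.isBigO_inner_sub hu) hN (by norm_num)).sub
    (isBigO_mul_inv_pow (m := 2) (isBigO_mul_inv_pow (m := 2) (isBigO_revivalCoeff hu)
      hw.isBigO_norm_sq_sub (by norm_num)) hN (by norm_num))
  refine h.congr' ?_ (.refl _ _)
  filter_upwards [hhalf] with n hn
  have hne : ((‖toL2 (airyMode (w n))‖ ^ 2 : ℝ) : ℂ) ≠ 0 :=
    Complex.ofReal_ne_zero.2 (by linarith)
  rw [amplitude, Complex.ofReal_sub]
  field_simp
  push_cast
  ring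

end Coefficients

/-! ### Termwise comparison of the flow with the revival series. -/

/-- The difference between the `n`-th mode of the solution and the `n`-th term of the revival
series. -/
def modeDiff (v : L2I) (u₀ : ℝ → ℝ) (w : ℕ → ℝ) (t : ℝ) (n : ℕ) (x : ℝ) : ℂ :=
  amplitude v (w n) * Complex.exp (Complex.I * (w n : ℂ) ^ 3 * t) * airyMode (w n) x
    - revivalCoeff u₀ n * Complex.exp (Complex.I * (waveNumber n : ℂ) ^ 3 * t)
      * Complex.exp (Complex.I * waveNumber n * x)

/-- A bound of `modeDiff` on `[δ, 1 - δ]`. -/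
def modeDiffBound (v : L2I) (u₀ : ℝ → ℝ) (w : ℕ → ℝ) (t δ : ℝ) (n : ℕ) : ℝ :=
  ‖amplitude v (w n) - revivalCoeff u₀ n‖
    + ‖revivalCoeff u₀ n‖ * (|w n ^ 3 - waveNumber n ^ 3| * |t| + |w n - waveNumber n|)
    + ‖amplitude v (w n)‖ * (4 * Real.exp (-(Real.sqrt 3 / 2 * δ * w n)))

/-- The difference splits into a change of amplitude, a change of phase and the boundary layers; the
distance `δ` from the ends makes the layers exponentially small. -/
theorem norm_modeDiff_le (v : L2I) (u₀ : ℝ → ℝ) {w : ℕ → ℝ} {t δ : ℝ} {n : ℕ} (hw : 1 ≤ w n)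
    (hδ : 0 ≤ δ) {x : ℝ} (hx : x ∈ Icc δ (1 - δ)) :
    ‖modeDiff v u₀ w t n x‖ ≤ modeDiffBound v u₀ w t δ n := by
  have e : modeDiff v u₀ w t n x
      = (amplitude v (w n) - revivalCoeff u₀ n) * (Complex.exp (Complex.I * (w n : ℂ) ^ 3 * t)
          * Complex.exp (Complex.I * w n * x))
        + revivalCoeff u₀ n * (Complex.exp (Complex.I * ((w n ^ 3 * t + w n * x : ℝ) : ℂ))
          - Complex.exp (Complex.I * ((waveNumber n ^ 3 * t + waveNumber n * x : ℝ) : ℂ)))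
        + amplitude v (w n) * (Complex.exp (Complex.I * (w n : ℂ) ^ 3 * t) * layerPart (w n) x) := by
    have e1 : ∀ a : ℝ, Complex.exp (Complex.I * ((a ^ 3 * t + a * x : ℝ) : ℂ))
        = Complex.exp (Complex.I * (a : ℂ) ^ 3 * t) * Complex.exp (Complex.I * a * x) := by
      intro a
      rw [← Complex.exp_add]
      congr 1
      push_cast
      ring
    rw [modeDiff, airyMode_eq, e1, e1]
    ring
  have hx0 : 0 ≤ x := hδ.trans hx.1
  have hx1 : x ≤ 1 := by linarith [hx.2]
  rw [e, modeDiffBound]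
  refine (norm_add₃_le).trans ?_
  simp only [norm_mul, norm_exp_I_mul, norm_exp_I_mul_ofReal, mul_one, one_mul]
  gcongr
  · refine (norm_exp_sub_exp_le _ _).trans ?_
    have e2 : w n ^ 3 * t + w n * x - (waveNumber n ^ 3 * t + waveNumber n * x)
        = (w n ^ 3 - waveNumber n ^ 3) * t + (w n - waveNumber n) * x := by ring
    rw [e2]
    refine (abs_add_le _ _).trans ?_
    rw [abs_mul, abs_mul, abs_of_nonneg hx0]
    gcongr
    exact mul_le_of_le_one_right (abs_nonneg _) hx1
  · refine (norm_layerPart_le hw x).trans ?_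
    have h1 : Real.exp (-(Real.sqrt 3 / 2 * w n * x)) ≤ Real.exp (-(Real.sqrt 3 / 2 * δ * w n)) := by
      have : Real.sqrt 3 / 2 * w n * δ ≤ Real.sqrt 3 / 2 * w n * x :=
        mul_le_mul_of_nonneg_left hx.1 (by positivity)
      exact Real.exp_le_exp.2 (by linarith)
    have h2 : Real.exp (-(Real.sqrt 3 / 2 * w n * (1 - x)))
        ≤ Real.exp (-(Real.sqrt 3 / 2 * δ * w n)) := by
      have : Real.sqrt 3 / 2 * w n * δ ≤ Real.sqrt 3 / 2 * w n * (1 - x) :=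
        mul_le_mul_of_nonneg_left (by linarith [hx.2]) (by positivity)
      exact Real.exp_le_exp.2 (by linarith)
    linarith

/-- Cubing loses a factor `n²`, which the faster than polynomial approach of `w n` to `waveNumber n`
compensates; order `3` is enough here. -/
theorem IsWaveSeq.isBigO_cube_sub {w : ℕ → ℝ} (hw : IsWaveSeq w) :
    (fun n => w n ^ 3 - waveNumber n ^ 3) =O[atTop] fun n : ℕ => ((n : ℝ)⁻¹) ^ 1 := by
  have h1 : (fun n => w n ^ 2 + w n * waveNumber n + waveNumber n ^ 2) =O[atTop]
      fun n : ℕ => (n : ℝ) ^ 2 := by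
    refine IsBigO.of_bound 243 ?_
    filter_upwards [hw.bounds] with n ⟨hn, h200, h2, h3⟩
    obtain ⟨a, b⟩ := le_waveNumber hn
    have hn1 : (1 : ℝ) ≤ n := by exact_mod_cast hn
    have hk : 0 ≤ waveNumber n := by linarith
    have hw0 : 0 ≤ w n := by linarith
    rw [Real.norm_of_nonneg (by positivity), Real.norm_of_nonneg (by positivity)]
    have b1 : w n ^ 2 ≤ (9 * n) ^ 2 := by gcongr
    have b2 : waveNumber n ^ 2 ≤ (9 * n) ^ 2 := by gcongr; linarith
    have b3 : w n * waveNumber n ≤ (9 * n) * (9 * n) := by gcongr; linarith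
    nlinarith
  have h2 := (hw.isBigO_sub 3).mul h1
  refine h2.congr' (.of_forall fun n => by ring) ?_
  filter_upwards [eventually_ge_atTop 1] with n hn
  have hn1 : (n : ℝ) ≠ 0 := by positivity
  field_simp

theorem IsWaveSeq.summable_modeDiffBound {w : ℕ → ℝ} (hw : IsWaveSeq w) {u₀ : ℝ → ℝ}
    (hu : PiecewiseLipschitz u₀) (t : ℝ) {δ : ℝ} (hδ : 0 < δ) :
    Summable (modeDiffBound ((hu.memLp 2).toLp u₀) u₀ w t δ) := by
  have hs : Summable fun n : ℕ => ((n : ℝ)⁻¹) ^ 2 := by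
    simp
  refine summable_of_isBigO_nat hs ?_
  have hd := hw.isBigO_amplitude_sub hu
  have hr := isBigO_revivalCoeff hu
  have ha : (fun n => amplitude ((hu.memLp 2).toLp u₀) (w n)) =O[atTop]
      fun n : ℕ => ((n : ℝ)⁻¹) ^ 0 :=
    ((hd.trans (isBigO_inv_pow_of_le (by norm_num))).add
      (hr.trans (isBigO_inv_pow_of_le (by norm_num)))).congr_left fun n => by ring
  have h2 : (fun n => |w n ^ 3 - waveNumber n ^ 3| * |t| + |w n - waveNumber n|) =O[atTop]
      fun n : ℕ => ((n : ℝ)⁻¹) ^ 1 := by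
    refine IsBigO.add ?_ ((hw.isBigO_sub 1).norm_left)
    exact (hw.isBigO_cube_sub.norm_left.const_mul_left |t|).congr_left fun n => by
      rw [Real.norm_eq_abs, mul_comm]
  have h3 : (fun n => 4 * Real.exp (-(Real.sqrt 3 / 2 * δ * w n))) =O[atTop]
      fun n : ℕ => ((n : ℝ)⁻¹) ^ 2 :=
    (hw.isBigO_exp (c := Real.sqrt 3 / 2 * δ) (by positivity) 2).const_mul_left 4
  have h4 := hr.norm_left.mul h2
  have h5 := ha.norm_left.mul h3
  simp only [← pow_add] at h4 h5
  exact (hd.norm_left.add h4).add h5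

/-! ### The revival series and the continuity of the remainder -/

theorem continuous_const_mul_fun {f : ℝ → ℂ} (hf : Continuous f) (c : ℂ) :
    Continuous fun x => c * f x :=
  continuous_const.mul hf

theorem summable_smul_iff_of_orthonormal {ι : Type*} {e : ι → L2C} (he : Orthonormal ℂ e)
    (a : ι → ℂ) : Summable (fun i => a i • e i) ↔ Summable fun i => ‖a i‖ ^ 2 :=
  he.orthogonalFamily.summable_iff_norm_sq_summable a

theorem smul_toL2 {f : ℝ → ℂ} (hf : Continuous f) (c : ℂ) :
    c • toL2 f = toL2 (fun x => c * f x) := by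
  apply Lp.ext
  filter_upwards [Lp.coeFn_smul c (toL2 f), coeFn_toL2_of_continuous hf,
    coeFn_toL2_of_continuous (continuous_const_mul_fun hf c)] with x h1 h2 h3
  rw [h1, h3, Pi.smul_apply, h2, smul_eq_mul]

theorem toL2_sub {f g : ℝ → ℂ} (hf : Continuous f) (hg : Continuous g) :
    toL2 f - toL2 g = toL2 (fun x => f x - g x) := by
  have hfg : Continuous fun x => f x - g x := hf.sub hg
  apply Lp.ext
  filter_upwards [Lp.coeFn_sub (toL2 f) (toL2 g), coeFn_toL2_of_continuous hf,
    coeFn_toL2_of_continuous hg, coeFn_toL2_of_continuous hfg] with x h1 h2 h3 h4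
  rw [h1, h4, Pi.sub_apply, h2, h3]

/-- The plane wave of wave number `waveNumber n`. -/
def planeWave (n : ℕ) (x : ℝ) : ℂ := Complex.exp (Complex.I * waveNumber n * x)

theorem continuous_planeWave (n : ℕ) : Continuous (planeWave n) := by
  unfold planeWave
  fun_prop

theorem orthonormal_planeWave : Orthonormal ℂ fun n => toL2 (planeWave n) := by
  rw [orthonormal_iff_ite]
  intro m n
  have e : inner ℂ (toL2 (planeWave m)) (toL2 (planeWave n))
      = ∫ x in (0 : ℝ)..1, Complex.exp ((((n : ℤ) - m : ℤ) : ℂ) * (2 * Real.pi * Complex.I) * x) := by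
    rw [inner_toL2_left (memLp_of_continuous (continuous_planeWave m) 2), ← integral_volI]
    refine integral_congr_ae
      ((coeFn_toL2_of_continuous (continuous_planeWave n)).mono fun x hx => ?_)
    simp only [hx, planeWave]
    rw [← Complex.exp_conj, ← Complex.exp_add]
    congr 1
    simp only [map_mul, Complex.conj_I, Complex.conj_ofReal, waveNumber]
    push_cast
    ring
  rw [e]
  split_ifs with h
  · subst h
    simp
  · have h0 : (((n : ℤ) - m : ℤ) : ℂ) * (2 * Real.pi * Complex.I) ≠ 0 := by
      refine mul_ne_zero (Int.cast_ne_zero.2 (by omega)) Complex.two_pi_I_ne_zero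
    rw [integral_exp_mul_complex h0]
    simp [Complex.exp_int_mul_two_pi_mul_I, -Int.cast_sub]

/-- The `n`-th complex term of the revival series. -/
def revivalMode (u₀ : ℝ → ℝ) (t : ℝ) (n : ℕ) : L2C :=
  (revivalCoeff u₀ n * Complex.exp (Complex.I * (waveNumber n : ℂ) ^ 3 * t)) • toL2 (planeWave n)

theorem summable_inv_sq : Summable fun n : ℕ => ((n : ℝ)⁻¹) ^ 2 := by simp

theorem summable_revivalMode {u₀ : ℝ → ℝ} (hu : PiecewiseLipschitz u₀) (t : ℝ) :
    Summable (revivalMode u₀ t) := by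
  refine (summable_smul_iff_of_orthonormal orthonormal_planeWave
    (fun n => revivalCoeff u₀ n * Complex.exp (Complex.I * (waveNumber n : ℂ) ^ 3 * t))).2 ?_
  refine summable_of_isBigO_nat summable_inv_sq ?_
  have h := (isBigO_revivalCoeff hu).norm_left.pow 2
  simp only [pow_one] at h
  exact h.congr_left fun n => by rw [norm_mul, norm_exp_I_mul, mul_one]

theorem revivalTerm_eq (u₀ : ℝ → ℝ) (t : ℝ) (n : ℕ) :
    revivalTerm u₀ t n = (2 : ℝ) • realPart (revivalMode u₀ t n) := by
  apply Lp.ext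
  rw [revivalMode, smul_toL2 (continuous_planeWave n)]
  filter_upwards [(memLp_revivalTermFun u₀ t n).coeFn_toLp, Lp.coeFn_smul (2 : ℝ) (realPart
    (toL2 fun x => revivalCoeff u₀ n * Complex.exp (Complex.I * (waveNumber n : ℂ) ^ 3 * t)
      * planeWave n x)), coeFn_realPart (toL2 fun x => revivalCoeff u₀ n
      * Complex.exp (Complex.I * (waveNumber n : ℂ) ^ 3 * t) * planeWave n x),
    coeFn_toL2_of_continuous (continuous_const_mul_fun (continuous_planeWave n)
      (revivalCoeff u₀ n * Complex.exp (Complex.I * (waveNumber n : ℂ) ^ 3 * t)))]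
    with x h1 h2 h3 h4
  rw [revivalTerm, h1, h2, Pi.smul_apply, h3, h4, revivalTermFun, planeWave, smul_eq_mul]

theorem hasSum_revivalTerm {u₀ : ℝ → ℝ} (hu : PiecewiseLipschitz u₀) (t : ℝ) :
    HasSum (fun n => revivalTerm u₀ t (n + 1))
      ((2 : ℝ) • realPart (∑' n, revivalMode u₀ t (n + 1))) := by
  simp only [revivalTerm_eq]
  exact ((((summable_nat_add_iff 1).2 (summable_revivalMode hu t)).hasSum).mapL realPart).const_smul _

/-- An `L²`-convergent series of continuous functions that converges locally uniformly in `(0,1)`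
has a sum that is continuous there. -/
theorem exists_continuousOn_of_hasSum_toL2 {D : ℕ → ℝ → ℂ} (hD : ∀ n, Continuous (D n)) {v : L2C}
    (hs : HasSum (fun n => toL2 (D n)) v) {b : ℝ → ℕ → ℝ} (hb : ∀ δ, 0 < δ → Summable (b δ))
    (hle : ∀ δ, 0 < δ → ∀ n, ∀ x ∈ Icc δ (1 - δ), ‖D n x‖ ≤ b δ n) :
    ∃ W : ℝ → ℂ, ContinuousOn W (Ioo 0 1) ∧ ∀ᵐ x ∂volI, v x = W x := by
  refine ⟨fun x => ∑' n, D n x, fun x hx => ?_, ?_⟩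
  -- Half the distance to the ends, so that `[δ, 1 - δ]` is a neighbourhood of `x`.
  · have hδ : 0 < min x (1 - x) / 2 := by
      have : 0 < min x (1 - x) := lt_min hx.1 (by linarith [hx.2])
      linarith
    have h1 : min x (1 - x) ≤ x := min_le_left _ _
    have h2 : min x (1 - x) ≤ 1 - x := min_le_right _ _
    have hc := continuousOn_tsum (s := Icc (min x (1 - x) / 2) (1 - min x (1 - x) / 2))
      (fun n => (hD n).continuousOn) (hb _ hδ) (hle _ hδ)
    exact (hc.continuousAt (Icc_mem_nhds (by linarith) (by linarith))).continuousWithinAt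
  -- `L²` convergence gives almost everywhere convergence of a subsequence of partial sums; its
  -- limit is the pointwise sum.
  · obtain ⟨ns, hns, hlim⟩ :=
      (tendstoInMeasure_of_tendsto_Lp hs.tendsto_sum_nat).exists_seq_tendsto_ae
    have hsum : ∀ᵐ x ∂volI, ∀ n, (∑ i ∈ Finset.range n, toL2 (D i) : L2C) x
        = ∑ i ∈ Finset.range n, D i x := by
      rw [ae_all_iff]
      intro n
      have h2 : ∀ᵐ x ∂volI, ∀ i, toL2 (D i) x = D i x :=
        ae_all_iff.2 fun i => coeFn_toL2_of_continuous (hD i)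
      filter_upwards [Lp.coeFn_finsetSum (Finset.range n) (fun i => toL2 (D i)), h2] with x h1 h2
      rw [h1]
      simp [h2]
    filter_upwards [hlim, hsum, ae_volI_mem] with x h1 h2 hx
    simp only [h2] at h1
    have hδ : 0 < min x (1 - x) := lt_min hx.1 (by linarith [hx.2])
    have hsx : Summable fun n => D n x := Summable.of_norm_bounded (hb _ hδ) fun n =>
      hle _ hδ n x ⟨min_le_left _ _, by linarith [min_le_right x (1 - x)]⟩
    exact tendsto_nhds_unique h1 (hsx.hasSum.tendsto_sum_nat.comp hns.tendsto_atTop)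

/-- A sum of modes of bounded wave number lies in the range of the Green operator. -/
theorem exists_greenOp_eq_tsum (v : L2I) (t : ℝ) {S : Set WaveSet} {R : ℝ}
    (hS : ∀ κ ∈ S, (κ : ℝ) ≤ R) :
    ∃ W : L2C, ∑' κ : S, flowCoeff v t κ • unitMode κ = greenOp W := by
  have hf : Summable fun κ => ‖flowCoeff v t κ‖ ^ 2 :=
    (summable_smul_iff_of_orthonormal orthonormal_unitMode (flowCoeff v t)).1
      (hasSum_flow v t).summable
  have ho : Orthonormal ℂ fun κ : S => unitMode κ :=
    orthonormal_unitMode.comp (Subtype.val : S → WaveSet) Subtype.val_injective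
  -- Dividing by the eigenvalue multiplies the coefficients by `-iκ³`, of modulus at most `R³`, so
  -- they stay square summable. Finiteness of `S` is not needed.
  have hW : Summable fun κ : S =>
      (flowCoeff v t κ * (-Complex.I * ((κ : WaveSet) : ℝ) ^ 3)) • unitMode κ := by
    refine (summable_smul_iff_of_orthonormal ho
      fun κ : S => flowCoeff v t κ * (-Complex.I * ((κ : WaveSet) : ℝ) ^ 3)).2 ?_
    refine Summable.of_nonneg_of_le (fun κ => by positivity) (fun κ => ?_)
      ((hf.subtype S).mul_right ((R ^ 3) ^ 2))
    have h0 : (0 : ℝ) < ((κ : WaveSet) : ℝ) := κ.1.2.1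
    have h1 := hS κ κ.2
    simp only [norm_mul, norm_neg, Complex.norm_I, one_mul, norm_pow,
      Complex.norm_real, Real.norm_eq_abs, abs_of_pos h0, mul_pow]
    exact mul_le_mul_of_nonneg_left (by gcongr) (sq_nonneg _)
  refine ⟨∑' κ : S, (flowCoeff v t κ * (-Complex.I * ((κ : WaveSet) : ℝ) ^ 3)) • unitMode κ, ?_⟩
  rw [greenOp.map_tsum hW]
  refine tsum_congr fun κ => ?_
  have h0 : (((κ : WaveSet) : ℝ) : ℂ) ≠ 0 := by exact_mod_cast κ.1.2.1.ne'
  rw [map_smul, greenOp_unitMode, smul_smul]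
  congr 1
  push_cast
  field_simp
  linear_combination (flowCoeff v t κ) * Complex.I_sq

/-- The difference between the flow and the revival series is continuous in `(0,1)`. -/
theorem exists_continuousOn_flow_sub {u₀ : ℝ → ℝ} (hu : PiecewiseLipschitz u₀) (t : ℝ) :
    ∃ W : ℝ → ℂ, ContinuousOn W (Ioo 0 1) ∧
      ∀ᵐ x ∂volI, (flow ((hu.memLp 2).toLp u₀) t - ∑' n, revivalMode u₀ t (n + 1) : L2C) x = W x := by
  obtain ⟨N, w, hN, hw, hsurj, hinj⟩ := exists_wave_enumeration
  set v := (hu.memLp 2).toLp u₀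
  have hseq : IsWaveSeq w := by
    filter_upwards [eventually_ge_atTop N] with n hn
    exact ⟨(hw n hn).1, (hw n hn).2.2.1, (hw n hn).2.2.2⟩
  let i : ℕ → WaveSet := fun m =>
    ⟨w (m + N), by linarith [(hw (m + N) (by omega)).1], (hw (m + N) (by omega)).2.1⟩
  have hi : Function.Injective i := fun a b hab => by
    have := hinj (a + N) (b + N) (by omega) (by omega) (congrArg (fun κ : WaveSet => (κ : ℝ)) hab)
    omega
  have hlow : ∀ κ ∈ (range i)ᶜ, (κ : ℝ) ≤ waveNumber N - 1 := by
    intro κ hκ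
    by_contra! hlt
    obtain ⟨n, hn, e⟩ := hsurj κ hlt κ.2.2
    refine hκ ⟨n - N, Subtype.ext ?_⟩
    simp only [i]
    rw [Nat.sub_add_cancel hn, e]
  obtain ⟨W₀, hW₀⟩ := exists_greenOp_eq_tsum v t hlow
  have hfs := (hasSum_flow v t).summable
  have hflow : flow v t = (∑' m, flowCoeff v t (i m) • unitMode (i m)) + greenOp W₀ := by
    rw [← hW₀, ← (hasSum_flow v t).tsum_eq,
      ← hfs.tsum_subtype_add_tsum_subtype_compl (range i), tsum_range
        (fun κ => flowCoeff v t κ • unitMode κ) hi]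
  have hrs := (summable_nat_add_iff 1).2 (summable_revivalMode hu t)
  have hrN := (summable_nat_add_iff N).2 (summable_revivalMode hu t)
  -- The modes are matched with the revival terms from index `N` on. The revival series starts at
  -- `1`, so `N - 1` terms are left over, a finite continuous sum.
  have hrev : ∑' n, revivalMode u₀ t (n + 1)
      = (∑ n ∈ Finset.range (N - 1), revivalMode u₀ t (n + 1)) + ∑' m, revivalMode u₀ t (m + N) := by
    rw [← hrs.sum_add_tsum_nat_add (N - 1)]
    congr 1
    refine tsum_congr fun m => ?_
    congr 1
    omega
  have hcm : ∀ n, Continuous (airyMode (w n)) := fun n => continuous_expComb _ _ _ _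
  have hcD : ∀ n, Continuous (modeDiff v u₀ w t n) := fun n =>
    (continuous_const.mul (hcm n)).sub (continuous_const.mul (continuous_planeWave n))
  have hD : ∀ m, toL2 (modeDiff v u₀ w t (m + N))
      = flowCoeff v t (i m) • unitMode (i m) - revivalMode u₀ t (m + N) := by
    intro m
    rw [flowCoeff_smul_unitMode, revivalMode, smul_toL2 (continuous_planeWave _),
      smul_toL2 (hcm (m + N)), toL2_sub (continuous_const_mul_fun (hcm (m + N)) _)
        (continuous_const_mul_fun (continuous_planeWave _) _)]
    rfl
  have hsum : HasSum (fun m => toL2 (modeDiff v u₀ w t (m + N)))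
      ((∑' m, flowCoeff v t (i m) • unitMode (i m)) - ∑' m, revivalMode u₀ t (m + N)) := by
    simp only [hD]
    exact (hfs.comp_injective hi).hasSum.sub hrN.hasSum
  obtain ⟨W, hWc, hW⟩ := exists_continuousOn_of_hasSum_toL2 (fun m => hcD (m + N)) hsum
    (b := fun δ m => modeDiffBound v u₀ w t δ (m + N))
    (fun δ hδ => (summable_nat_add_iff N).2 (hseq.summable_modeDiffBound hu t hδ))
    (fun δ hδ m x hx => norm_modeDiff_le v u₀ (by linarith [(hw (m + N) (by omega)).1]) hδ.le hx)
  refine ⟨fun x => W x + greenFun W₀ x - ∑ n ∈ Finset.range (N - 1),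
    revivalCoeff u₀ (n + 1) * Complex.exp (Complex.I * (waveNumber (n + 1) : ℂ) ^ 3 * t)
      * planeWave (n + 1) x, ?_, ?_⟩
  · refine (hWc.add (continuous_greenFun (integrable_coeFn W₀)).continuousOn).sub
      (Continuous.continuousOn ?_)
    exact continuous_finsetSum _ fun n _ => continuous_const_mul_fun (continuous_planeWave _) _
  have hfin : ∀ᵐ x ∂volI, ∀ n, revivalMode u₀ t (n + 1) x
      = revivalCoeff u₀ (n + 1) * Complex.exp (Complex.I * (waveNumber (n + 1) : ℂ) ^ 3 * t)
        * planeWave (n + 1) x := by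
    rw [ae_all_iff]
    intro n
    rw [revivalMode, smul_toL2 (continuous_planeWave _)]
    exact coeFn_toL2_of_continuous (continuous_const_mul_fun (continuous_planeWave _) _)
  have e : flow v t - ∑' n, revivalMode u₀ t (n + 1)
      = ((∑' m, flowCoeff v t (i m) • unitMode (i m)) - ∑' m, revivalMode u₀ t (m + N))
        + greenOp W₀ - ∑ n ∈ Finset.range (N - 1), revivalMode u₀ t (n + 1) := by
    rw [hflow, hrev]
    abel
  rw [e]
  filter_upwards [hW, hfin, coeFn_greenOp W₀,
    Lp.coeFn_finsetSum (Finset.range (N - 1)) (fun n => revivalMode u₀ t (n + 1)),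
    Lp.coeFn_sub (((∑' m, flowCoeff v t (i m) • unitMode (i m)) - ∑' m, revivalMode u₀ t (m + N))
        + greenOp W₀) (∑ n ∈ Finset.range (N - 1), revivalMode u₀ t (n + 1)),
    Lp.coeFn_add ((∑' m, flowCoeff v t (i m) • unitMode (i m)) - ∑' m, revivalMode u₀ t (m + N))
        (greenOp W₀)] with x h1 h2 h3 h4 h5 h6
  rw [h5, Pi.sub_apply, h6, Pi.add_apply, h1, h3, h4, Finset.sum_apply]
  simp only [h2]

theorem exists_continuousOn_solution_sub {u₀ : ℝ → ℝ} (hu : PiecewiseLipschitz u₀)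
    {u : ℝ → L2I} (h : IsAirySolution u₀ u) (t : ℝ) :
    ∃ U : ℝ → ℝ, ContinuousOn U (Ioo 0 1) ∧ ∀ᵐ x ∂volI, u t x = revivalPart u₀ t x + U x := by
  obtain ⟨W, hWc, hW⟩ := exists_continuousOn_flow_sub hu t
  refine ⟨fun x => 2 * (W x).re,
    continuousOn_const.mul (Complex.continuous_re.comp_continuousOn hWc), ?_⟩
  set f := flow ((hu.memLp 2).toLp u₀) t
  set r := ∑' n, revivalMode u₀ t (n + 1)
  have e1 : u t = (2 : ℝ) • realPart f := congrFun (h.eq_airySolution (hu.memLp 2)) t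
  have e2 : revivalPart u₀ t = (2 : ℝ) • realPart r := (hasSum_revivalTerm hu t).tsum_eq
  rw [e1, e2]
  filter_upwards [hW, Lp.coeFn_smul (2 : ℝ) (realPart f), Lp.coeFn_smul (2 : ℝ) (realPart r),
    coeFn_realPart f, coeFn_realPart r, Lp.coeFn_sub f r] with x h1 h2 h3 h4 h5 h6
  rw [h6, Pi.sub_apply] at h1
  rw [h2, h3, Pi.smul_apply, Pi.smul_apply, h4, h5, ← h1, Complex.sub_re, smul_eq_mul, smul_eq_mul]
  ring

/-! ### The revival series at rational times -/

/-- Normalised Haar measure on the unit circle. -/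
abbrev haarU : Measure UnitAddCircle := AddCircle.haarAddCircle (T := (1 : ℝ))

theorem volume_unitAddCircle : (volume : Measure UnitAddCircle) = haarU := by
  have h := AddCircle.volume_eq_smul_haarAddCircle (T := (1 : ℝ))
  rwa [ENNReal.ofReal_one, one_smul] at h

theorem measurePreserving_coe_add (a : ℝ) :
    MeasurePreserving (fun x : ℝ => ((x + a : ℝ) : UnitAddCircle)) volI haarU := by
  have h0 := UnitAddCircle.measurePreserving_mk 0
  rw [zero_add, ← Measure.restrict_congr_set Ioo_ae_eq_Ioc, volume_unitAddCircle] at h0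
  exact (measurePreserving_add_right haarU (a : UnitAddCircle)).comp h0

/-- `Gper u₀` is `G u₀` composed with this map, which transfers square integrability to the circle.
-/
theorem measurePreserving_equivIco :
    MeasurePreserving (fun y : UnitAddCircle => (AddCircle.equivIco 1 0 y : ℝ)) haarU volI := by
  have hm : Measurable fun y : UnitAddCircle => (AddCircle.equivIco 1 0 y : ℝ) :=
    measurable_subtype_coe.comp (AddCircle.measurableEquivIco (1 : ℝ) 0).measurable
  refine ⟨hm, ?_⟩
  have h0 := measurePreserving_coe_add 0
  rw [← h0.map_eq, Measure.map_map hm h0.measurable]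
  conv_rhs => rw [← Measure.map_id (μ := volI)]
  refine Measure.map_congr ?_
  filter_upwards [ae_volI_mem] with x hx
  have hx' : x ∈ Ico (0 : ℝ) (0 + 1) := ⟨hx.1.le, by linarith [hx.2]⟩
  simp only [Function.comp_apply, add_zero, id]
  rw [AddCircle.equivIco_coe_eq hx']

theorem memLp_G {u₀ : ℝ → ℝ} (hu : MemLp u₀ 2 volI) : MemLp (G u₀) 2 volI := by
  have h1 : MemLp (shifted u₀) 2 volI :=
    (hu.add (memLp_const (Function.leftLim u₀ 1))).add (memLp_const (Function.rightLim u₀ 0))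
  have hc : Continuous fun x : ℝ => Complex.exp (Complex.I * Real.pi * x / 3) := by fun_prop
  refine h1.of_le ((Complex.continuous_ofReal.comp_aestronglyMeasurable h1.1).mul
    hc.aestronglyMeasurable) (.of_forall fun x => ?_)
  have e : Complex.I * Real.pi * x / 3 = ((Real.pi * x / 3 : ℝ) : ℂ) * Complex.I := by
    push_cast; ring
  rw [G, norm_mul, Complex.norm_real, e, Complex.norm_exp_ofReal_mul_I, mul_one]

theorem memLp_Gper {u₀ : ℝ → ℝ} (hu : MemLp u₀ 2 volI) : MemLp (Gper u₀) 2 haarU :=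
  (memLp_G hu).comp_measurePreserving measurePreserving_equivIco

theorem fourierCoeff_Gper (u₀ : ℝ → ℝ) (n : ℤ) :
    fourierCoeff (Gper u₀) n
      = ∫ x in (0 : ℝ)..1, Complex.exp (-(2 * Real.pi * Complex.I * n * x)) * G u₀ x := by
  rw [fourierCoeff_eq_intervalIntegral _ _ 0, zero_add, div_one, one_smul]
  refine intervalIntegral.integral_congr_Ioo_of_le zero_le_one fun x hx => ?_
  have hx' : x ∈ Ico (0 : ℝ) 1 := ⟨hx.1.le, hx.2⟩
  rw [Gper, AddCircle.liftIco_zero_coe_apply hx', fourier_coe_apply, smul_eq_mul]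
  congr 2
  push_cast
  ring

theorem fourierCoeff_Gper_zero (u₀ : ℝ → ℝ) : fourierCoeff (Gper u₀) 0 = L₃ u₀ := by
  rw [fourierCoeff_Gper, L₃]
  simp

/-- The factor `e^{iπx/3}` in `G` turns the frequency `(2n - 1/3)π` into `2πn`. -/
theorem fourierCoeff_Gper_natCast (u₀ : ℝ → ℝ) (n : ℕ) :
    fourierCoeff (Gper u₀) n = revivalCoeff u₀ n := by
  rw [fourierCoeff_Gper, revivalCoeff]
  refine intervalIntegral.integral_congr fun x _ => ?_
  simp only [G]
  rw [mul_left_comm, ← Complex.exp_add]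
  congr 2
  rw [waveNumber]
  push_cast
  ring

/-- The function on the circle whose Fourier series is the analytic part, without constant term,
of the series of `g`. -/
def positivePart (g : UnitAddCircle → ℂ) : Lp ℂ 2 haarU :=
  ∑' n : ℕ, fourierCoeff g ((n : ℤ) + 1) • (fourierLp 2 ((n : ℤ) + 1) : Lp ℂ 2 haarU)

theorem hasSum_fourierLp {g : UnitAddCircle → ℂ} (hg : MemLp g 2 haarU) :
    HasSum (fun n : ℤ => fourierCoeff g n • (fourierLp 2 n : Lp ℂ 2 haarU)) (hg.toLp g) := by
  have h := hasSum_fourier_series_L2 (hg.toLp g)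
  have hco : ∀ m : ℤ, fourierCoeff (hg.toLp g) m = fourierCoeff g m := fun m =>
    integral_congr_ae (hg.coeFn_toLp.mono fun x hx => by simp only [hx])
  simpa only [hco] using h

theorem hasSum_positivePart {g : UnitAddCircle → ℂ} (hg : MemLp g 2 haarU) :
    HasSum (fun n : ℕ => fourierCoeff g ((n : ℤ) + 1) • (fourierLp 2 ((n : ℤ) + 1) : Lp ℂ 2 haarU))
      (positivePart g) :=
  ((hasSum_fourierLp hg).summable.comp_injective (i := fun n : ℕ => (n : ℤ) + 1)
    fun a b hab => by simp only at hab; omega).hasSum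

/-- `I • periodicHilbert g` is the positive-frequency part minus the negative one. Adding `g`
doubles the former, cancels the latter and leaves the mean. -/
theorem two_smul_positivePart {g : UnitAddCircle → ℂ} (hg : MemLp g 2 haarU) :
    (2 : ℂ) • positivePart g = hg.toLp g + Complex.I • periodicHilbert g
      - fourierCoeff g 0 • (fourierLp 2 0 : Lp ℂ 2 haarU) := by
  set F : ℤ → Lp ℂ 2 haarU := fun n => fourierCoeff g n • fourierLp 2 n with hF
  have hs : HasSum F (hg.toLp g) := hasSum_fourierLp hg
  have hpos : HasSum (fun n : ℕ => F ((n : ℤ) + 1)) (positivePart g) := hasSum_positivePart hg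
  have hneg : Summable fun n : ℕ => F (-((n : ℤ) + 1)) :=
    hs.summable.comp_injective (i := fun n : ℕ => -((n : ℤ) + 1)) fun a b hab => by
      simp only at hab; omega
  have hH : periodicHilbert g
      = Complex.I • ∑' n : ℕ, (F (-((n : ℤ) + 1)) - F ((n : ℤ) + 1)) := rfl
  have h0 : fourierCoeff g 0 • (fourierLp 2 0 : Lp ℂ 2 haarU) = F 0 := rfl
  rw [h0, hH, (hneg.hasSum.sub hpos).tsum_eq, hs.unique (hpos.of_add_one_of_neg_add_one hneg.hasSum),
    smul_smul, Complex.I_mul_I, neg_one_smul, two_smul]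
  clear_value F
  abel

/-- Two `L²`-convergent series whose terms differ by a fixed factor have sums that differ by that
factor. -/
theorem ae_eq_mul_of_hasSum {P Q : ℕ → L2C} {p q : L2C} (hP : HasSum P p) (hQ : HasSum Q q)
    {φ : ℝ → ℂ} (h : ∀ n, ∀ᵐ x ∂volI, P n x = φ x * Q n x) : ∀ᵐ x ∂volI, p x = φ x * q x := by
  obtain ⟨ns, hns, h1⟩ :=
    (tendstoInMeasure_of_tendsto_Lp hP.tendsto_sum_nat).exists_seq_tendsto_ae
  -- The second subsequence is extracted from the first, so that both series converge almost
  -- everywhere along the same indices.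
  obtain ⟨ms, hms, h2⟩ := (tendstoInMeasure_of_tendsto_Lp
    (hQ.tendsto_sum_nat.comp hns.tendsto_atTop)).exists_seq_tendsto_ae
  have hsum : ∀ R : ℕ → L2C, ∀ᵐ x ∂volI, ∀ n, (∑ i ∈ Finset.range n, R i : L2C) x
      = ∑ i ∈ Finset.range n, R i x := by
    intro R
    rw [ae_all_iff]
    intro n
    filter_upwards [Lp.coeFn_finsetSum (Finset.range n) R] with x hx
    rw [hx, Finset.sum_apply]
  filter_upwards [h1, h2, hsum P, hsum Q, ae_all_iff.2 h] with x h1 h2 h3 h4 h5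
  have h6 := h1.comp hms.tendsto_atTop
  refine tendsto_nhds_unique h6 ((h2.const_mul (φ x)).congr fun n => ?_)
  simp only [Function.comp_apply, h3, h4, h5, Finset.mul_sum]

/-! ### Finite Fourier transform of the rational phases. -/

theorem sum_exp_two_pi_div {q : ℕ} (hq : 0 < q) (j : ℤ) :
    ∑ k ∈ Finset.range q, Complex.exp (2 * Real.pi * Complex.I * (j * k) / q)
      = if (q : ℤ) ∣ j then (q : ℂ) else 0 := by
  have hq0 : (q : ℂ) ≠ 0 := by exact_mod_cast hq.ne'
  have e : ∀ k : ℕ, Complex.exp (2 * Real.pi * Complex.I * (j * k) / q)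
      = Complex.exp (2 * Real.pi * Complex.I * j / q) ^ k := by
    intro k
    rw [← Complex.exp_nat_mul]
    congr 1
    ring
  simp only [e]
  split_ifs with h
  · obtain ⟨c, rfl⟩ := h
    have : Complex.exp (2 * Real.pi * Complex.I * ((q * c : ℤ) : ℂ) / q) = 1 := by
      rw [Complex.exp_eq_one_iff]
      refine ⟨c, ?_⟩
      push_cast
      field_simp
    rw [this]
    simp
  · have h1 : Complex.exp (2 * Real.pi * Complex.I * j / q) ≠ 1 := by
      intro h1
      obtain ⟨c, hc⟩ := Complex.exp_eq_one_iff.1 h1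
      refine h ⟨c, ?_⟩
      have h2 : (j : ℂ) = q * c := by
        field_simp at hc
        exact hc
      exact_mod_cast h2
    rw [geom_sum_eq h1, ← Complex.exp_nat_mul]
    have : (q : ℂ) * (2 * Real.pi * Complex.I * j / q) = j * (2 * Real.pi * Complex.I) := by
      field_simp
    rw [this, Complex.exp_int_mul_two_pi_mul_I, sub_self, zero_div]

/-- The scalars `dCoeff` are the finite Fourier coefficients of `m ↦ e^{2πi(4m³ - 2m²)p/q}`, which
is `q`-periodic because the polynomial has integer coefficients; this is the inversion formula. -/
theorem sum_dCoeff_mul_exp (p : ℕ) {q : ℕ} (hq : 0 < q) (n : ℕ) :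
    ∑ k ∈ Finset.range q, dCoeff p q k * Complex.exp (-(2 * Real.pi * Complex.I * (n * k) / q))
      = Complex.exp (2 * Real.pi * Complex.I * ((4 * (n : ℂ) ^ 3 - 2 * (n : ℂ) ^ 2) * p) / q) := by
  have hq0 : (q : ℂ) ≠ 0 := by exact_mod_cast hq.ne'
  have e : ∀ k : ℕ, dCoeff p q k * Complex.exp (-(2 * Real.pi * Complex.I * (n * k) / q))
      = ∑ m ∈ Finset.range q, 1 / (q : ℂ)
        * Complex.exp (2 * Real.pi * Complex.I * ((4 * (m : ℂ) ^ 3 - 2 * (m : ℂ) ^ 2) * p) / q)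
        * Complex.exp (2 * Real.pi * Complex.I * ((((m : ℤ) - n : ℤ) : ℂ) * k) / q) := by
    intro k
    rw [dCoeff, mul_assoc (1 / (q : ℂ)), Finset.sum_mul, Finset.mul_sum]
    refine Finset.sum_congr rfl fun m _ => ?_
    rw [mul_assoc (1 / (q : ℂ)), ← Complex.exp_add, ← Complex.exp_add]
    congr 2
    push_cast
    ring
  simp only [e]
  rw [Finset.sum_comm]
  simp only [← Finset.mul_sum, sum_exp_two_pi_div hq]
  rw [Finset.sum_eq_single (n % q)]
  · have hd : (q : ℤ) ∣ ((n % q : ℕ) : ℤ) - n :=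
      Int.modEq_iff_dvd.1 (Int.natCast_modEq_iff.2 (Nat.mod_modEq n q)).symm
    rw [if_pos hd]
    obtain ⟨c, hc⟩ := hd
    have hc' : ((n % q : ℕ) : ℂ) = n + q * c := by
      have : (((n % q : ℕ) : ℤ) : ℂ) = ((n + q * c : ℤ) : ℂ) := by
        congr 1
        linarith
      push_cast at this ⊢
      exact this
    rw [hc', mul_right_comm, one_div, inv_mul_cancel₀ hq0, one_mul, Complex.exp_eq_exp_iff_exists_int]
    -- With `P(m) = 4m³ - 2m²`, the witness is `(P(n + qc) - P(n)) p / q`.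
    refine ⟨(4 * (3 * n ^ 2 * c + 3 * n * q * c ^ 2 + q ^ 2 * c ^ 3)
      - 2 * (2 * n * c + q * c ^ 2)) * p, ?_⟩
    push_cast
    field_simp
    ring
  · intro m hm hne
    rw [if_neg, mul_zero]
    intro hd
    refine hne ?_
    have h1 : m ≡ n [MOD q] := (Int.natCast_modEq_iff.1 (Int.modEq_iff_dvd.2 (by
      rw [← neg_sub]; exact (dvd_neg.2 hd) : (q : ℤ) ∣ (n : ℤ) - m)))
    rw [← h1, Nat.mod_eq_of_lt (Finset.mem_range.1 hm)]
  · intro h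
    exact absurd (Finset.mem_range.2 (Nat.mod_lt n hq)) h

/-- This is why the mean `L₃` appears once and without weights. -/
theorem sum_dCoeff (p : ℕ) {q : ℕ} (hq : 0 < q) : ∑ k ∈ Finset.range q, dCoeff p q k = 1 := by
  simpa using sum_dCoeff_mul_exp p hq 0

/-- Pull-back of functions on the circle along `x ↦ x + a`. -/
def pullback (a : ℝ) : Lp ℂ 2 haarU →L[ℂ] L2C :=
  (Lp.compMeasurePreservingₗᵢ ℂ _ (measurePreserving_coe_add a)).toContinuousLinearMap

theorem coeFn_pullback (a : ℝ) (f : Lp ℂ 2 haarU) :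
    ∀ᵐ x ∂volI, pullback a f x = f ((x + a : ℝ) : UnitAddCircle) :=
  Lp.coeFn_compMeasurePreserving f (measurePreserving_coe_add a)

theorem ae_coe_add {P : UnitAddCircle → Prop} (h : ∀ᵐ y ∂haarU, P y) (a : ℝ) :
    ∀ᵐ x ∂volI, P ((x + a : ℝ) : UnitAddCircle) :=
  (measurePreserving_coe_add a).quasiMeasurePreserving.ae h

theorem coeFn_pullback_fourierLp (a : ℝ) (n : ℤ) : ∀ᵐ x ∂volI,
    pullback a (fourierLp 2 n) x = Complex.exp (2 * Real.pi * Complex.I * n * (x + a)) := by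
  filter_upwards [coeFn_pullback a (fourierLp 2 n), ae_coe_add (coeFn_fourierLp 2 n) a]
    with x h1 h2
  rw [h1, h2, fourier_coe_apply]
  congr 1
  push_cast
  ring

/-- Here `(2n - 1/3)³π³t = π(8n³ - 4n² + 2n/3 - 1/27)p/q`. The first two terms give the translations
by `k/q`, the third the translation by `p/(3q)`, and the last joins `e^{-iπx/3}` in the common
factor. -/
theorem exp_rational_time (p : ℕ) {q : ℕ} (hq : 0 < q) (n : ℕ) (x : ℝ) :
    Complex.exp (Complex.I * (waveNumber n : ℂ) ^ 3 * ((p : ℝ) / ((q : ℝ) * Real.pi ^ 2) : ℝ))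
        * planeWave n x
      = Complex.exp (-Complex.I * (Real.pi / 27) * (9 * (x : ℂ) + (p : ℂ) / (q : ℂ)))
        * ∑ k ∈ Finset.range q, dCoeff p q k * Complex.exp
          (2 * Real.pi * Complex.I * (n : ℤ) * (x + ((p / (3 * q) - k / q : ℝ) : ℂ))) := by
  have hq0 : (q : ℂ) ≠ 0 := by exact_mod_cast hq.ne'
  have hpi : (Real.pi : ℂ) ≠ 0 := by exact_mod_cast Real.pi_ne_zero
  have e : ∀ k : ℕ, dCoeff p q k * Complex.exp
      (2 * Real.pi * Complex.I * (n : ℤ) * (x + ((p / (3 * q) - k / q : ℝ) : ℂ)))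
      = Complex.exp (2 * Real.pi * Complex.I * n * (x + p / (3 * q)))
        * (dCoeff p q k * Complex.exp (-(2 * Real.pi * Complex.I * (n * k) / q))) := by
    intro k
    rw [mul_left_comm, ← Complex.exp_add]
    congr 2
    push_cast
    ring
  simp only [e]
  rw [← Finset.mul_sum, sum_dCoeff_mul_exp p hq n, planeWave, ← Complex.exp_add, ← Complex.exp_add,
    ← Complex.exp_add]
  congr 1
  rw [waveNumber]
  push_cast
  field_simp
  ring

theorem revivalPart_rational_time {u₀ : ℝ → ℝ} (hu : PiecewiseLipschitz u₀) (p : ℕ) {q : ℕ}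
    (hq : 0 < q) :
    ∀ᵐ x ∂volI, revivalPart u₀ ((p : ℝ) / ((q : ℝ) * Real.pi ^ 2)) x =
      (Complex.exp (-Complex.I * (Real.pi / 27) * (9 * (x : ℂ) + (p : ℂ) / (q : ℂ))) *
        (L₁ u₀ p q x + Complex.I * L₂ u₀ p q x - L₃ u₀)).re := by
  set t : ℝ := (p : ℝ) / ((q : ℝ) * Real.pi ^ 2)
  let a : ℕ → ℝ := fun k => p / (3 * q) - k / q
  set g := Gper u₀
  have hg : MemLp g 2 haarU := memLp_Gper (hu.memLp 2)
  have hP := ((summable_nat_add_iff 1).2 (summable_revivalMode hu t)).hasSum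
  have hQ : HasSum (fun n : ℕ => ∑ k ∈ Finset.range q, dCoeff p q k • pullback (a k)
      (fourierCoeff g ((n : ℤ) + 1) • (fourierLp 2 ((n : ℤ) + 1) : Lp ℂ 2 haarU)))
      (∑ k ∈ Finset.range q, dCoeff p q k • pullback (a k) (positivePart g)) :=
    hasSum_sum fun k _ => ((hasSum_positivePart hg).mapL (pullback (a k))).const_smul _
  -- The factor `φ` depends on `x` but not on `n`, so it can be taken out of the `L²` sum; the rest
  -- is the series of translates of the positive-frequency part.
  have key := ae_eq_mul_of_hasSum hP hQ
    (φ := fun x => Complex.exp (-Complex.I * (Real.pi / 27) * (9 * (x : ℂ) + (p : ℂ) / (q : ℂ))))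
    fun n => by
      have h1 : ∀ᵐ x ∂volI, revivalMode u₀ t (n + 1) x = revivalCoeff u₀ (n + 1)
          * Complex.exp (Complex.I * (waveNumber (n + 1) : ℂ) ^ 3 * t) * planeWave (n + 1) x := by
        rw [revivalMode, smul_toL2 (continuous_planeWave _)]
        exact coeFn_toL2_of_continuous (continuous_const_mul_fun (continuous_planeWave _) _)
      have h2 : ∀ᵐ x ∂volI, ∀ k, (dCoeff p q k • pullback (a k) (fourierCoeff g ((n : ℤ) + 1)
          • (fourierLp 2 ((n : ℤ) + 1) : Lp ℂ 2 haarU)) : L2C) x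
          = fourierCoeff g ((n : ℤ) + 1) * (dCoeff p q k * Complex.exp
            (2 * Real.pi * Complex.I * ((n + 1 : ℕ) : ℤ) * (x + (a k : ℂ)))) := by
        rw [ae_all_iff]
        intro k
        rw [map_smul, smul_smul]
        filter_upwards [coeFn_pullback_fourierLp (a k) ((n : ℤ) + 1), Lp.coeFn_smul
          (dCoeff p q k * fourierCoeff g ((n : ℤ) + 1)) (pullback (a k) (fourierLp 2 ((n : ℤ) + 1)))]
          with x h1 h2
        rw [h2, Pi.smul_apply, h1, smul_eq_mul]
        push_cast
        ring
      filter_upwards [h1, h2, Lp.coeFn_finsetSum (Finset.range q) fun k => dCoeff p q k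
        • pullback (a k) (fourierCoeff g ((n : ℤ) + 1) • (fourierLp 2 ((n : ℤ) + 1) : Lp ℂ 2 haarU))]
        with x h1 h2 h3
      rw [h1, h3, Finset.sum_apply, mul_assoc, exp_rational_time p hq]
      simp only [h2]
      have hco : fourierCoeff g ((n : ℤ) + 1) = revivalCoeff u₀ (n + 1) := by
        exact_mod_cast fourierCoeff_Gper_natCast u₀ (n + 1)
      rw [← Finset.mul_sum, hco]
      exact mul_left_comm _ _ _
  have hR : ∀ᵐ x ∂volI, ∀ k, 2 * pullback (a k) (positivePart g) x
      = g (shiftPoint p q k x : UnitAddCircle)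
        + Complex.I * periodicHilbert g (shiftPoint p q k x : UnitAddCircle) - L₃ u₀ := by
    rw [ae_all_iff]
    intro k
    have hs : ∀ x, shiftPoint p q k x = x + a k := fun x => by rw [shiftPoint]; ring
    have hc : ∀ᵐ y ∂haarU, 2 * positivePart g y
        = g y + Complex.I * periodicHilbert g y - L₃ u₀ := by
      have e := two_smul_positivePart hg
      filter_upwards [Lp.coeFn_smul (2 : ℂ) (positivePart g),
        Lp.coeFn_sub (hg.toLp g + Complex.I • periodicHilbert g)
          (fourierCoeff g 0 • (fourierLp 2 0 : Lp ℂ 2 haarU)),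
        Lp.coeFn_add (hg.toLp g) (Complex.I • periodicHilbert g),
        Lp.coeFn_smul Complex.I (periodicHilbert g), hg.coeFn_toLp,
        Lp.coeFn_smul (fourierCoeff g 0) (fourierLp 2 0 : Lp ℂ 2 haarU),
        coeFn_fourierLp (T := (1 : ℝ)) 2 0] with y h1 h2 h3 h4 h5 h6 h7
      rw [Pi.smul_apply, smul_eq_mul] at h1
      rw [← h1, e, h2, Pi.sub_apply, h3, Pi.add_apply, h4, h5, h6, Pi.smul_apply, Pi.smul_apply, h7,
        fourier_zero, smul_eq_mul, smul_eq_mul, mul_one, fourierCoeff_Gper_zero]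
    filter_upwards [coeFn_pullback (a k) (positivePart g), ae_coe_add hc (a k)] with x h1 h2
    rw [h1, h2, hs]
  have hS : ∀ᵐ x ∂volI, ∀ k, (dCoeff p q k • pullback (a k) (positivePart g) : L2C) x
      = dCoeff p q k * pullback (a k) (positivePart g) x :=
    ae_all_iff.2 fun k => Lp.coeFn_smul _ _
  have e2 : revivalPart u₀ t = (2 : ℝ) • realPart (∑' n, revivalMode u₀ t (n + 1)) :=
    (hasSum_revivalTerm hu t).tsum_eq
  rw [e2]
  filter_upwards [key, hR, hS, Lp.coeFn_finsetSum (Finset.range q)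
      (fun k => dCoeff p q k • pullback (a k) (positivePart g)),
    Lp.coeFn_smul (2 : ℝ) (realPart (∑' n, revivalMode u₀ t (n + 1))),
    coeFn_realPart (∑' n, revivalMode u₀ t (n + 1))] with x h1 h2 h3 h4 h5 h6
  have e3 : 2 * ∑ k ∈ Finset.range q, dCoeff p q k * pullback (a k) (positivePart g) x
      = L₁ u₀ p q x + Complex.I * L₂ u₀ p q x - L₃ u₀ := by
    have e4 : ∀ k, 2 * (dCoeff p q k * pullback (a k) (positivePart g) x)
        = dCoeff p q k * g (shiftPoint p q k x : UnitAddCircle)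
          + Complex.I * (dCoeff p q k * periodicHilbert g (shiftPoint p q k x : UnitAddCircle))
          - dCoeff p q k * L₃ u₀ := fun k => by
      rw [mul_left_comm, h2]
      ring
    rw [Finset.mul_sum]
    simp only [e4]
    rw [Finset.sum_sub_distrib, Finset.sum_add_distrib, ← Finset.mul_sum, ← Finset.sum_mul,
      sum_dCoeff p hq, one_mul, L₁, L₂]
  rw [h5, Pi.smul_apply, h6, h1, h4, Finset.sum_apply]
  simp only [h3]
  rw [← e3, mul_left_comm, smul_eq_mul, ← Complex.re_ofReal_mul]
  norm_num

end
end AiryRevival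

theorem theorem2p1 (u₀ : ℝ → ℝ) (hu₀ : AiryRevival.PiecewiseLipschitz u₀) :
    -- the boundary value problem has exactly one solution
    (∃! u : ℝ → AiryRevival.L2I, AiryRevival.IsAirySolution u₀ u) ∧
    -- the series that defines `U_R` converges at all times
    (∀ t : ℝ, Summable fun n : ℕ => AiryRevival.revivalTerm u₀ t (n + 1)) ∧
    -- the solution is `U_R + U_C` with `U_C(·,t)` continuous on `(0,1)`
    (∀ u : ℝ → AiryRevival.L2I, AiryRevival.IsAirySolution u₀ u →
      ∀ t : ℝ, ∃ U_C : ℝ → ℝ, ContinuousOn U_C (Set.Ioo 0 1) ∧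
        ∀ᵐ x ∂AiryRevival.volI, u t x = AiryRevival.revivalPart u₀ t x + U_C x) ∧
    -- the form of `U_R` at rational times
    (∀ p q : ℕ, 0 < q → Nat.Coprime p q →
      ∀ᵐ x ∂AiryRevival.volI,
        AiryRevival.revivalPart u₀ ((p : ℝ) / ((q : ℝ) * Real.pi ^ 2)) x =
          (Complex.exp (-Complex.I * (Real.pi / 27) * (9 * (x : ℂ) + (p : ℂ) / (q : ℂ))) *
            (AiryRevival.L₁ u₀ p q x + Complex.I * AiryRevival.L₂ u₀ p q x
              - AiryRevival.L₃ u₀)).re) :=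
  ⟨AiryRevival.existsUnique_isAirySolution (hu₀.memLp 2),
    fun t => (AiryRevival.hasSum_revivalTerm hu₀ t).summable,
    fun _ hu t => AiryRevival.exists_continuousOn_solution_sub hu₀ hu t,
    fun p _ hq _ => AiryRevival.revivalPart_rational_time hu₀ p hq⟩
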